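/- Let $q\in\mathbb{C}^\times$ be a root of unity, let $l\ge 2$ be the least positive integer with $q^{2l}=1$, and put $\delta=q+q^{-1}$. Let $TL_n=TL_n(\delta)$ be the Temperley–Lieb algebra over $\mathbb{C}$ with generators $e_1,\dots,e_{n-1}$, and let $TL_\infty=\bigcup_n TL_n$. For $0\le p\le\lfloor n/2\rfloor$ let $\mathcal V_{n,p}$ be the standard representation of $TL_n$ on $(n,p)$-link states ($p$ non-crossing cups and $n-2p$ through strands), with matrix trace $t_{n,p}$. Let $\mathcal L_{n,p}$ be its irreducible quotient, with matrix trace $l_{n,p}$; here, if $\delta=0$ and $n>0$ is even, the index $p=n/2$ is omitted, since then there is no $\mathcal L_{n,n/2}$. A normalized trace on $TL_\infty$ is a linear functional $\chi$ with $\chi(ab)=\chi(ba)$ and $\chi(1)=1$. Call it extremal if it is an extreme point of the convex set of those normalized traces whose restriction to each $TL_n$ is a combination with non-negative coefficients of the standard traces $t_{n,p}$ $(0\le p\le\lfloor n/2\rfloor)$, or an extreme point of the analogous convex set defined with the irreducible traces $l_{n,p}$ in place of the $t_{n,p}$. For a number $\gamma$ define the generic coefficients $c_{n,i}=c_{n,i}(\gamma)$,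 $0\le i\le\lfloor n/2\rfloor$, by $$c_{0,0}=c_{1,0}=1,\qquad c_{n,0}=c_{n-1,0}-\gamma\,c_{n-2,0}\ (n\ge2),\qquad c_{n,i}=\gamma^i c_{n-2i,0}.$$ Equivalently $c_{n,0}=[n+1]_r/[2]_r^{\,n}$ when $\gamma=[2]_r^{-2}$, where $[k]_r=(r^k-r^{-k})/(r-r^{-1})$. These are the coefficients of the generic extremal traces. Let $\chi=\chi_{\infty,l}$ be extremal, in either sense. Then $\chi$ has an expansion $\chi|_{TL_n}=\sum_i\lambda_{n,i}\,l_{n,i}$ for all $n\ge0$, and there is a real number $\gamma\ge0$ (with $\gamma\le\frac14$ if $\chi$ is extremal in the first sense) such that $\chi|_{TL_n}=\sum_i c_{n,i}(\gamma)\,t_{n,i}$ for all $n\ge0$ and such that, for every such family of coefficients $\lambda_{n,i}$: - if $l=2$, then $\lambda_{2n+1,n}=c_{2n+1,n}(\gamma)$ for all $n\ge0$; - if $l\ge3$, then $\lambda_{2n,n}=c_{2n,n}(\gamma)$ for all $n\ge0$. -/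

import Mathlib

noncomputable section

/-! ### The Temperley-Lieb algebras -/

/-- The Temperley-Lieb relations with loop parameter `δ` on generators indexed by a set `S` of
natural numbers. The index `i` stands for the generator usually written `e_{i+1}`, which joins the
neighbouring points `i` and `i + 1` (points being counted from `0`). -/
inductive TLRel (δ : ℂ) (S : Set ℕ) : FreeAlgebra ℂ S → FreeAlgebra ℂ S → Prop
  | sq (i : S) :
      TLRel δ S (FreeAlgebra.ι ℂ i * FreeAlgebra.ι ℂ i) (δ • FreeAlgebra.ι ℂ i)
  | braid (i j : S) (h : (i : ℕ) + 1 = j ∨ (j : ℕ) + 1 = i) :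
      TLRel δ S (FreeAlgebra.ι ℂ i * FreeAlgebra.ι ℂ j * FreeAlgebra.ι ℂ i) (FreeAlgebra.ι ℂ i)
  | comm (i j : S) (h : (i : ℕ) + 1 < j ∨ (j : ℕ) + 1 < i) :
      TLRel δ S (FreeAlgebra.ι ℂ i * FreeAlgebra.ι ℂ j) (FreeAlgebra.ι ℂ j * FreeAlgebra.ι ℂ i)

/-- Indices of the `n - 1` generators of the Temperley-Lieb algebra on `n` strands. -/
abbrev TLIndex (n : ℕ) : Set ℕ := {i | i + 1 < n}

/-- The Temperley-Lieb algebra `TL_n(δ)`. -/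
abbrev TL (δ : ℂ) (n : ℕ) : Type := RingQuot (TLRel δ (TLIndex n))

/-- The infinite Temperley-Lieb algebra `TL_∞(δ)`, the union (direct limit) of the `TL_n(δ)`:
all generators `e_1, e_2, …` with all Temperley-Lieb relations among them. -/
abbrev TLInf (δ : ℂ) : Type := RingQuot (TLRel δ Set.univ)

/-- The inclusion `TL_n(δ) → TL_∞(δ)`, sending each generator to the generator of the same name. -/
def TL.incl (δ : ℂ) (n : ℕ) : TL δ n →ₐ[ℂ] TLInf δ :=
  RingQuot.liftAlgHom ℂ ⟨FreeAlgebra.lift ℂ fun i : TLIndex n =>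
    RingQuot.mkAlgHom ℂ (TLRel δ Set.univ) (FreeAlgebra.ι ℂ ⟨i, trivial⟩), by
      intro x y h
      induction h with
      | sq i =>
        simpa using RingQuot.mkAlgHom_rel ℂ (TLRel.sq (δ := δ) (S := Set.univ) ⟨i, trivial⟩)
      | braid i j h =>
        simpa using RingQuot.mkAlgHom_rel ℂ
          (TLRel.braid (δ := δ) (S := Set.univ) ⟨i, trivial⟩ ⟨j, trivial⟩ h)
      | comm i j h =>
        simpa using RingQuot.mkAlgHom_rel ℂ
          (TLRel.comm (δ := δ) (S := Set.univ) ⟨i, trivial⟩ ⟨j, trivial⟩ h)⟩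

/-! ### Link states and the standard representations -/

/-- An `(n, p)`-link state: `p` non-crossing cups and `n - 2p` through strands on the points
`0, …, n - 1`. It is recorded as an involution `f`: the point `a` is joined to `f a` by a cup if
`f a ≠ a`, and carries a through strand if `f a = a`. The second condition says that below a cup
joining `a` and `f a` there are no through strands, and that no cup crosses it. -/
def LinkState (n p : ℕ) : Type :=
  {f : Fin n → Fin n // (∀ a, f (f a) = a) ∧
    (∀ a b, a < b → b < f a → f b ≠ b ∧ a < f b ∧ f b < f a) ∧
    (Finset.univ.filter fun a => f a = a).card + 2 * p = n}

/-- Apply a cap to the points `a`, `b` of `f`, and insert a new cup there: the partners of `a` and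
`b` get joined, or, if one of `a`, `b` carries a through strand, the partner of the other one
receives this through strand. -/
def glue {α : Type*} [DecidableEq α] (f : α → α) (a b : α) (x : α) : α :=
  if x = a then b else if x = b then a
  else if f x = a then (if f b = b then x else f b)
  else if f x = b then (if f a = a then x else f a)
  else f x

theorem glue_invol {α : Type*} [DecidableEq α] {f : α → α} (hf : ∀ x, f (f x) = x) {a b : α}
    (hab : a ≠ b) (h1 : f a ≠ b) (h2 : ¬ (f a = a ∧ f b = b)) (x : α) :
    glue f a b (glue f a b x) = x := by
  have := hf x
  have := hf a
  have := hf b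
  grind [glue]

theorem glue_card {α : Type*} [DecidableEq α] [Fintype α] {f : α → α} (hf : ∀ x, f (f x) = x)
    {a b : α} (hab : a ≠ b) (h1 : f a ≠ b) (h2 : ¬ (f a = a ∧ f b = b)) :
    (Finset.univ.filter fun x => glue f a b x = x).card =
      (Finset.univ.filter fun x => f x = x).card := by
  symm
  refine Finset.card_nbij' (fun x => if x = a then f b else if x = b then f a else x)
    (fun y => if f y = b then a else if f y = a then b else y) ?_ ?_ ?_ ?_
  all_goals
    intro x hx
    have := hf x
    have := hf a
    have := hf b
    simp only [Finset.coe_filter, Finset.mem_univ, true_and, Set.mem_ofPred_eq] at hx ⊢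
    grind [glue]

theorem glue_nested {n : ℕ} {f : Fin n → Fin n} (hf : ∀ x, f (f x) = x)
    (hn : ∀ a b, a < b → b < f a → f b ≠ b ∧ a < f b ∧ f b < f a)
    {a b : Fin n} (hab : (a : ℕ) + 1 = b) (h1 : f a ≠ b)
    (x y : Fin n) (hxy : x < y) (hy : y < glue f a b x) :
    glue f a b y ≠ y ∧ x < glue f a b y ∧ glue f a b y < glue f a b x := by
  have ha := hf a
  have hb := hf b
  have hx := hf x
  have hy' := hf y
  have nxy := hn x y
  have nxa := hn x a
  have nxb := hn x b
  have nay := hn a y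
  have nby := hn b y
  have nax := hn a x
  have nbx := hn b x
  have nfay := hn (f a) y
  have nfby := hn (f b) y
  have nya := hn y a
  have nyb := hn y b
  have nfya := hn (f y) a
  have nfyb := hn (f y) b
  have nfab := hn (f a) b
  have nfba := hn (f b) a
  have nfayy := hn (f y) x
  have m1 := hn a (f x)
  have m2 := hn b (f x)
  have m3 := hn a (f y)
  have m4 := hn b (f y)
  have m5 := hn x (f a)
  have m6 := hn x (f b)
  have m7 := hn y (f a)
  have m8 := hn y (f b)
  have m9 := hn x (f y)
  simp only [hf] at nfay nfby nfya nfyb nfab nfba nfayy m1 m2 m3 m4 m5 m6 m7 m8 m9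
  clear hn hf
  unfold glue at *
  split_ifs at hy <;> grind (splits := 30)

section
variable {α : Type*} [DecidableEq α] {f : α → α} {a b c d : α}

theorem glue_braid (hf : ∀ x, f (f x) = x) (hab : a ≠ b) (hcd : c ≠ d)
    (h : (b = c ∧ a ≠ d) ∨ (d = a ∧ b ≠ c)) (hw : f a = b) :
    glue (glue f c d) a b = f ∧ glue f c d a ≠ b ∧
      ¬ (glue f c d a = a ∧ glue f c d b = b) := by
  have ha := hf a
  have hb := hf b
  have hc := hf c
  have hd := hf d
  refine ⟨?_, ?_, ?_⟩
  · funext x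
    have hx := hf x
    rcases h with ⟨rfl, h⟩ | ⟨rfl, h⟩
    · simp only [glue]
      grind
    · simp only [glue]
      grind
  · grind [glue]
  · grind [glue]

theorem glue_comm (hf : ∀ x, f (f x) = x) (hab : a ≠ b) (hcd : c ≠ d)
    (h : a ≠ c ∧ a ≠ d ∧ b ≠ c ∧ b ≠ d) (h1 : f a ≠ b) (h2 : ¬ (f a = a ∧ f b = b))
    (h3 : f c ≠ d) (h4 : ¬ (f c = c ∧ f d = d)) :
    (glue f c d a = b → glue f a b c = d ∧ glue f c d = glue f a b) ∧
    (glue f c d a = a ∧ glue f c d b = b → glue f a b c = c ∧ glue f a b d = d) ∧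
    (glue f c d a ≠ b → ¬ (glue f c d a = a ∧ glue f c d b = b) →
      glue (glue f c d) a b = glue (glue f a b) c d) := by
  have ha := hf a
  have hb := hf b
  have hc := hf c
  have hd := hf d
  refine ⟨?_, ?_, ?_⟩
  · intro g
    refine ⟨by grind [glue], ?_⟩
    have g' : (f a = c ∧ f b = d) ∨ (f a = d ∧ f b = c) := by grind [glue]
    funext x
    have hx := hf x
    clear g
    simp only [glue]
    grind
  · grind [glue]
  · intro g1 g2
    have k1 : ¬ (f a = c ∧ f b = d) := by grind [glue]
    have k2 : ¬ (f a = d ∧ f b = c) := by grind [glue]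
    have k3 : ¬ (f a = c ∧ f b = b ∧ f d = d) := by grind [glue]
    have k4 : ¬ (f a = d ∧ f b = b ∧ f c = c) := by grind [glue]
    have k5 : ¬ (f b = c ∧ f a = a ∧ f d = d) := by grind [glue]
    have k6 : ¬ (f b = d ∧ f a = a ∧ f c = c) := by grind [glue]
    clear g1 g2
    funext x
    have hx := hf x
    have hfi : ∀ y z, f y = z → f z = y := fun y z h => h ▸ hf y
    simp only [glue]
    by_cases x1 : x = a
    · subst x1; grind
    by_cases x2 : x = b
    · subst x2; grind
    by_cases x3 : x = c
    · subst x3; grind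
    by_cases x4 : x = d
    · subst x4; grind
    by_cases y1 : f x = a
    · grind
    by_cases y2 : f x = b
    · grind
    by_cases y3 : f x = c
    · grind
    by_cases y4 : f x = d
    · grind
    grind
end

namespace LinkState

variable {n p : ℕ}

instance : Finite (LinkState n p) := Subtype.finite

/-- The link state `glue w.1 a b`, for neighbouring points `a`, `b` that are neither joined to each
other nor both ends of through strands. -/
def join (w : LinkState n p) (a b : Fin n) (hab : (a : ℕ) + 1 = b) (h1 : w.1 a ≠ b)
    (h2 : ¬ (w.1 a = a ∧ w.1 b = b)) : LinkState n p :=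
  have hne : a ≠ b := by intro h; simp [h] at hab
  ⟨glue w.1 a b, glue_invol w.2.1 hne h1 h2, glue_nested w.2.1 w.2.2.1 hab h1, by
    rw [glue_card w.2.1 hne h1 h2]; exact w.2.2.2⟩

/-- Vertical concatenation of the generator `e` that joins the neighbouring points `a`, `b` with a
link state: a closed circle is replaced by `δ`, and the result is zero if two through strands get
connected (so that there would be more than `p` cups). -/
def act (δ : ℂ) (a b : Fin n) (hab : (a : ℕ) + 1 = b) (w : LinkState n p) : LinkState n p →₀ ℂ :=
  if h1 : w.1 a = b then Finsupp.single w δ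
  else if h2 : w.1 a = a ∧ w.1 b = b then 0
  else Finsupp.single (w.join a b hab h1 h2) 1

/-- The linear extension of `act` to the space of formal combinations of link states. -/
def lact (p : ℕ) (δ : ℂ) (a b : Fin n) (hab : (a : ℕ) + 1 = b) :
    Module.End ℂ (LinkState n p →₀ ℂ) :=
  Finsupp.linearCombination ℂ (act δ a b hab)

theorem lact_single (δ : ℂ) (a b : Fin n) (hab : (a : ℕ) + 1 = b) (w : LinkState n p) (c : ℂ) :
    lact p δ a b hab (Finsupp.single w c) = c • act δ a b hab w := by
  simp [lact]

theorem lact_arc (δ : ℂ) (a b : Fin n) (hab : (a : ℕ) + 1 = b) (w : LinkState n p) (c : ℂ)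
    (h : w.1 a = b) :
    lact p δ a b hab (Finsupp.single w c) = Finsupp.single w (c * δ) := by
  rw [lact_single, act, dif_pos h, Finsupp.smul_single, smul_eq_mul]

theorem lact_zero (δ : ℂ) (a b : Fin n) (hab : (a : ℕ) + 1 = b) (w : LinkState n p) (c : ℂ)
    (h : w.1 a = a ∧ w.1 b = b) :
    lact p δ a b hab (Finsupp.single w c) = 0 := by
  have h1 : w.1 a ≠ b := by rw [h.1]; intro h; simp [h] at hab
  rw [lact_single, act, dif_neg h1, dif_pos h, smul_zero]

theorem lact_join (δ : ℂ) (a b : Fin n) (hab : (a : ℕ) + 1 = b) (w : LinkState n p) (c : ℂ)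
    (h1 : w.1 a ≠ b) (h2 : ¬ (w.1 a = a ∧ w.1 b = b)) :
    lact p δ a b hab (Finsupp.single w c) = Finsupp.single (w.join a b hab h1 h2) c := by
  rw [lact_single, act, dif_neg h1, dif_neg h2, Finsupp.smul_single, smul_eq_mul, mul_one]

/-- Two maps agree after `lact` if they agree on the link states with a cup at `a`, `b`. -/
theorem lact_image (δ : ℂ) (a b : Fin n) (hab : (a : ℕ) + 1 = b)
    {F G : Module.End ℂ (LinkState n p →₀ ℂ)}
    (h : ∀ w : LinkState n p, w.1 a = b → F (Finsupp.single w 1) = G (Finsupp.single w 1)) :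
    F * lact p δ a b hab = G * lact p δ a b hab := by
  have h' : ∀ (w : LinkState n p) (c : ℂ), w.1 a = b →
      F (Finsupp.single w c) = G (Finsupp.single w c) := by
    intro w c hw
    have := congrArg (c • ·) (h w hw)
    simpa only [← map_smul, Finsupp.smul_single, smul_eq_mul, mul_one] using this
  refine Finsupp.lhom_ext fun w c => ?_
  simp only [Module.End.mul_apply]
  by_cases h1 : w.1 a = b
  · rw [lact_arc _ _ _ _ _ _ h1, h' _ _ h1]
  by_cases h2 : w.1 a = a ∧ w.1 b = b
  · rw [lact_zero _ _ _ _ _ _ h2, map_zero, map_zero]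
  · rw [lact_join _ _ _ _ _ _ h1 h2, h' _ _ (by simp [join, glue])]

theorem lact_sq (δ : ℂ) (a b : Fin n) (hab : (a : ℕ) + 1 = b) :
    lact p δ a b hab * lact p δ a b hab = δ • lact p δ a b hab := by
  rw [lact_image δ a b hab (G := δ • 1), smul_mul_assoc, one_mul]
  intro w hw
  simp [lact_arc _ _ _ _ _ _ hw]

theorem lact_braid (δ : ℂ) (a b c d : Fin n) (hab : (a : ℕ) + 1 = b) (hcd : (c : ℕ) + 1 = d)
    (h : b = c ∨ d = a) :
    lact p δ a b hab * lact p δ c d hcd * lact p δ a b hab = lact p δ a b hab := by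
  rw [lact_image δ a b hab (G := 1), one_mul]
  intro w hw
  have hf := w.2.1
  have ha := hf a
  have h1 : w.1 c ≠ d := by grind
  have h2 : ¬ (w.1 c = c ∧ w.1 d = d) := by grind
  obtain ⟨g1, g2, g3⟩ := glue_braid (c := c) (d := d) hf (by grind) (by grind) (by grind) hw
  rw [Module.End.mul_apply, lact_join _ _ _ _ _ _ h1 h2, lact_join _ _ _ _ _ _ g2 g3,
    Module.End.one_apply]
  congr 1
  exact Subtype.ext g1

theorem lact_comm (δ : ℂ) (a b c d : Fin n) (hab : (a : ℕ) + 1 = b) (hcd : (c : ℕ) + 1 = d)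
    (h : b < c ∨ d < a) :
    lact p δ a b hab * lact p δ c d hcd = lact p δ c d hcd * lact p δ a b hab := by
  refine Finsupp.lhom_ext fun w r => ?_
  simp only [Module.End.mul_apply]
  have hf := w.2.1
  have ha := hf a
  have hb := hf b
  have hc := hf c
  have hd := hf d
  have e1 : a ≠ b := by grind
  have e2 : c ≠ d := by grind
  have e3 : a ≠ c ∧ a ≠ d ∧ b ≠ c ∧ b ≠ d := by grind
  have cc : ∀ {a b c d : Fin n}, a ≠ c ∧ a ≠ d ∧ b ≠ c ∧ b ≠ d → w.1 c = d → w.1 a ≠ b →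
      ¬ (w.1 a = a ∧ w.1 b = b) → glue w.1 a b c = d := by
    intro a b c d h h1 h2 h3
    have := hf c
    grind [glue]
  have zz : ∀ {a b c d : Fin n}, a ≠ c ∧ a ≠ d ∧ b ≠ c ∧ b ≠ d → w.1 c = c ∧ w.1 d = d →
      glue w.1 a b c = c ∧ glue w.1 a b d = d := by
    intro a b c d h h1
    grind [glue]
  have e3' : c ≠ a ∧ c ≠ b ∧ d ≠ a ∧ d ≠ b := by grind
  by_cases A1 : w.1 a = b <;> by_cases A2 : w.1 c = d
  · rw [lact_arc _ _ _ _ _ _ A1, lact_arc _ _ _ _ _ _ A2, lact_arc _ _ _ _ _ _ A1,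
      lact_arc _ _ _ _ _ _ A2, mul_right_comm]
  · rw [lact_arc _ _ _ _ _ _ A1]
    by_cases Z2 : w.1 c = c ∧ w.1 d = d
    · rw [lact_zero _ _ _ _ _ _ Z2, lact_zero _ _ _ _ _ _ Z2, map_zero]
    · rw [lact_join _ _ _ _ _ _ A2 Z2, lact_join _ _ _ _ _ _ A2 Z2, lact_arc]
      exact cc e3' A1 A2 Z2
  · rw [lact_arc _ _ _ _ _ _ A2]
    by_cases Z1 : w.1 a = a ∧ w.1 b = b
    · rw [lact_zero _ _ _ _ _ _ Z1, lact_zero _ _ _ _ _ _ Z1, map_zero]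
    · rw [lact_join _ _ _ _ _ _ A1 Z1, lact_join _ _ _ _ _ _ A1 Z1, lact_arc]
      exact cc e3 A2 A1 Z1
  by_cases Z1 : w.1 a = a ∧ w.1 b = b <;> by_cases Z2 : w.1 c = c ∧ w.1 d = d
  · rw [lact_zero _ _ _ _ _ _ Z1, lact_zero _ _ _ _ _ _ Z2, map_zero, map_zero]
  · rw [lact_zero _ _ _ _ _ _ Z1, lact_join _ _ _ _ _ _ A2 Z2, lact_zero, map_zero]
    exact zz e3' Z1
  · rw [lact_zero _ _ _ _ _ _ Z2, lact_join _ _ _ _ _ _ A1 Z1, lact_zero, map_zero]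
    exact zz e3 Z2
  rw [lact_join _ _ _ _ _ _ A1 Z1, lact_join _ _ _ _ _ _ A2 Z2]
  obtain ⟨g1, g2, g3⟩ := glue_comm hf e1 e2 e3 A1 Z1 A2 Z2
  obtain ⟨k1, k2, k3⟩ := glue_comm hf e2 e1 e3' A2 Z2 A1 Z1
  by_cases B : glue w.1 c d a = b
  · rw [lact_arc _ _ _ _ _ _ B, lact_arc _ _ _ _ _ _ (g1 B).1]
    congr 1
    exact Subtype.ext (g1 B).2
  have B' : glue w.1 a b c ≠ d := fun h => B (k1 h).1
  by_cases Y : glue w.1 c d a = a ∧ glue w.1 c d b = b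
  · rw [lact_zero _ _ _ _ _ _ Y, lact_zero _ _ _ _ _ _ (g2 Y)]
  have Y' : ¬ (glue w.1 a b c = c ∧ glue w.1 a b d = d) := fun h => Y (k2 h)
  rw [lact_join _ _ _ _ _ _ B Y, lact_join _ _ _ _ _ _ B' Y']
  congr 1
  exact Subtype.ext (g3 B Y)

end LinkState

/-- The standard representation `V_{n,p}` of `TL_n(δ)` on the space with basis the
`(n, p)`-link states, the generators acting by vertical concatenation. -/
def stdRep (δ : ℂ) (n p : ℕ) : TL δ n →ₐ[ℂ] Module.End ℂ (LinkState n p →₀ ℂ) :=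
  RingQuot.liftAlgHom ℂ ⟨FreeAlgebra.lift ℂ fun i : TLIndex n =>
    LinkState.lact p δ ⟨i, Nat.lt_of_succ_lt i.2⟩ ⟨i + 1, i.2⟩ rfl, by
      intro x y h
      induction h with
      | sq i => simpa using LinkState.lact_sq δ _ _ _
      | braid i j h =>
        simpa using LinkState.lact_braid δ _ _ _ _ _ _ (by simpa [Fin.ext_iff] using h)
      | comm i j h =>
        simpa using LinkState.lact_comm δ _ _ _ _ _ _ (by simpa [Fin.lt_def] using h)⟩

/-- The matrix trace `t_{n,p}` of the standard representation `V_{n,p}`. -/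
def stdTrace (δ : ℂ) (n p : ℕ) : TL δ n →ₗ[ℂ] ℂ :=
  LinearMap.trace ℂ (LinkState n p →₀ ℂ) ∘ₗ (stdRep δ n p).toLinearMap

/-! ### The irreducible quotients -/

/-- The largest proper subrepresentation of `V_{n,p}`: the sum of all proper ones. -/
def stdRad (δ : ℂ) (n p : ℕ) : Submodule ℂ (LinkState n p →₀ ℂ) :=
  sSup {N | N ≠ ⊤ ∧ ∀ x : TL δ n, N ≤ N.comap (stdRep δ n p x)}

theorem stdRad_le_comap (δ : ℂ) (n p : ℕ) (x : TL δ n) :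
    stdRad δ n p ≤ (stdRad δ n p).comap (stdRep δ n p x) :=
  sSup_le fun _ hN => (hN.2 x).trans (Submodule.comap_mono (le_sSup hN))

/-- The irreducible quotient `L_{n,p}` of `V_{n,p}`. -/
def irrRep (δ : ℂ) (n p : ℕ) :
    TL δ n →ₐ[ℂ] Module.End ℂ ((LinkState n p →₀ ℂ) ⧸ stdRad δ n p) :=
  AlgHom.ofLinearMap
    { toFun := fun x => (stdRad δ n p).mapQ (stdRad δ n p) (stdRep δ n p x) (stdRad_le_comap δ n p x)
      map_add' := fun x y => by
        apply Submodule.linearMap_qext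
        ext w
        simp
      map_smul' := fun c x => by
        apply Submodule.linearMap_qext
        ext w
        simp }
    (by
      apply Submodule.linearMap_qext
      ext w
      simp)
    (fun x y => by
      apply Submodule.linearMap_qext
      ext w
      simp)

/-- The matrix trace `l_{n,p}` of the irreducible representation `L_{n,p}`. -/
def irrTrace (δ : ℂ) (n p : ℕ) : TL δ n →ₗ[ℂ] ℂ :=
  LinearMap.trace ℂ ((LinkState n p →₀ ℂ) ⧸ stdRad δ n p) ∘ₗ (irrRep δ n p).toLinearMap

/-- The labels `0 ≤ p ≤ ⌊n/2⌋` of the standard representations of `TL_n(δ)`. -/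
def stdLabels (n : ℕ) : Finset ℕ := Finset.range (n / 2 + 1)

open Classical in
/-- The labels of the irreducible representations `L_{n,p}` of `TL_n(δ)`: all `0 ≤ p ≤ ⌊n/2⌋`,
except that there is no `L_{n,n/2}` if `δ = 0` and `n > 0` is even. -/
def irrLabels (δ : ℂ) (n : ℕ) : Finset ℕ :=
  (stdLabels n).filter fun p => ¬ (δ = 0 ∧ 0 < n ∧ n = 2 * p)

/-! ### Traces on the infinite algebra -/

/-- For every `n` the restriction of `χ` to `TL_n(δ)` is `∑ i ∈ I n, a n i • τ n i`. -/
def IsExpansion {δ : ℂ} (I : ℕ → Finset ℕ) (τ : ∀ n, ℕ → TL δ n →ₗ[ℂ] ℂ)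
    (χ : TLInf δ →ₗ[ℂ] ℂ) (a : ℕ → ℕ → ℂ) : Prop :=
  ∀ n, χ ∘ₗ (TL.incl δ n).toLinearMap = ∑ i ∈ I n, a n i • τ n i

/-- The normalized traces on `TL_∞(δ)` that have non-negative coefficients with respect to the
traces `τ n i`, `i ∈ I n`. -/
def positiveTraces {δ : ℂ} (I : ℕ → Finset ℕ) (τ : ∀ n, ℕ → TL δ n →ₗ[ℂ] ℂ) :
    Set (TLInf δ →ₗ[ℂ] ℂ) :=
  {χ | (∀ x y, χ (x * y) = χ (y * x)) ∧ χ 1 = 1 ∧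
    ∃ a : ℕ → ℕ → ℝ, (∀ n i, 0 ≤ a n i) ∧ IsExpansion I τ χ fun n i => (a n i : ℂ)}

/-- `χ` is extremal among the normalized traces with non-negative coefficients with respect to the
traces of the standard representations: it is not a proper convex combination of other ones. -/
def IsExtremalStd {δ : ℂ} (χ : TLInf δ →ₗ[ℂ] ℂ) : Prop :=
  χ ∈ (positiveTraces stdLabels (stdTrace δ)).extremePoints ℝ

/-- `χ` is extremal among the normalized traces with non-negative coefficients with respect to the
traces of the irreducible representations. -/
def IsExtremalIrr {δ : ℂ} (χ : TLInf δ →ₗ[ℂ] ℂ) : Prop :=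
  χ ∈ (positiveTraces (irrLabels δ) (irrTrace δ)).extremePoints ℝ

/-! ### The generic coefficients -/

/-- The coefficients `c_{n,0}` of the generic extremal trace with parameter `γ`. -/
def genTop (γ : ℂ) : ℕ → ℂ
  | 0 => 1
  | 1 => 1
  | n + 2 => genTop γ (n + 1) - γ * genTop γ n

/-- The coefficients `c_{n,i} = γ^i c_{n-2i,0}`, `0 ≤ i ≤ ⌊n/2⌋`, of the generic extremal trace
with parameter `γ`. -/
def genCoeff (γ : ℂ) (n i : ℕ) : ℂ := γ ^ i * genTop γ (n - 2 * i)

/-- The closed form `c_{n,0} = [n+1]_r / [2]_r ^ n` for `γ = [2]_r ^ (-2)`. -/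
theorem genTop_eq (r : ℂ) (h1 : r - r⁻¹ ≠ 0) (h2 : r + r⁻¹ ≠ 0) (n : ℕ) :
    genTop ((r + r⁻¹) ^ 2)⁻¹ n =
      (r ^ (n + 1) - r⁻¹ ^ (n + 1)) / (r - r⁻¹) / (r + r⁻¹) ^ n := by
  have hr : r ≠ 0 := by rintro rfl; simp at h1
  have hrr : r * r⁻¹ = 1 := mul_inv_cancel₀ hr
  generalize r⁻¹ = s at *
  induction n using Nat.twoStepInduction with
  | zero => simp [genTop, h1]
  | one => rw [genTop]; field_simp; ring
  | more n ih1 ih2 =>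
    have key : r ^ (n + 2 + 1) - s ^ (n + 2 + 1) =
        (r + s) * (r ^ (n + 1 + 1) - s ^ (n + 1 + 1)) - (r ^ (n + 1) - s ^ (n + 1)) := by
      linear_combination -(r ^ (n + 1) - s ^ (n + 1)) * hrr
    rw [genTop, ih1, ih2, key]
    field_simp
    ring

end

/-! ### Families of Temperley-Lieb generators in an algebra -/

/-! Let z_{n,k} (`endCups`) be the idempotent of TL_n whose k cups pair up the last 2k points. It is
a product of elements e_{m+1} e_m, which are idempotent for every δ; only the cup on the first two
points has to be δ⁻¹ e_0, and this is where the label n/2 is lost when δ = 0. The corner z TL_n z is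
contained in TL_{n-2k} z, so an irreducible representation is determined by the largest label k for
which z_{n,k} acts on it as a nonzero operator (`trace_eq_of_hasTop`). Moreover z_{n,k} kills
V_{n,p} and L_{n,p} for p < k and has trace 1 on both for p = k. The values l_{n,i}(z_{n,k})
therefore form a unitriangular matrix, and a combination of irreducible traces, in particular of
standard ones, is determined by its values on the z_{n,k} (`irrSpan_ext`). No decomposition numbers
or Gram determinants are needed; on V_{n,i} the trace of z_{n,k} is just the number of (n-2k,
i-k)-link states.

For a trace χ on TL_∞ put ψ(x) = χ(x e_{m+1} e_m) with m large. The braid relations make this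
independent of m (`trace_mul_gen_mul_gen`), ψ is a trace, and χ(z_{n+2,k+1}) = ψ(z_{n,k}). Both ψ
and χ - ψ inherit non-negative coefficients: for irreducible traces because cutting a module by an
idempotent that commutes with TL_n leaves a TL_n-module (`HasPosExpansion.farTrace_irr`), for
standard traces because the branching rule over two strands exhibits the coefficients
(`HasPosExpansion.farTrace_std`). Extremality forces ψ = γχ, hence χ(z_{n,k}) = γ^k
(`exists_moment`).

Counting link states gives ∑ c_{n,i}(γ) t_{n,i}(z_{n,k}) = γ^k as well
(`sum_genCoeff_mul_cupCount`), so χ has the generic expansion. Evaluating an irreducible expansion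
at z_{n,k} with k the largest label isolates λ_{n,k} = γ^k, which is c_{n,k} for n = 2k and n =
2k+1. In the standard case the numbers c_{n,0}(γ) are non-negative, which forces γ ≤ 1/4. -/

/-- The elements `e i`, `i + 1 < n`, of an algebra satisfy the relations of `TL_n(δ)`. -/
structure IsTLFamily {R : Type*} [Ring R] [Algebra ℂ R] (δ : ℂ) (n : ℕ) (e : ℕ → R) : Prop where
  sq : ∀ i, i + 1 < n → e i * e i = δ • e i
  up : ∀ i, i + 2 < n → e i * e (i + 1) * e i = e i
  down : ∀ i, i + 2 < n → e (i + 1) * e i * e (i + 1) = e (i + 1)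
  comm : ∀ i j, i + 1 < j → j + 1 < n → Commute (e i) (e j)

/-- The subalgebra generated by the `e i` with `i + 1 < m`. -/
def genAlg {R : Type*} [Ring R] [Algebra ℂ R] (e : ℕ → R) (m : ℕ) : Subalgebra ℂ R :=
  Algebra.adjoin ℂ (e '' {i | i + 1 < m})

/-- An idempotent of the algebra generated by the first `n - 1` generators, with a single cup and
a single cap, the cup joining the last two points. -/
noncomputable def endCup {R : Type*} [Ring R] [Algebra ℂ R] (δ : ℂ) (e : ℕ → R) : ℕ → R
  | 0 => 0
  | 1 => 0
  | 2 => δ⁻¹ • e 0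
  | m + 3 => e (m + 1) * e m

/-- An idempotent with `k` cups, which join the last `2k` of `n` points in pairs of neighbours. -/
noncomputable def endCups {R : Type*} [Ring R] [Algebra ℂ R] (δ : ℂ) (e : ℕ → R) : ℕ → ℕ → R
  | _, 0 => 1
  | n + 2, k + 1 => endCups δ e n k * endCup δ e (n + 2)
  | 0, _ + 1 => 0
  | 1, _ + 1 => 0

theorem mem_irrLabels {δ : ℂ} {n k : ℕ} :
    k ∈ irrLabels δ n ↔ 2 * k ≤ n ∧ (n = 2 * k → 0 < n → δ ≠ 0) := by
  simp only [irrLabels, stdLabels, Finset.mem_filter, Finset.mem_range]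
  constructor
  · rintro ⟨h1, h2⟩
    exact ⟨by omega, fun h3 h4 h5 => h2 ⟨h5, h4, h3⟩⟩
  · rintro ⟨h1, h2⟩
    exact ⟨by omega, fun ⟨h3, h4, h5⟩ => h2 h5 h4 h3⟩

theorem mem_stdLabels {n k : ℕ} : k ∈ stdLabels n ↔ 2 * k ≤ n := by
  simp only [stdLabels, Finset.mem_range]
  omega

theorem irrLabels_pred {δ : ℂ} {n k : ℕ} (h : k + 1 ∈ irrLabels δ (n + 2)) :
    k ∈ irrLabels δ n ∧ (0 < n ∨ δ ≠ 0) := by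
  rw [mem_irrLabels] at h ⊢
  refine ⟨⟨by omega, fun h1 _ => h.2 (by omega) (by omega)⟩, ?_⟩
  rcases Nat.eq_zero_or_pos n with hn | hn
  · exact Or.inr (h.2 (by omega) (by omega))
  · exact Or.inl hn

theorem irrLabels_succ {δ : ℂ} {n k : ℕ} (h : k ∈ irrLabels δ n) (hn : 0 < n ∨ δ ≠ 0) :
    k + 1 ∈ irrLabels δ (n + 2) := by
  rw [mem_irrLabels] at h ⊢
  refine ⟨by omega, fun h1 _ => ?_⟩
  rcases hn with hn | hn
  · exact h.2 (by omega) hn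
  · exact hn

section
variable {R R' : Type*} [Ring R] [Algebra ℂ R] [Ring R'] [Algebra ℂ R'] {δ : ℂ} {e : ℕ → R}

theorem map_endCup (φ : R →ₐ[ℂ] R') (n : ℕ) :
    φ (endCup δ e n) = endCup δ (fun i => φ (e i)) n := by
  rcases n with _ | _ | _ | n <;> simp [endCup]

theorem map_endCups (φ : R →ₐ[ℂ] R') (n k : ℕ) :
    φ (endCups δ e n k) = endCups δ (fun i => φ (e i)) n k := by
  fun_induction endCups δ e n k with
  | case1 => simp [endCups]
  | case2 n k ih => simp [endCups, ih, map_endCup]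
  | case3 => simp [endCups]
  | case4 => simp [endCups]

theorem endCup_congr {e' : ℕ → R} {n : ℕ} (h : ∀ i, i + 1 < n → e i = e' i) :
    endCup δ e n = endCup δ e' n := by
  rcases n with _ | _ | _ | n
  · rfl
  · rfl
  · simp [endCup, h 0 (by omega)]
  · simp [endCup, h n (by omega), h (n + 1) (by omega)]

theorem endCups_congr {e' : ℕ → R} {n : ℕ} (k : ℕ) (h : ∀ i, i + 1 < n → e i = e' i) :
    endCups δ e n k = endCups δ e' n k := by
  induction k generalizing n with
  | zero => simp [endCups]
  | succ k ih =>
    rcases n with _ | _ | n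
    · simp [endCups]
    · simp [endCups]
    · rw [endCups, endCups, ih fun i hi => h i (by omega), endCup_congr h]

theorem genAlg_mono {m m' : ℕ} (h : m ≤ m') : genAlg e m ≤ genAlg e m' :=
  Algebra.adjoin_mono (Set.image_mono fun i (hi : i + 1 < m) => lt_of_lt_of_le hi h)

theorem gen_mem_genAlg {i m : ℕ} (h : i + 1 < m) : e i ∈ genAlg e m :=
  Algebra.subset_adjoin ⟨i, h, rfl⟩

theorem endCup_mem (n : ℕ) : endCup δ e n ∈ genAlg e n := by
  rcases n with _ | _ | _ | n
  · exact zero_mem _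
  · exact zero_mem _
  · exact Subalgebra.smul_mem _ (gen_mem_genAlg (by omega)) _
  · exact mul_mem (gen_mem_genAlg (by omega)) (gen_mem_genAlg (by omega))

theorem endCups_mem (n k : ℕ) : endCups δ e n k ∈ genAlg e n := by
  fun_induction endCups δ e n k with
  | case1 => exact one_mem _
  | case2 n k ih => exact mul_mem (genAlg_mono (by omega) ih) (endCup_mem _)
  | case3 => exact zero_mem _
  | case4 => exact zero_mem _

theorem endCups_succ' {n k : ℕ} (h : 2 * k + 2 ≤ n) :
    endCups δ e n (k + 1) = endCup δ e (n - 2 * k) * endCups δ e n k := by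
  induction k generalizing n with
  | zero =>
    obtain ⟨n, rfl⟩ : ∃ m, n = m + 2 := ⟨n - 2, by omega⟩
    simp [endCups]
  | succ k ih =>
    obtain ⟨n, rfl⟩ : ∃ m, n = m + 2 := ⟨n - 2, by omega⟩
    rw [endCups, ih (by omega), endCups, mul_assoc]
    congr 2
    omega

/-- Jones's normal form: words with at most one occurrence of the last generator suffice. Their span
contains 1 and is stable under left multiplication by every generator, since `J` absorbs a second
occurrence. Having `J` as a hypothesis allows the lemma to serve inside the induction that proves
`J`. -/
theorem genAlg_succ_le {m : ℕ}
    (J : ∀ x ∈ genAlg e (m + 1), ∃ y ∈ genAlg e m, e m * x * e m = y * e m)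
    {x : R} (hx : x ∈ genAlg e (m + 2)) :
    x ∈ (genAlg e (m + 1)).toSubmodule ⊔
      Submodule.span ℂ {x | ∃ a ∈ genAlg e (m + 1), ∃ b ∈ genAlg e (m + 1), x = a * e m * b} := by
  set X := (genAlg e (m + 1)).toSubmodule ⊔
      Submodule.span ℂ {x | ∃ a ∈ genAlg e (m + 1), ∃ b ∈ genAlg e (m + 1), x = a * e m * b}
    with hX
  have hl : ∀ a ∈ genAlg e (m + 1), a ∈ X := fun a ha => Submodule.mem_sup_left ha
  have hr : ∀ a ∈ genAlg e (m + 1), ∀ b ∈ genAlg e (m + 1), a * e m * b ∈ X :=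
    fun a ha b hb => Submodule.mem_sup_right (Submodule.subset_span ⟨a, ha, b, hb, rfl⟩)
  have key : ∀ c : R, (∀ a ∈ genAlg e (m + 1), c * a ∈ X) →
      (∀ a ∈ genAlg e (m + 1), ∀ b ∈ genAlg e (m + 1), c * (a * e m * b) ∈ X) →
      ∀ y ∈ X, c * y ∈ X := by
    intro c h1 h2
    have : X ≤ X.comap (LinearMap.mulLeft ℂ c) := by
      refine sup_le (fun a ha => h1 a ha) (Submodule.span_le.2 ?_)
      rintro _ ⟨a, ha, b, hb, rfl⟩
      exact h2 a ha b hb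
    exact this
  suffices h : ∀ y ∈ X, x * y ∈ X by simpa using h 1 (hl 1 (one_mem _))
  induction hx using Algebra.adjoin_induction with
  | mem x hx =>
    obtain ⟨i, hi, rfl⟩ := hx
    have hi : i + 1 < m + 2 := hi
    rcases Nat.lt_or_ge i m with him | him
    · have hm : e i ∈ genAlg e (m + 1) := gen_mem_genAlg (by omega)
      refine key _ (fun a ha => hl _ (mul_mem hm ha)) fun a ha b hb => ?_
      rw [← mul_assoc, ← mul_assoc]
      exact hr _ (mul_mem hm ha) _ hb
    · obtain rfl : i = m := by omega
      refine key _ (fun a ha => by simpa using hr 1 (one_mem _) a ha) fun a ha b hb => ?_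
      obtain ⟨y, hy, h⟩ := J a ha
      rw [← mul_assoc, ← mul_assoc, h]
      exact hr _ (genAlg_mono (by omega) hy) _ hb
  | algebraMap r =>
    intro y hy
    rw [← Algebra.smul_def]
    exact X.smul_mem _ hy
  | add x y _ _ hx hy =>
    intro w hw
    rw [add_mul]
    exact X.add_mem (hx _ hw) (hy _ hw)
  | mul x y _ _ hx hy =>
    intro w hw
    rw [mul_assoc]
    exact hx _ (hy _ hw)

/-! ### Corners of the algebra cut out by the cup idempotents -/

namespace IsTLFamily
variable {n : ℕ} (he : IsTLFamily δ n e)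
include he

theorem commute_genAlg {m i : ℕ} (hm : m ≤ i) (hi : i + 1 < n) {x : R} (hx : x ∈ genAlg e m) :
    Commute x (e i) := by
  have : genAlg e m ≤ Subalgebra.centralizer ℂ {e i} := by
    refine Algebra.adjoin_le ?_
    rintro _ ⟨j, hj, rfl⟩
    simp only [SetLike.mem_coe, Subalgebra.mem_centralizer_iff, Set.mem_singleton_iff, forall_eq]
    exact (he.comm j i (by have : j + 1 < m := hj; omega) hi).eq.symm
  have := this hx
  simp only [Subalgebra.mem_centralizer_iff, Set.mem_singleton_iff, forall_eq] at this
  exact this.symm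

/-- The conditional expectation of TL_{m+1} onto TL_m, in unnormalized form. By the normal form it
is enough to treat elements commuting with e_{m+1}, where the square relation applies, and products
a e_m b with a, b commuting with e_{m+1}, where the braid relation applies. -/
theorem sandwich_aux (m : ℕ) (hm : m + 2 ≤ n) :
    ∀ x ∈ genAlg e (m + 1), ∃ y ∈ genAlg e m, e m * x * e m = y * e m := by
  induction m with
  | zero =>
    intro x hx
    -- On zero or one strand there are no generators, so both algebras consist of scalars.
    have : x ∈ genAlg e 0 := by
      refine Algebra.adjoin_mono ?_ hx
      rintro _ ⟨i, hi, rfl⟩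
      have hi : i + 1 < 0 + 1 := hi
      omega
    refine ⟨δ • x, Subalgebra.smul_mem _ this _, ?_⟩
    rw [← (he.commute_genAlg le_rfl (by omega) this).eq, mul_assoc, he.sq _ (by omega)]
    simp
  | succ m ih =>
    intro x hx
    have := genAlg_succ_le (ih (by omega)) hx
    obtain ⟨y, hy, z, hz, rfl⟩ := Submodule.mem_sup.1 this
    have hy : y ∈ genAlg e (m + 1) := hy
    have h1 : ∃ u ∈ genAlg e (m + 1), e (m + 1) * y * e (m + 1) = u * e (m + 1) := by
      refine ⟨δ • y, Subalgebra.smul_mem _ hy _, ?_⟩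
      rw [← (he.commute_genAlg le_rfl (by omega) hy).eq, mul_assoc, he.sq _ (by omega)]
      simp
    have h2 : ∃ u ∈ genAlg e (m + 1), e (m + 1) * z * e (m + 1) = u * e (m + 1) := by
      clear hx this
      induction hz using Submodule.span_induction with
      | mem z hz =>
        obtain ⟨a, ha, b, hb, rfl⟩ := hz
        refine ⟨a * b, mul_mem ha hb, ?_⟩
        have ca := (he.commute_genAlg le_rfl (by omega) ha).eq
        have cb := (he.commute_genAlg le_rfl (by omega) hb).eq
        calc e (m + 1) * (a * e m * b) * e (m + 1)
            = (e (m + 1) * a) * e m * (b * e (m + 1)) := by noncomm_ring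
          _ = a * (e (m + 1) * e m * e (m + 1)) * b := by rw [← ca, cb]; noncomm_ring
          _ = a * b * e (m + 1) := by rw [he.down m (by omega), mul_assoc, ← cb, mul_assoc]
      | zero => exact ⟨0, zero_mem _, by simp⟩
      | add x y hx hy ihx ihy =>
        obtain ⟨u, hu, h1⟩ := ihx
        obtain ⟨v, hv, h2⟩ := ihy
        exact ⟨u + v, add_mem hu hv, by rw [mul_add, add_mul, h1, h2, add_mul]⟩
      | smul c x hx ih =>
        obtain ⟨u, hu, h1⟩ := ih
        exact ⟨c • u, Subalgebra.smul_mem _ hu _, by simp [h1]⟩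
    obtain ⟨u, hu, h1⟩ := h1
    obtain ⟨v, hv, h2⟩ := h2
    exact ⟨u + v, add_mem hu hv, by rw [mul_add, add_mul, h1, h2, add_mul]⟩

theorem sandwich {m : ℕ} (hm : m + 2 ≤ n) {x : R} (hx : x ∈ genAlg e (m + 2)) :
    ∃ y ∈ genAlg e m, e m * x * e m = y * e m := by
  obtain ⟨y, hy, z, hz, rfl⟩ :=
    Submodule.mem_sup.1 (genAlg_succ_le (he.sandwich_aux m hm) hx)
  obtain ⟨u, hu, h1⟩ := he.sandwich_aux m hm y hy
  have h2 : ∃ u ∈ genAlg e m, e m * z * e m = u * e m := by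
    clear hx
    induction hz using Submodule.span_induction with
    | mem z hz =>
      obtain ⟨a, ha, b, hb, rfl⟩ := hz
      obtain ⟨u, hu, h1⟩ := he.sandwich_aux m hm a ha
      obtain ⟨v, hv, h2⟩ := he.sandwich_aux m hm b hb
      refine ⟨u * v, mul_mem hu hv, ?_⟩
      calc e m * (a * e m * b) * e m = (e m * a * e m) * b * e m := by noncomm_ring
        _ = u * (e m * b * e m) := by rw [h1]; noncomm_ring
        _ = u * v * e m := by rw [h2, mul_assoc]
    | zero => exact ⟨0, zero_mem _, by simp⟩
    | add x y hx hy ihx ihy =>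
      obtain ⟨u, hu, h1⟩ := ihx
      obtain ⟨v, hv, h2⟩ := ihy
      exact ⟨u + v, add_mem hu hv, by rw [mul_add, add_mul, h1, h2, add_mul]⟩
    | smul c x hx ih =>
      obtain ⟨u, hu, h1⟩ := ih
      exact ⟨c • u, Subalgebra.smul_mem _ hu _, by simp [h1]⟩
  obtain ⟨v, hv, h2⟩ := h2
  exact ⟨u + v, add_mem hu hv, by rw [mul_add, add_mul, h1, h2, add_mul]⟩

theorem endCup_sandwich {m : ℕ} (hm : m + 2 ≤ n) (h0 : 0 < m ∨ δ ≠ 0) {x : R}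
    (hx : x ∈ genAlg e (m + 2)) :
    ∃ y ∈ genAlg e m, endCup δ e (m + 2) * x * endCup δ e (m + 2) = y * endCup δ e (m + 2) := by
  rcases m with _ | m
  · obtain ⟨y, hy, h⟩ := he.sandwich hm hx
    refine ⟨δ⁻¹ • y, Subalgebra.smul_mem _ hy _, ?_⟩
    simp [endCup, h]
  -- The idempotent is e_{m+1} e_m; its right factor e_m is absorbed into the element enclosed
  -- between two copies of e_{m+1}.
  · obtain ⟨y, hy, h⟩ := he.sandwich hm (mul_mem (gen_mem_genAlg (i := m) (by omega)) hx)
    refine ⟨y, hy, ?_⟩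
    simp only [endCup]
    rw [← mul_assoc y, ← h]
    noncomm_ring

/-- The form is one-sided because y commutes with e_{m+1} but in general not with e_m: it can be
moved out to the left only. -/
theorem endCup_mul_endCup {m : ℕ} (hm : m + 2 ≤ n) (h0 : 0 < m ∨ δ ≠ 0) {y : R}
    (hy : y ∈ genAlg e m) :
    endCup δ e (m + 2) * y * endCup δ e (m + 2) = y * endCup δ e (m + 2) := by
  rcases m with _ | m
  · have h0 : δ ≠ 0 := by simpa using h0
    have c := (he.commute_genAlg le_rfl (by omega) hy).eq
    simp only [endCup, smul_mul_assoc, mul_smul_comm]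
    rw [← c, mul_assoc, he.sq 0 (by omega)]
    simp [smul_smul, h0]
  · have c := (he.commute_genAlg (i := m + 1) le_rfl (by omega) hy).eq
    simp only [endCup]
    calc e (m + 1) * e m * y * (e (m + 1) * e m)
        = e (m + 1) * e m * (y * e (m + 1)) * e m := by noncomm_ring
      _ = (e (m + 1) * e m * e (m + 1)) * y * e m := by rw [c]; noncomm_ring
      _ = y * (e (m + 1) * e m) := by rw [he.down m (by omega), ← c, mul_assoc]

theorem mono {n' : ℕ} (h : n' ≤ n) : IsTLFamily δ n' e where
  sq i hi := he.sq i (by omega)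
  up i hi := he.up i (by omega)
  down i hi := he.down i (by omega)
  comm i j hi hj := he.comm i j hi (by omega)

theorem endCups_mul_endCups {k : ℕ} (hk : k ∈ irrLabels δ n) {y : R}
    (hy : y ∈ genAlg e (n - 2 * k)) :
    endCups δ e n k * y * endCups δ e n k = y * endCups δ e n k := by
  induction k generalizing n with
  | zero => simp [endCups]
  | succ k ih =>
    obtain ⟨n, rfl⟩ : ∃ m, n = m + 2 := ⟨n - 2, by have := (mem_irrLabels.1 hk).1; omega⟩
    obtain ⟨h1, h2⟩ := irrLabels_pred hk
    rw [show n + 2 - 2 * (k + 1) = n - 2 * k by omega] at hy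
    have hz := endCups_mem (δ := δ) (e := e) n k
    set z := endCups δ e n k with hzdef
    set F := endCup δ e (n + 2) with hF
    have IH := ih (he.mono (by omega)) h1 hy
    have E := he.endCup_mul_endCup le_rfl h2
      (mul_mem (genAlg_mono (by omega : n - 2 * k ≤ n) hy) hz)
    rw [endCups, ← hzdef, ← hF]
    calc z * F * y * (z * F) = z * (F * (y * z) * F) := by noncomm_ring
      _ = (z * y * z) * F := by rw [E]; noncomm_ring
      _ = y * (z * F) := by rw [IH, mul_assoc]

theorem endCups_sandwich {k : ℕ} (hk : k ∈ irrLabels δ n) {x : R} (hx : x ∈ genAlg e n) :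
    ∃ y ∈ genAlg e (n - 2 * k), endCups δ e n k * x * endCups δ e n k = y * endCups δ e n k := by
  induction k generalizing n x with
  | zero => exact ⟨x, by simpa using hx, by simp [endCups]⟩
  | succ k ih =>
    obtain ⟨n, rfl⟩ : ∃ m, n = m + 2 := ⟨n - 2, by have := (mem_irrLabels.1 hk).1; omega⟩
    obtain ⟨h1, h2⟩ := irrLabels_pred hk
    rw [show n + 2 - 2 * (k + 1) = n - 2 * k by omega]
    have hz := endCups_mem (δ := δ) (e := e) n k
    obtain ⟨u, hu, hxu⟩ := he.endCup_sandwich le_rfl h2 hx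
    obtain ⟨y, hy, huy⟩ := ih (he.mono (by omega)) h1 hu
    have E := he.endCup_mul_endCup le_rfl h2 hz
    refine ⟨y, hy, ?_⟩
    set z := endCups δ e n k with hzdef
    set F := endCup δ e (n + 2) with hF
    rw [endCups, ← hzdef, ← hF]
    -- The relation F z F = z F, with F on the new pair of points, is used to insert an F next to x
    -- and is used backwards at the end to remove it.
    calc z * F * x * (z * F) = z * F * x * (F * z * F) := by rw [E]
      _ = z * (F * x * F) * z * F := by noncomm_ring
      _ = z * u * (F * z * F) := by rw [hxu]; noncomm_ring
      _ = (z * u * z) * F := by rw [E]; noncomm_ring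
      _ = y * (z * F) := by rw [huy, mul_assoc]

theorem endCups_sq {k : ℕ} (hk : k ∈ irrLabels δ n) :
    endCups δ e n k * endCups δ e n k = endCups δ e n k := by
  simpa using he.endCups_mul_endCups hk (one_mem _)

/-- If the idempotent with `k + 1` cups vanishes, then so does every product of the idempotent with
`k` cups and a generator on the remaining points. -/
theorem gen_mul_endCups {k : ℕ} (hk : k ∈ irrLabels δ n) (hk' : k + 1 ∈ irrLabels δ n)
    (h0 : endCups δ e n (k + 1) = 0) {j : ℕ} (hj : j + 1 < n - 2 * k) :
    e j * endCups δ e n k = 0 := by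
  obtain ⟨m, hm⟩ : ∃ m, n = m + 2 * k + 2 := ⟨n - 2 * k - 2, by omega⟩
  have hz : ∀ y ∈ genAlg e (n - 2 * k),
      endCups δ e n k * y * endCups δ e n k = y * endCups δ e n k :=
    fun y hy => he.endCups_mul_endCups hk hy
  rw [endCups_succ' (by omega)] at h0
  have hm' : n - 2 * k = m + 2 := by omega
  rw [hm'] at h0 hz hj
  set z := endCups δ e n k
  -- First the last generator on the remaining points: z g z = g z for a generator g there makes the
  -- vanishing product e_{m+1} e_m z appear. The relation e_j e_{j+1} e_j = e_j then carries the
  -- vanishing down to all smaller indices.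
  have top : e m * z = 0 := by
    rcases m with _ | m
    · have hδ := (mem_irrLabels.1 hk').2 (by omega) (by omega)
      simpa [endCup, hδ] using h0
    · have hem : e (m + 1) ∈ genAlg e (m + 3) := gen_mem_genAlg (by omega)
      calc e (m + 1) * z = e (m + 1) * e m * e (m + 1) * z := by rw [he.down m (by omega)]
        _ = (e (m + 1) * e m) * (e (m + 1) * z) := by noncomm_ring
        _ = (e (m + 1) * e m) * (z * e (m + 1) * z) := by rw [hz _ hem]
        _ = (e (m + 1) * e m * z) * e (m + 1) * z := by noncomm_ring
        _ = 0 := by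
          have : e (m + 1) * e m * z = 0 := h0
          rw [this]; simp
  have hjm : j ≤ m := by omega
  induction hjm using Nat.decreasingInduction with
  | self => exact top
  | of_succ j hjm ih =>
    have hem : e j ∈ genAlg e (m + 2) := gen_mem_genAlg (by omega)
    calc e j * z = e j * e (j + 1) * e j * z := by rw [he.up j (by omega)]
      _ = (e j * e (j + 1)) * (e j * z) := by noncomm_ring
      _ = (e j * e (j + 1)) * (z * e j * z) := by rw [hz _ hem]
      _ = e j * (e (j + 1) * z) * e j * z := by noncomm_ring
      _ = 0 := by rw [ih (by omega)]; simp

end IsTLFamily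

theorem IsTLFamily.map {n : ℕ} (he : IsTLFamily δ n e) (φ : R →ₐ[ℂ] R') :
    IsTLFamily δ n fun i => φ (e i) where
  sq i hi := by rw [← map_mul, he.sq i hi, map_smul]
  up i hi := by rw [← map_mul, ← map_mul, he.up i hi]
  down i hi := by rw [← map_mul, ← map_mul, he.down i hi]
  comm i j hi hj := (he.comm i j hi hj).map φ

/-! ### The generators of the Temperley-Lieb algebras -/

/-- The generators of `TL_n(δ)`, extended by zero. -/
noncomputable def TL.gen (δ : ℂ) (n i : ℕ) : TL δ n :=
  if h : i + 1 < n then RingQuot.mkAlgHom ℂ (TLRel δ (TLIndex n)) (FreeAlgebra.ι ℂ ⟨i, h⟩) else 0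

/-- The generators of `TL_∞(δ)`. -/
noncomputable def TLInf.gen (δ : ℂ) (i : ℕ) : TLInf δ :=
  RingQuot.mkAlgHom ℂ (TLRel δ Set.univ) (FreeAlgebra.ι ℂ ⟨i, trivial⟩)

theorem TL.isTLFamily (δ : ℂ) (n : ℕ) : IsTLFamily δ n (TL.gen δ n) where
  sq i hi := by
    simpa [TL.gen, hi] using
      RingQuot.mkAlgHom_rel ℂ (TLRel.sq (δ := δ) (S := TLIndex n) ⟨i, hi⟩)
  up i hi := by
    have h1 : i + 1 < n := by omega
    have h2 : i + 1 + 1 < n := by omega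
    simpa [TL.gen, h1, h2] using
      RingQuot.mkAlgHom_rel ℂ (TLRel.braid (δ := δ) (S := TLIndex n) ⟨i, h1⟩ ⟨i + 1, h2⟩ (by simp))
  down i hi := by
    have h1 : i + 1 < n := by omega
    have h2 : i + 1 + 1 < n := by omega
    simpa [TL.gen, h1, h2] using
      RingQuot.mkAlgHom_rel ℂ (TLRel.braid (δ := δ) (S := TLIndex n) ⟨i + 1, h2⟩ ⟨i, h1⟩ (by simp))
  comm i j hi hj := by
    have h1 : i + 1 < n := by omega
    have := RingQuot.mkAlgHom_rel ℂ
      (TLRel.comm (δ := δ) (S := TLIndex n) ⟨i, h1⟩ ⟨j, hj⟩ (Or.inl hi))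
    simpa [TL.gen, h1, hj, Commute, SemiconjBy] using this

theorem TLInf.isTLFamily (δ : ℂ) (n : ℕ) : IsTLFamily δ n (TLInf.gen δ) where
  sq i hi := by
    simpa [TLInf.gen] using
      RingQuot.mkAlgHom_rel ℂ (TLRel.sq (δ := δ) (S := Set.univ) ⟨i, trivial⟩)
  up i hi := by
    simpa [TLInf.gen] using RingQuot.mkAlgHom_rel ℂ
      (TLRel.braid (δ := δ) (S := Set.univ) ⟨i, trivial⟩ ⟨i + 1, trivial⟩ (by simp))
  down i hi := by
    simpa [TLInf.gen] using RingQuot.mkAlgHom_rel ℂ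
      (TLRel.braid (δ := δ) (S := Set.univ) ⟨i + 1, trivial⟩ ⟨i, trivial⟩ (by simp))
  comm i j hi hj := by
    have := RingQuot.mkAlgHom_rel ℂ
      (TLRel.comm (δ := δ) (S := Set.univ) ⟨i, trivial⟩ ⟨j, trivial⟩ (Or.inl hi))
    simpa [TLInf.gen, Commute, SemiconjBy] using this

theorem adjoin_mkAlgHom (S : Set ℕ) :
    Algebra.adjoin ℂ (Set.range fun i : S =>
      RingQuot.mkAlgHom ℂ (TLRel δ S) (FreeAlgebra.ι ℂ i)) = ⊤ := by
  have := congrArg (Subalgebra.map (RingQuot.mkAlgHom ℂ (TLRel δ S)))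
    (FreeAlgebra.adjoin_range_ι ℂ S)
  rw [AlgHom.map_adjoin, ← Set.range_comp, Algebra.map_top,
    (AlgHom.range_eq_top _).2 (RingQuot.mkAlgHom_surjective ℂ _)] at this
  exact this

theorem TL.genAlg_eq_top (δ : ℂ) (n : ℕ) : genAlg (TL.gen δ n) n = ⊤ := by
  rw [genAlg, ← adjoin_mkAlgHom]
  congr 1
  ext x
  constructor
  · rintro ⟨i, hi, rfl⟩
    have hi : i + 1 < n := hi
    exact ⟨⟨i, hi⟩, by simp [TL.gen, hi]⟩
  · rintro ⟨⟨i, hi⟩, rfl⟩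
    have hi : i + 1 < n := hi
    exact ⟨i, hi, by simp [TL.gen, hi]⟩

theorem TLInf.exists_mem_genAlg (x : TLInf δ) : ∃ n, x ∈ genAlg (TLInf.gen δ) n := by
  have hx : x ∈ (⊤ : Subalgebra ℂ (TLInf δ)) := trivial
  rw [← adjoin_mkAlgHom] at hx
  induction hx using Algebra.adjoin_induction with
  | mem x hx =>
    obtain ⟨⟨i, hi⟩, rfl⟩ := hx
    exact ⟨i + 2, gen_mem_genAlg (e := TLInf.gen δ) (by omega)⟩
  | algebraMap r => exact ⟨0, Subalgebra.algebraMap_mem _ r⟩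
  | add x y _ _ hx hy =>
    obtain ⟨n, hn⟩ := hx
    obtain ⟨m, hm⟩ := hy
    exact ⟨max n m, add_mem (genAlg_mono (le_max_left _ _) hn) (genAlg_mono (le_max_right _ _) hm)⟩
  | mul x y _ _ hx hy =>
    obtain ⟨n, hn⟩ := hx
    obtain ⟨m, hm⟩ := hy
    exact ⟨max n m, mul_mem (genAlg_mono (le_max_left _ _) hn) (genAlg_mono (le_max_right _ _) hm)⟩

/-- The algebra morphism from `TL_n(δ)` given by elements that satisfy its relations. -/
noncomputable def IsTLFamily.lift {n : ℕ} (he : IsTLFamily δ n e) : TL δ n →ₐ[ℂ] R :=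
  RingQuot.liftAlgHom ℂ ⟨FreeAlgebra.lift ℂ fun i : TLIndex n => e i, by
    intro x y h
    induction h with
    | sq i => simpa using he.sq i i.2
    | braid i j h =>
      obtain ⟨i, hi⟩ := i
      obtain ⟨j, hj⟩ := j
      have hi : i + 1 < n := hi
      have hj : j + 1 < n := hj
      rcases h with h | h
      · obtain rfl : i + 1 = j := h
        simpa using he.up i (by omega)
      · obtain rfl : j + 1 = i := h
        simpa using he.down j (by omega)
    | comm i j h =>
      rcases h with h | h
      · simpa using (he.comm i j h j.2).eq
      · simpa using (he.comm j i h i.2).eq.symm⟩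

theorem IsTLFamily.lift_gen {n i : ℕ} (he : IsTLFamily δ n e) (hi : i + 1 < n) :
    he.lift (TL.gen δ n i) = e i := by
  simp [IsTLFamily.lift, TL.gen, hi]

theorem TL.incl_gen {n i : ℕ} (hi : i + 1 < n) : TL.incl δ n (TL.gen δ n i) = TLInf.gen δ i := by
  simp [TL.incl, TL.gen, TLInf.gen, hi]

theorem TL.algHom_ext {n : ℕ} {φ ψ : TL δ n →ₐ[ℂ] R}
    (h : ∀ i, i + 1 < n → φ (TL.gen δ n i) = ψ (TL.gen δ n i)) : φ = ψ := by
  refine AlgHom.ext_of_adjoin_eq_top (TL.genAlg_eq_top δ n) ?_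
  rintro _ ⟨i, hi, rfl⟩
  exact h i hi

theorem TL.range_incl (δ : ℂ) (n : ℕ) : (TL.incl δ n).range = genAlg (TLInf.gen δ) n := by
  rw [← Algebra.map_top, ← TL.genAlg_eq_top, genAlg, AlgHom.map_adjoin, genAlg, Set.image_image]
  congr 1
  exact Set.image_congr fun i hi => TL.incl_gen hi

/-- The inclusion `TL_n(δ) → TL_m(δ)` for `n ≤ m`. -/
noncomputable def TL.inclOfLE (δ : ℂ) {n m : ℕ} (h : n ≤ m) : TL δ n →ₐ[ℂ] TL δ m :=
  ((TL.isTLFamily δ m).mono h).lift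

theorem TL.inclOfLE_gen {n m i : ℕ} (h : n ≤ m) (hi : i + 1 < n) :
    TL.inclOfLE δ h (TL.gen δ n i) = TL.gen δ m i :=
  IsTLFamily.lift_gen _ hi

theorem TL.incl_inclOfLE {n m : ℕ} (h : n ≤ m) (x : TL δ n) :
    TL.incl δ m (TL.inclOfLE δ h x) = TL.incl δ n x := by
  have : (TL.incl δ m).comp (TL.inclOfLE δ h) = TL.incl δ n :=
    TL.algHom_ext fun i hi => by
      simp [TL.inclOfLE_gen h hi, TL.incl_gen hi, TL.incl_gen (lt_of_lt_of_le hi h)]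
  exact DFunLike.congr_fun this x

theorem TL.inclOfLE_mem {n m : ℕ} (h : n ≤ m) (x : TL δ n) :
    TL.inclOfLE δ h x ∈ genAlg (TL.gen δ m) n := by
  have : (TL.inclOfLE δ h).range ≤ genAlg (TL.gen δ m) n := by
    rw [← Algebra.map_top, ← TL.genAlg_eq_top, genAlg, AlgHom.map_adjoin, genAlg, Set.image_image]
    exact Algebra.adjoin_mono (Set.image_congr fun i hi => TL.inclOfLE_gen h hi).subset
  exact this ⟨x, rfl⟩

theorem TL.incl_endCups (n k : ℕ) :
    TL.incl δ n (endCups δ (TL.gen δ n) n k) = endCups δ (TLInf.gen δ) n k := by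
  rw [map_endCups]
  exact endCups_congr k fun i hi => TL.incl_gen hi
end

/-! ### Finite-dimensional representations and their traces -/

section
variable {A M M' : Type*} [Ring A] [Algebra ℂ A] [AddCommGroup M] [Module ℂ M]
  [AddCommGroup M'] [Module ℂ M']

/-- Cyclicity of the trace: i ∘ r is a projection onto a copy of M', and g restricted to this copy
is g'. -/
theorem trace_mul_of_section [FiniteDimensional ℂ M] [FiniteDimensional ℂ M']
    {i : M' →ₗ[ℂ] M} {r : M →ₗ[ℂ] M'} (hri : r ∘ₗ i = LinearMap.id) {g : Module.End ℂ M}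
    {g' : Module.End ℂ M'} (h : g ∘ₗ i = i ∘ₗ g') :
    LinearMap.trace ℂ M (g ∘ₗ i ∘ₗ r) = LinearMap.trace ℂ M' g' := by
  rw [← LinearMap.comp_assoc, h, LinearMap.comp_assoc, LinearMap.trace_comp_comm',
    LinearMap.comp_assoc, hri, LinearMap.comp_id]

/-- The restriction of a representation to an invariant subspace. -/
noncomputable def subRep (ρ : A →ₐ[ℂ] Module.End ℂ M) (N : Submodule ℂ M)
    (h : ∀ x, N ≤ N.comap (ρ x)) : A →ₐ[ℂ] Module.End ℂ N :=
  AlgHom.ofLinearMap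
    { toFun := fun x => (ρ x).restrict (h x)
      map_add' := fun x y => by ext; simp
      map_smul' := fun c x => by ext; simp }
    (by ext; simp) (fun x y => by ext; simp)

/-- The quotient of a representation by an invariant subspace. -/
noncomputable def quotRep (ρ : A →ₐ[ℂ] Module.End ℂ M) (N : Submodule ℂ M)
    (h : ∀ x, N ≤ N.comap (ρ x)) : A →ₐ[ℂ] Module.End ℂ (M ⧸ N) :=
  AlgHom.ofLinearMap
    { toFun := fun x => N.mapQ N (ρ x) (h x)
      map_add' := fun x y => by apply Submodule.linearMap_qext; ext; simp
      map_smul' := fun c x => by apply Submodule.linearMap_qext; ext; simp }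
    (by apply Submodule.linearMap_qext; ext; simp)
    (fun x y => by apply Submodule.linearMap_qext; ext; simp)

theorem quotRep_mk (ρ : A →ₐ[ℂ] Module.End ℂ M) (N : Submodule ℂ M)
    (h : ∀ x, N ≤ N.comap (ρ x)) (x : A) (v : M) :
    quotRep ρ N h x (Submodule.Quotient.mk v) = Submodule.Quotient.mk (ρ x v) := rfl

/-- A linear complement s of N splits the identity into two projections, and the trace is the sum of
the two diagonal blocks. -/
theorem trace_eq_trace_sub_add_trace_quot [FiniteDimensional ℂ M] (ρ : A →ₐ[ℂ] Module.End ℂ M)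
    (N : Submodule ℂ M) (h : ∀ x, N ≤ N.comap (ρ x)) (x : A) :
    LinearMap.trace ℂ M (ρ x) =
      LinearMap.trace ℂ N (subRep ρ N h x) + LinearMap.trace ℂ (M ⧸ N) (quotRep ρ N h x) := by
  obtain ⟨s, hs⟩ := N.mkQ.exists_rightInverse_of_surjective (Submodule.range_mkQ N)
  have hmem : ∀ v, ((LinearMap.id : M →ₗ[ℂ] M) - s ∘ₗ N.mkQ) v ∈ N := by
    intro v
    have := DFunLike.congr_fun hs (N.mkQ v)
    rw [← Submodule.Quotient.mk_eq_zero, ← Submodule.mkQ_apply, LinearMap.sub_apply, map_sub]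
    simpa [sub_eq_zero] using this.symm
  set r : M →ₗ[ℂ] N := ((LinearMap.id : M →ₗ[ℂ] M) - s ∘ₗ N.mkQ).codRestrict N hmem with hr
  have hsum : N.subtype ∘ₗ r + s ∘ₗ N.mkQ = LinearMap.id := by
    ext v
    simp [hr]
  have hrN : r ∘ₗ N.subtype = LinearMap.id := by
    ext v
    have : (Submodule.Quotient.mk (v : M) : M ⧸ N) = 0 := (Submodule.Quotient.mk_eq_zero N).2 v.2
    simp [hr, this]
  have h1 : LinearMap.trace ℂ M (ρ x ∘ₗ N.subtype ∘ₗ r) =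
      LinearMap.trace ℂ N (subRep ρ N h x) := trace_mul_of_section hrN rfl
  have h2 : LinearMap.trace ℂ M (ρ x ∘ₗ s ∘ₗ N.mkQ) =
      LinearMap.trace ℂ (M ⧸ N) (quotRep ρ N h x) := by
    rw [← LinearMap.comp_assoc, LinearMap.trace_comp_comm', ← LinearMap.comp_assoc]
    have : N.mkQ ∘ₗ ρ x = quotRep ρ N h x ∘ₗ N.mkQ := rfl
    rw [this, LinearMap.comp_assoc, hs, LinearMap.comp_id]
  rw [← h1, ← h2, ← map_add, ← LinearMap.comp_add, hsum, LinearMap.comp_id]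

/-- A representation is irreducible: the space is not zero and has no proper invariant subspace
other than zero. -/
def IsIrr (ρ : A →ₐ[ℂ] Module.End ℂ M) : Prop :=
  Nontrivial M ∧ ∀ N : Submodule ℂ M, (∀ x, N ≤ N.comap (ρ x)) → N = ⊥ ∨ N = ⊤

/-- The submodule generated by a vector. -/
noncomputable def orbitMap (ρ : A →ₐ[ℂ] Module.End ℂ M) (v : M) : A →ₗ[ℂ] M :=
  LinearMap.applyₗ v ∘ₗ ρ.toLinearMap

theorem orbitMap_apply (ρ : A →ₐ[ℂ] Module.End ℂ M) (v : M) (a : A) :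
    orbitMap ρ v a = ρ a v := rfl

theorem range_orbitMap_le (ρ : A →ₐ[ℂ] Module.End ℂ M) (v : M) (x : A) :
    LinearMap.range (orbitMap ρ v) ≤ (LinearMap.range (orbitMap ρ v)).comap (ρ x) := by
  rintro _ ⟨a, rfl⟩
  exact ⟨x * a, by simp [orbitMap_apply]⟩

theorem IsIrr.range_orbitMap {ρ : A →ₐ[ℂ] Module.End ℂ M} (hρ : IsIrr ρ) {v : M} (hv : v ≠ 0) :
    LinearMap.range (orbitMap ρ v) = ⊤ := by
  refine (hρ.2 _ (range_orbitMap_le ρ v)).resolve_left fun h => hv ?_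
  have : orbitMap ρ v 1 ∈ LinearMap.range (orbitMap ρ v) := ⟨1, rfl⟩
  rw [h, orbitMap_apply, map_one] at this
  simpa using this

/-- If `z` is an idempotent such that `z A z` acts by the same scalars on the images of `z` in two
irreducible representations, then these have the same annihilator of corresponding vectors. -/
theorem apply_eq_zero_of_sandwich {ρ : A →ₐ[ℂ] Module.End ℂ M} {ρ' : A →ₐ[ℂ] Module.End ℂ M'}
    (hρ' : IsIrr ρ') {z : A}
    (hs : ∀ x, ∃ c : ℂ, ρ (z * x * z) = c • ρ z ∧ ρ' (z * x * z) = c • ρ' z)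
    {v : M} {v' : M'} (hv : ρ z v = v) (hv0 : v ≠ 0) (hv' : ρ' z v' = v') (hv0' : v' ≠ 0)
    {a : A} (ha : ρ a v = 0) : ρ' a v' = 0 := by
  by_contra hne
  have htop := hρ'.range_orbitMap hne
  have hz : ∀ w, ρ' z w = 0 := by
    intro w
    obtain ⟨x, rfl⟩ : w ∈ LinearMap.range (orbitMap ρ' (ρ' a v')) := htop ▸ trivial
    obtain ⟨c, h1, h2⟩ := hs (x * a)
    have hc : c • v = 0 := by
      calc c • v = (c • ρ z) v := by rw [LinearMap.smul_apply, hv]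
        _ = ρ (z * x) (ρ a (ρ z v)) := by rw [← h1]; simp
        _ = 0 := by rw [hv, ha, map_zero]
    have hc : c = 0 := (smul_eq_zero.1 hc).resolve_right hv0
    calc ρ' z (ρ' x (ρ' a v')) = ρ' z (ρ' x (ρ' a (ρ' z v'))) := by rw [hv']
      _ = ρ' (z * (x * a) * z) v' := by simp
      _ = 0 := by rw [h2, hc]; simp
  exact hv0' (hv' ▸ hz v')

/-- Both modules are cyclic, generated by vectors fixed by z, and these vectors have the same
annihilator. Hence both are the same quotient of A by a left ideal. -/
theorem trace_eq_of_sandwich {ρ : A →ₐ[ℂ] Module.End ℂ M} {ρ' : A →ₐ[ℂ] Module.End ℂ M'}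
    (hρ : IsIrr ρ) (hρ' : IsIrr ρ') {z : A} (hz : z * z = z) (h0 : ρ z ≠ 0) (h0' : ρ' z ≠ 0)
    (hs : ∀ x, ∃ c : ℂ, ρ (z * x * z) = c • ρ z ∧ ρ' (z * x * z) = c • ρ' z) (x : A) :
    LinearMap.trace ℂ M (ρ x) = LinearMap.trace ℂ M' (ρ' x) := by
  obtain ⟨u, hu⟩ : ∃ u, ρ z u ≠ 0 := by
    by_contra! h
    exact h0 (LinearMap.ext h)
  obtain ⟨u', hu'⟩ : ∃ u', ρ' z u' ≠ 0 := by
    by_contra! h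
    exact h0' (LinearMap.ext h)
  set v := ρ z u
  set v' := ρ' z u'
  have hv : ρ z v = v := by
    change (ρ z * ρ z) u = _
    rw [← map_mul, hz]
  have hv' : ρ' z v' = v' := by
    change (ρ' z * ρ' z) u' = _
    rw [← map_mul, hz]
  have hker : LinearMap.ker (orbitMap ρ v) = LinearMap.ker (orbitMap ρ' v') := by
    ext a
    simp only [LinearMap.mem_ker, orbitMap_apply]
    exact ⟨apply_eq_zero_of_sandwich hρ' hs hv hu hv' hu',
      apply_eq_zero_of_sandwich hρ (fun x => (hs x).imp fun _ h => h.symm) hv' hu' hv hu⟩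
  have hr := LinearMap.range_eq_top.1 (hρ.range_orbitMap hu)
  have hr' := LinearMap.range_eq_top.1 (hρ'.range_orbitMap hu')
  let φ : M ≃ₗ[ℂ] M' := ((orbitMap ρ v).quotKerEquivOfSurjective hr).symm ≪≫ₗ
    Submodule.quotEquivOfEq _ _ hker ≪≫ₗ (orbitMap ρ' v').quotKerEquivOfSurjective hr'
  have hφ : ∀ a, φ (ρ a v) = ρ' a v' := by
    intro a
    have : ((orbitMap ρ v).quotKerEquivOfSurjective hr).symm (ρ a v) =
        Submodule.Quotient.mk a := by
      rw [LinearEquiv.symm_apply_eq]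
      rfl
    simp only [φ, LinearEquiv.trans_apply, this]
    rfl
  have hconj : φ.conj (ρ x) = ρ' x := by
    ext w
    obtain ⟨a, rfl⟩ := hr' w
    have h1 : φ.symm (orbitMap ρ' v' a) = ρ a v := by
      rw [LinearEquiv.symm_apply_eq, hφ]
      rfl
    rw [LinearEquiv.conj_apply_apply, h1]
    have := hφ (x * a)
    simpa [orbitMap_apply] using this
  rw [← hconj, LinearMap.trace_conj']

end

/-! ### Irreducible representations of the Temperley-Lieb algebras -/

section
variable {M M' : Type*} [AddCommGroup M] [Module ℂ M] [AddCommGroup M'] [Module ℂ M'] {δ : ℂ}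
  {n k : ℕ}

/-- The idempotent with `k` cups does not vanish in a representation, but its products with the
generators on the remaining points do. -/
def HasTop (ρ : TL δ n →ₐ[ℂ] Module.End ℂ M) (k : ℕ) : Prop :=
  k ∈ irrLabels δ n ∧ ρ (endCups δ (TL.gen δ n) n k) ≠ 0 ∧
    ∀ j, j + 1 < n - 2 * k → ρ (TL.gen δ n j * endCups δ (TL.gen δ n) n k) = 0

theorem hasTop_of_isIrr {ρ : TL δ n →ₐ[ℂ] Module.End ℂ M} (hρ : IsIrr ρ) (hk : k ∈ irrLabels δ n)
    (h0 : ρ (endCups δ (TL.gen δ n) n k) ≠ 0)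
    (h1 : k + 1 ∈ irrLabels δ n → ρ (endCups δ (TL.gen δ n) n (k + 1)) = 0) : HasTop ρ k := by
  refine ⟨hk, h0, fun j hj => ?_⟩
  by_cases hk' : k + 1 ∈ irrLabels δ n
  · have := ((TL.isTLFamily δ n).map ρ).gen_mul_endCups hk hk'
      (by rw [← map_endCups]; exact h1 hk') hj
    rwa [← map_endCups, ← map_mul] at this
  · rw [mem_irrLabels] at hk'
    -- The omitted label: two points remain, with one generator g, and g² = 0. If g z s ≠ 0,
    -- irreducibility gives s = a g z s for some a. But z a z = y z with y a polynomial in g, so g z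
    -- a g z = g y z g z is a multiple of g² z and vanishes, which contradicts g z s ≠ 0.
    obtain ⟨hn, hδ⟩ : n = 2 * (k + 1) ∧ δ = 0 := by
      by_contra h
      refine hk' ⟨by omega, fun h2 _ h3 => h ⟨h2, h3⟩⟩
    obtain rfl : j = 0 := by omega
    have hfam := TL.isTLFamily δ n
    have hmem : TL.gen δ n 0 ∈ genAlg (TL.gen δ n) (n - 2 * k) := gen_mem_genAlg hj
    have hz := hfam.endCups_mul_endCups hk hmem
    have hzz := hfam.endCups_sq hk
    have hsq : TL.gen δ n 0 * TL.gen δ n 0 = 0 := by rw [hfam.sq 0 (by omega), hδ, zero_smul]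
    have hsand : ∀ x : TL δ n, ∃ y ∈ genAlg (TL.gen δ n) (n - 2 * k),
        endCups δ (TL.gen δ n) n k * x * endCups δ (TL.gen δ n) n k =
          y * endCups δ (TL.gen δ n) n k :=
      fun x => hfam.endCups_sandwich hk (by rw [TL.genAlg_eq_top]; trivial)
    set z := endCups δ (TL.gen δ n) n k
    set g := TL.gen δ n 0
    have hy : ∀ y ∈ genAlg (TL.gen δ n) (n - 2 * k), ∃ c : ℂ, g * y = c • g := by
      intro y hy
      induction hy using Algebra.adjoin_induction with
      | mem y hy =>
        obtain ⟨i, hi, rfl⟩ := hy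
        have hi : i + 1 < n - 2 * k := hi
        obtain rfl : i = 0 := by omega
        exact ⟨0, by rw [hsq, zero_smul]⟩
      | algebraMap r => exact ⟨r, by rw [← Algebra.commutes, ← Algebra.smul_def]⟩
      | add y y' _ _ h h' =>
        obtain ⟨c, hc⟩ := h
        obtain ⟨c', hc'⟩ := h'
        exact ⟨c + c', by rw [mul_add, hc, hc', add_smul]⟩
      | mul y y' _ _ h h' =>
        obtain ⟨c, hc⟩ := h
        obtain ⟨c', hc'⟩ := h'
        exact ⟨c * c', by rw [← mul_assoc, hc, smul_mul_assoc, hc', smul_smul]⟩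
    by_contra hne
    obtain ⟨s, hs⟩ : ∃ s, ρ (g * z) s ≠ 0 := by
      by_contra! h
      exact hne (LinearMap.ext h)
    obtain ⟨a, ha⟩ : s ∈ LinearMap.range (orbitMap ρ (ρ (g * z) s)) :=
      hρ.range_orbitMap hs ▸ trivial
    obtain ⟨y, hy', hay⟩ := hsand a
    obtain ⟨c, hc⟩ := hy y hy'
    apply hs
    calc ρ (g * z) s = ρ (g * z) (ρ a (ρ (g * z) s)) := by
          conv_lhs => rw [← ha]
          rfl
      _ = ρ (g * z) (ρ a (ρ (z * g * z) s)) := by rw [hz]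
      _ = ρ (g * (z * a * z) * g * z) s := by simp
      _ = ρ ((g * y) * (z * g * z)) s := by rw [hay]; simp
      _ = 0 := by
        rw [hc, hz, smul_mul_assoc, ← mul_assoc, hsq]
        simp

theorem exists_hasTop {ρ : TL δ n →ₐ[ℂ] Module.End ℂ M} (hρ : IsIrr ρ) : ∃ k, HasTop ρ k := by
  classical
  set I := (irrLabels δ n).filter fun k => ρ (endCups δ (TL.gen δ n) n k) ≠ 0 with hI
  have h0 : 0 ∈ I := by
    have := hρ.1
    rw [hI, Finset.mem_filter, mem_irrLabels]
    refine ⟨⟨by omega, fun h1 h2 => by omega⟩, ?_⟩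
    simp [endCups]
  have hmem := I.max'_mem ⟨0, h0⟩
  set k := I.max' ⟨0, h0⟩ with hk
  rw [hI, Finset.mem_filter] at hmem
  refine ⟨k, hasTop_of_isIrr hρ hmem.1 hmem.2 fun h => ?_⟩
  by_contra hne
  have := I.le_max' (k + 1) (by rw [hI, Finset.mem_filter]; exact ⟨h, hne⟩)
  omega

/-- The corner z TL_n z consists of elements y z with y a polynomial in the generators on the
remaining points. Since these generators annihilate z in both representations, y z acts as the
constant term of y times z. -/
theorem trace_eq_of_hasTop {ρ : TL δ n →ₐ[ℂ] Module.End ℂ M} {ρ' : TL δ n →ₐ[ℂ] Module.End ℂ M'}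
    (hρ : IsIrr ρ) (hρ' : IsIrr ρ') (hk : HasTop ρ k) (hk' : HasTop ρ' k) (x : TL δ n) :
    LinearMap.trace ℂ M (ρ x) = LinearMap.trace ℂ M' (ρ' x) := by
  have hfam := TL.isTLFamily δ n
  refine trace_eq_of_sandwich hρ hρ' (hfam.endCups_sq hk.1) hk.2.1 hk'.2.1 (fun x => ?_) x
  obtain ⟨y, hy, h⟩ := hfam.endCups_sandwich hk.1 (x := x) (by rw [TL.genAlg_eq_top]; trivial)
  rw [h]
  clear h
  have e1 := hk.2.2
  have e2 := hk'.2.2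
  set z := endCups δ (TL.gen δ n) n k
  induction hy using Algebra.adjoin_induction with
  | mem y hy =>
    obtain ⟨i, hi, rfl⟩ := hy
    exact ⟨0, by rw [e1 i hi, zero_smul], by rw [e2 i hi, zero_smul]⟩
  | algebraMap r =>
    exact ⟨r, by rw [← Algebra.smul_def, map_smul], by rw [← Algebra.smul_def, map_smul]⟩
  | add y y' _ _ h h' =>
    obtain ⟨c, h1, h2⟩ := h
    obtain ⟨c', h1', h2'⟩ := h'
    exact ⟨c + c', by rw [add_mul, map_add, h1, h1', add_smul],
      by rw [add_mul, map_add, h2, h2', add_smul]⟩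
  | mul y y' _ _ h h' =>
    obtain ⟨c, h1, h2⟩ := h
    obtain ⟨c', h1', h2'⟩ := h'
    exact ⟨c' * c, by rw [mul_assoc, map_mul, h1', mul_smul_comm, ← map_mul, h1, smul_smul],
      by rw [mul_assoc, map_mul, h2', mul_smul_comm, ← map_mul, h2, smul_smul]⟩

end

/-! ### Link states with a cup at the end -/

section
variable {n p : ℕ}

/-- Append a cup joining two new points at the end. -/
def appendCupFun (f : Fin n → Fin n) (a : Fin (n + 2)) : Fin (n + 2) :=
  if h : a.1 < n then (f ⟨a, h⟩).castAdd 2 else if a.1 = n then Fin.last (n + 1) else ⟨n, by omega⟩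

theorem appendCupFun_castAdd (f : Fin n → Fin n) (a : Fin n) :
    appendCupFun f (a.castAdd 2) = (f a).castAdd 2 := by
  simp [appendCupFun]

theorem appendCupFun_penult (f : Fin n → Fin n) :
    appendCupFun f ⟨n, by omega⟩ = Fin.last (n + 1) := by
  simp [appendCupFun]

theorem appendCupFun_last (f : Fin n → Fin n) :
    appendCupFun f (Fin.last (n + 1)) = ⟨n, by omega⟩ := by
  simp [appendCupFun]

theorem fin_add_two_cases (a : Fin (n + 2)) :
    (∃ b : Fin n, a = b.castAdd 2) ∨ a = ⟨n, by omega⟩ ∨ a = Fin.last (n + 1) := by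
  by_cases h : a.1 < n
  · exact Or.inl ⟨⟨a, h⟩, rfl⟩
  · by_cases h' : a.1 = n
    · exact Or.inr (Or.inl (Fin.ext h'))
    · exact Or.inr (Or.inr (Fin.ext (by simp; omega)))

theorem castAdd_ne_penult (b : Fin n) : b.castAdd 2 ≠ ⟨n, by omega⟩ := by
  simp only [ne_eq, Fin.ext_iff, Fin.val_castAdd]
  omega

theorem castAdd_ne_last (b : Fin n) : b.castAdd 2 ≠ Fin.last (n + 1) := by
  simp only [ne_eq, Fin.ext_iff, Fin.val_castAdd, Fin.val_last]
  omega

theorem penult_ne_last : (⟨n, by omega⟩ : Fin (n + 2)) ≠ Fin.last (n + 1) := by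
  simp [Fin.ext_iff]

theorem appendCupFun_card (f : Fin n → Fin n) :
    (Finset.univ.filter fun a => appendCupFun f a = a).card =
      (Finset.univ.filter fun a => f a = a).card := by
  have : (Finset.univ.filter fun a => appendCupFun f a = a) =
      (Finset.univ.filter fun a => f a = a).map (Fin.castAddEmb 2) := by
    ext a
    simp only [Finset.mem_filter, Finset.mem_univ, true_and, Finset.mem_map, Fin.castAddEmb_apply]
    constructor
    · intro h
      rcases fin_add_two_cases a with ⟨b, rfl⟩ | rfl | rfl
      · rw [appendCupFun_castAdd] at h
        exact ⟨b, (Fin.castAdd_injective n 2) h, rfl⟩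
      · rw [appendCupFun_penult] at h
        exact absurd h.symm penult_ne_last
      · rw [appendCupFun_last] at h
        exact absurd h penult_ne_last
    · rintro ⟨b, hb, rfl⟩
      rw [appendCupFun_castAdd, hb]
  rw [this, Finset.card_map]

namespace LinkState

/-- Append a cup joining two new points at the end. -/
def appendCup (w : LinkState n p) : LinkState (n + 2) (p + 1) :=
  ⟨appendCupFun w.1, by
    intro a
    rcases fin_add_two_cases a with ⟨b, rfl⟩ | rfl | rfl
    · rw [appendCupFun_castAdd, appendCupFun_castAdd, w.2.1]
    · rw [appendCupFun_penult, appendCupFun_last]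
    · rw [appendCupFun_last, appendCupFun_penult], by
    intro a b hab hb
    rcases fin_add_two_cases a with ⟨a, rfl⟩ | rfl | rfl
    · rw [appendCupFun_castAdd] at hb
      have hbn : b.1 < n := lt_trans (Fin.lt_def.1 hb) (w.1 a).2
      obtain ⟨b, rfl⟩ : ∃ b' : Fin n, b = b'.castAdd 2 := ⟨⟨b, hbn⟩, rfl⟩
      have := w.2.2.1 a b hab hb
      rw [appendCupFun_castAdd, appendCupFun_castAdd]
      exact ⟨fun h => this.1 ((Fin.castAdd_injective n 2) h), this.2⟩
    · rw [appendCupFun_penult] at hb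
      simp only [Fin.lt_def, Fin.val_last] at hab hb
      omega
    · rw [appendCupFun_last] at hb
      simp only [Fin.lt_def, Fin.val_last] at hab hb
      omega, by
    rw [appendCupFun_card]
    have := w.2.2.2
    omega⟩

theorem appendCup_injective : Function.Injective (appendCup : LinkState n p → _) := by
  intro w w' h
  refine Subtype.ext (funext fun a => ?_)
  have := congrFun (congrArg Subtype.val h) (a.castAdd 2)
  simp only [appendCup, appendCupFun_castAdd] at this
  exact Fin.castAdd_injective n 2 this

/-- The involution exchanges the last two points, hence preserves the set of the others. -/
theorem exists_appendCup (w : LinkState (n + 2) (p + 1))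
    (hw : w.1 ⟨n, by omega⟩ = Fin.last (n + 1)) : ∃ w', appendCup w' = w := by
  have hw' : w.1 (Fin.last (n + 1)) = ⟨n, by omega⟩ := by rw [← hw, w.2.1]
  have hlt : ∀ a : Fin n, ∃ b : Fin n, w.1 (a.castAdd 2) = b.castAdd 2 := by
    intro a
    rcases fin_add_two_cases (w.1 (a.castAdd 2)) with h | h | h
    · exact h
    · have := w.2.1 (a.castAdd 2)
      rw [h, hw] at this
      exact absurd this.symm (castAdd_ne_last a)
    · have := w.2.1 (a.castAdd 2)
      rw [h, hw'] at this
      exact absurd this.symm (castAdd_ne_penult a)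
  choose f hf using hlt
  have hfun : appendCupFun f = w.1 := by
    funext a
    rcases fin_add_two_cases a with ⟨a, rfl⟩ | rfl | rfl
    · rw [appendCupFun_castAdd, hf]
    · rw [appendCupFun_penult, hw]
    · rw [appendCupFun_last, hw']
  refine ⟨⟨f, fun a => ?_, fun a b hab hb => ?_, ?_⟩, Subtype.ext hfun⟩
  · apply Fin.castAdd_injective n 2
    rw [← hf, ← hf, w.2.1]
  · have := w.2.2.1 (a.castAdd 2) (b.castAdd 2) hab (by rw [hf]; exact hb)
    rw [hf, hf] at this
    exact ⟨fun h => this.1 (by rw [h]), this.2⟩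
  · have h1 := w.2.2.2
    rw [← hfun, appendCupFun_card] at h1
    omega

theorem lact_appendCup (δ : ℂ) (a b : Fin n) (hab : (a : ℕ) + 1 = b) :
    lact (p + 1) δ (a.castAdd 2) (b.castAdd 2) hab ∘ₗ Finsupp.lmapDomain ℂ ℂ appendCup =
      Finsupp.lmapDomain ℂ ℂ appendCup ∘ₗ lact p δ a b hab := by
  refine Finsupp.lhom_ext fun w c => ?_
  have inj := Fin.castAdd_injective n 2
  have ha : (appendCup w).1 (a.castAdd 2) = (w.1 a).castAdd 2 := appendCupFun_castAdd _ _
  have hb : (appendCup w).1 (b.castAdd 2) = (w.1 b).castAdd 2 := appendCupFun_castAdd _ _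
  simp only [LinearMap.comp_apply, Finsupp.lmapDomain_apply, Finsupp.mapDomain_single]
  by_cases h1 : w.1 a = b
  · rw [lact_arc _ _ _ _ _ _ h1, lact_arc _ _ _ _ _ _ (by rw [ha, h1]), Finsupp.mapDomain_single]
  have h1' : (appendCup w).1 (a.castAdd 2) ≠ b.castAdd 2 := by
    rw [ha]
    exact fun h => h1 (inj h)
  by_cases h2 : w.1 a = a ∧ w.1 b = b
  · rw [lact_zero _ _ _ _ _ _ h2, lact_zero _ _ _ _ _ _ (by rw [ha, hb, h2.1, h2.2]; simp),
      Finsupp.mapDomain_zero]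
  have h2' : ¬ ((appendCup w).1 (a.castAdd 2) = a.castAdd 2 ∧
      (appendCup w).1 (b.castAdd 2) = b.castAdd 2) := by
    rw [ha, hb]
    exact fun h => h2 ⟨inj h.1, inj h.2⟩
  rw [lact_join _ _ _ _ _ _ h1 h2, lact_join _ _ _ _ _ _ h1' h2', Finsupp.mapDomain_single]
  congr 1
  refine Subtype.ext (funext fun x => ?_)
  change glue (appendCupFun w.1) (a.castAdd 2) (b.castAdd 2) x = appendCupFun (glue w.1 a b) x
  have n1 := castAdd_ne_penult a
  have n2 := castAdd_ne_penult b
  have n3 := castAdd_ne_last a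
  have n4 := castAdd_ne_last b
  rcases fin_add_two_cases x with ⟨x, rfl⟩ | rfl | rfl
  · rw [appendCupFun_castAdd]
    simp only [glue, appendCupFun_castAdd, inj.eq_iff]
    split_ifs <;> rfl
  · rw [appendCupFun_penult]
    simp only [glue, appendCupFun_penult, n1.symm, n2.symm, n3.symm, n4.symm, if_false]
  · rw [appendCupFun_last]
    simp only [glue, appendCupFun_last, n1.symm, n2.symm, n3.symm, n4.symm, if_false]

/-- Every combination of link states is mapped by a generator to a combination of link states with
a cup at its points. -/
theorem lact_mem_span (δ : ℂ) (a b : Fin n) (hab : (a : ℕ) + 1 = b) (v : LinkState n p →₀ ℂ) :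
    lact p δ a b hab v ∈
      Submodule.span ℂ {x | ∃ w : LinkState n p, w.1 a = b ∧ x = Finsupp.single w 1} := by
  induction v using Finsupp.induction_linear with
  | zero => simp
  | add v w hv hw => rw [map_add]; exact add_mem hv hw
  | single w c =>
    have key : ∀ (w : LinkState n p) (c : ℂ), w.1 a = b → Finsupp.single w c ∈
        Submodule.span ℂ {x | ∃ w : LinkState n p, w.1 a = b ∧ x = Finsupp.single w 1} := by
      intro w c hw
      have : Finsupp.single w c = c • Finsupp.single w (1 : ℂ) := by simp
      rw [this]
      exact Submodule.smul_mem _ _ (Submodule.subset_span ⟨w, hw, rfl⟩)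
    by_cases h1 : w.1 a = b
    · rw [lact_arc _ _ _ _ _ _ h1]
      exact key _ _ h1
    by_cases h2 : w.1 a = a ∧ w.1 b = b
    · rw [lact_zero _ _ _ _ _ _ h2]
      exact zero_mem _
    · rw [lact_join _ _ _ _ _ _ h1 h2]
      exact key _ _ (by simp [join, glue])

/-- A neighbouring generator moves a small cup, and the generator of the cup moves it back. -/
theorem lact_lact_of_arc (δ : ℂ) (a b c d : Fin n) (hab : (a : ℕ) + 1 = b) (hcd : (c : ℕ) + 1 = d)
    (h : b = c ∨ d = a) (w : LinkState n p) (hw : w.1 a = b) :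
    ∃ w' : LinkState n p, w'.1 c = d ∧
      lact p δ c d hcd (Finsupp.single w 1) = Finsupp.single w' 1 ∧
      lact p δ a b hab (Finsupp.single w' 1) = Finsupp.single w 1 := by
  have hf := w.2.1
  have ha := hf a
  have h1 : w.1 c ≠ d := by grind
  have h2 : ¬ (w.1 c = c ∧ w.1 d = d) := by grind
  obtain ⟨g1, g2, g3⟩ := glue_braid (c := c) (d := d) hf (by grind) (by grind) (by grind) hw
  refine ⟨w.join c d hcd h1 h2, by simp [join, glue], lact_join _ _ _ _ _ _ h1 h2, ?_⟩
  rw [lact_join _ _ _ _ _ _ g2 g3]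
  congr 1
  exact Subtype.ext g1

theorem two_mul_le (w : LinkState n p) : 2 * p ≤ n := by
  have := w.2.2.2
  omega

/-- A cup of minimal length joins neighbours: a point strictly below it would belong to a shorter
cup. -/
theorem exists_small_cup (w : LinkState n (p + 1)) :
    ∃ a b : Fin n, (a : ℕ) + 1 = b ∧ w.1 a = b := by
  classical
  have h0 : ∃ d : ℕ, ∃ a : Fin n, a < w.1 a ∧ (w.1 a : ℕ) - a = d := by
    by_contra! h
    have hfix : ∀ a, w.1 a = a := by
      intro a
      have h1 : ¬ a < w.1 a := fun h' => h _ a h' rfl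
      have h2 : ¬ w.1 a < w.1 (w.1 a) := fun h' => h _ _ h' rfl
      rw [w.2.1] at h2
      exact le_antisymm (not_lt.1 h1) (not_lt.1 h2)
    have := w.2.2.2
    simp [hfix] at this
  obtain ⟨a, ha, hd⟩ := Nat.find_spec h0
  have hmin := fun m => @Nat.find_min _ _ h0 m
  refine ⟨a, w.1 a, ?_, rfl⟩
  have ha' : (a : ℕ) < w.1 a := ha
  by_contra hne
  set b : Fin n := ⟨a + 1, by have := (w.1 a).2; omega⟩ with hb
  have hab : a < b := by simp [hb, Fin.lt_def]
  have hba : b < w.1 a := by simp only [hb, Fin.lt_def]; omega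
  obtain ⟨h1, h2, h3⟩ := w.2.2.1 a b hab hba
  have hbv : (b : ℕ) = a + 1 := rfl
  have h2' : (a : ℕ) < w.1 b := h2
  have h3' : (w.1 b : ℕ) < w.1 a := h3
  have hne' : (w.1 b : ℕ) ≠ b := fun h => h1 (Fin.ext h)
  refine hmin ((w.1 b : ℕ) - b) (by omega) ⟨b, ?_, rfl⟩
  rw [Fin.lt_def]
  omega

instance : Subsingleton (LinkState n 0) := by
  have key : ∀ w : LinkState n 0, ∀ a, w.1 a = a := by
    intro w a
    have h := w.2.2.2
    have : (Finset.univ.filter fun a => w.1 a = a) = Finset.univ := by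
      apply Finset.eq_univ_of_card
      simpa using h
    have ha := Finset.mem_univ a
    rw [← this, Finset.mem_filter] at ha
    exact ha.2
  exact ⟨fun w w' => Subtype.ext (funext fun a => by rw [key w, key w'])⟩

theorem apply_zero (w : LinkState n 0) (a : Fin n) : w.1 a = a := by
  have h : w = ⟨id, fun _ => rfl, fun a b h1 h2 => absurd (h1.trans h2) (lt_irrefl _),
    by simp⟩ := Subsingleton.elim _ _
  rw [h]
  rfl

instance : Nonempty (LinkState n 0) :=
  ⟨⟨id, fun _ => rfl, fun _ _ h1 h2 => absurd (h1.trans h2) (lt_irrefl _), by simp⟩⟩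

end LinkState

/-! ### The standard module on n points inside the one on n + 2 points -/

theorem stdRep_gen {δ : ℂ} {i : ℕ} (hi : i + 1 < n) :
    stdRep δ n p (TL.gen δ n i) =
      LinkState.lact p δ ⟨i, Nat.lt_of_succ_lt hi⟩ ⟨i + 1, hi⟩ rfl := by
  simp [stdRep, TL.gen, hi]

/-- Append a cup to all link states of a combination. -/
noncomputable def appendLin (n p : ℕ) :
    (LinkState n p →₀ ℂ) →ₗ[ℂ] (LinkState (n + 2) (p + 1) →₀ ℂ) :=
  Finsupp.lmapDomain ℂ ℂ LinkState.appendCup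

theorem appendLin_single (w : LinkState n p) (c : ℂ) :
    appendLin n p (Finsupp.single w c) = Finsupp.single w.appendCup c := by
  simp [appendLin]

theorem appendLin_injective : Function.Injective (appendLin n p) :=
  Finsupp.mapDomain_injective LinkState.appendCup_injective

variable {δ : ℂ}

theorem stdRep_inclOfLE_appendLin (x : TL δ n) :
    stdRep δ (n + 2) (p + 1) (TL.inclOfLE δ (Nat.le_add_right n 2) x) ∘ₗ appendLin n p =
      appendLin n p ∘ₗ stdRep δ n p x := by
  have hx : x ∈ genAlg (TL.gen δ n) n := by rw [TL.genAlg_eq_top]; trivial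
  induction hx using Algebra.adjoin_induction with
  | mem x hx =>
    obtain ⟨i, hi, rfl⟩ := hx
    have hi : i + 1 < n := hi
    rw [TL.inclOfLE_gen _ hi, stdRep_gen hi, stdRep_gen (by omega)]
    exact LinkState.lact_appendCup δ ⟨i, by omega⟩ ⟨i + 1, hi⟩ rfl
  | algebraMap r => exact LinearMap.ext fun v => by simp [Module.algebraMap_end_apply]
  | add x y _ _ hx hy =>
    rw [map_add, map_add, LinearMap.add_comp, hx, hy, map_add, LinearMap.comp_add]
  | mul x y _ _ hx hy =>
    rw [map_mul, map_mul, Module.End.mul_eq_comp, LinearMap.comp_assoc, hy, ← LinearMap.comp_assoc,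
      hx, LinearMap.comp_assoc, map_mul, Module.End.mul_eq_comp]

theorem span_endCup_le_range :
    Submodule.span ℂ {x | ∃ w : LinkState (n + 2) (p + 1), w.1 ⟨n, by omega⟩ = Fin.last (n + 1) ∧
      x = Finsupp.single w 1} ≤ LinearMap.range (appendLin n p) := by
  rw [Submodule.span_le]
  rintro _ ⟨w, hw, rfl⟩
  obtain ⟨w', rfl⟩ := w.exists_appendCup hw
  exact ⟨Finsupp.single w' 1, appendLin_single _ _⟩

/-- With `stdRep_endCup_appendLin` this shows that the end cup idempotent is a projection of
V_{n+2,p+1} onto the copy of V_{n,p} formed by the link states with a cup at the end. -/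
theorem range_stdRep_endCup_le :
    LinearMap.range (stdRep δ (n + 2) (p + 1) (endCup δ (TL.gen δ (n + 2)) (n + 2))) ≤
      LinearMap.range (appendLin n p) := by
  rintro _ ⟨v, rfl⟩
  apply span_endCup_le_range
  rcases n with _ | n
  · rw [endCup, map_smul, stdRep_gen (by omega)]
    exact Submodule.smul_mem _ _ (LinkState.lact_mem_span δ _ _ _ v)
  · rw [endCup, map_mul, stdRep_gen (by omega)]
    exact LinkState.lact_mem_span δ _ _ _ _

theorem stdRep_endCup_appendLin (h0 : 0 < n ∨ δ ≠ 0) :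
    stdRep δ (n + 2) (p + 1) (endCup δ (TL.gen δ (n + 2)) (n + 2)) ∘ₗ appendLin n p =
      appendLin n p := by
  refine Finsupp.lhom_ext' fun w => LinearMap.ext_ring ?_
  simp only [LinearMap.comp_apply, Finsupp.lsingle_apply, appendLin_single]
  have hw : w.appendCup.1 ⟨n, by omega⟩ = Fin.last (n + 1) := appendCupFun_penult _
  rcases n with _ | n
  · have h0 : δ ≠ 0 := by simpa using h0
    rw [endCup, map_smul, stdRep_gen (by omega), LinearMap.smul_apply,
      LinkState.lact_arc _ ⟨0, _⟩ ⟨0 + 1, _⟩ _ _ _ hw]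
    simp [h0]
  · rw [endCup, map_mul, stdRep_gen (by omega), stdRep_gen (by omega), Module.End.mul_apply]
    obtain ⟨w', -, h1, h2⟩ := LinkState.lact_lact_of_arc δ (⟨n + 1, by omega⟩ : Fin (n + 3))
      ⟨n + 2, by omega⟩ ⟨n, by omega⟩ ⟨n + 1, by omega⟩ rfl rfl (Or.inr rfl) w.appendCup hw
    rw [h1, h2]

theorem stdRep_zero_gen {i : ℕ} (hi : i + 1 < n) : stdRep δ n 0 (TL.gen δ n i) = 0 := by
  rw [stdRep_gen hi]
  refine Finsupp.lhom_ext fun w c => ?_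
  rw [LinkState.lact_zero _ _ _ _ _ _ ⟨w.apply_zero _, w.apply_zero _⟩]
  simp

theorem stdRep_zero_endCup : stdRep δ n 0 (endCup δ (TL.gen δ n) n) = 0 := by
  rcases n with _ | _ | _ | n
  · simp [endCup]
  · simp [endCup]
  · rw [endCup, map_smul, stdRep_zero_gen (by omega), smul_zero]
  · rw [endCup, map_mul, stdRep_zero_gen (by omega), zero_mul]

/-- An invariant subspace that contains all link states with a cup at the end is everything. -/
theorem eq_top_of_range_appendLin_le {N : Submodule ℂ (LinkState (n + 2) (p + 1) →₀ ℂ)}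
    (hN : ∀ x, N ≤ N.comap (stdRep δ (n + 2) (p + 1) x))
    (h : LinearMap.range (appendLin n p) ≤ N) : N = ⊤ := by
  have hgen : ∀ i (hi : i + 1 < n + 2) (v), v ∈ N →
      LinkState.lact (p + 1) δ ⟨i, Nat.lt_of_succ_lt hi⟩ ⟨i + 1, hi⟩ rfl v ∈ N := by
    intro i hi v hv
    rw [← stdRep_gen hi]
    exact hN _ hv
  -- Downward induction on the position of a small cup: the generator at its own points recovers a
  -- link state from the one with the cup moved one place to the right.
  have key : ∀ i ≤ n, ∀ (hi : i + 1 < n + 2) (w : LinkState (n + 2) (p + 1)),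
      w.1 ⟨i, Nat.lt_of_succ_lt hi⟩ = ⟨i + 1, hi⟩ → Finsupp.single w (1 : ℂ) ∈ N := by
    intro i hin
    induction hin using Nat.decreasingInduction with
    | self =>
      intro _ w hw
      obtain ⟨w', rfl⟩ := w.exists_appendCup hw
      exact h ⟨Finsupp.single w' 1, appendLin_single _ _⟩
    | of_succ i hin ih =>
      intro hi w hw
      obtain ⟨w', h1, -, h2⟩ := LinkState.lact_lact_of_arc δ ⟨i, Nat.lt_of_succ_lt hi⟩ ⟨i + 1, hi⟩
        ⟨i + 1, hi⟩ ⟨i + 2, by omega⟩ rfl rfl (Or.inl rfl) w hw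
      rw [← h2]
      exact hgen _ _ _ (ih (by omega) w' h1)
  rw [eq_top_iff]
  intro v _
  induction v using Finsupp.induction_linear with
  | zero => exact zero_mem _
  | add v w hv hw => exact add_mem (hv trivial) (hw trivial)
  | single w c =>
    obtain ⟨a, b, hab, hw⟩ := w.exists_small_cup
    have hb := b.2
    have : Finsupp.single w c = c • Finsupp.single w (1 : ℂ) := by simp
    rw [this]
    refine N.smul_mem _ (key a (by omega) (by omega) w ?_)
    rw [hw]
    exact Fin.ext hab.symm

end

/-! ### Traces of the idempotents, and irreducibility of the quotients -/

section
variable {n p k : ℕ} {δ : ℂ}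

theorem inclOfLE_endCups (n k : ℕ) :
    TL.inclOfLE δ (Nat.le_add_right n 2) (endCups δ (TL.gen δ n) n k) =
      endCups δ (TL.gen δ (n + 2)) n k := by
  rw [map_endCups]
  exact endCups_congr k fun i hi => TL.inclOfLE_gen _ hi

/-- Multiplication by the idempotent restricts the trace to its image, and TL_n acts on this image
as on V_{n,p}. -/
theorem stdTrace_mul_endCup (h0 : 0 < n ∨ δ ≠ 0) (x : TL δ n) :
    stdTrace δ (n + 2) (p + 1) (TL.inclOfLE δ (Nat.le_add_right n 2) x *
      endCup δ (TL.gen δ (n + 2)) (n + 2)) = stdTrace δ n p x := by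
  obtain ⟨g, hg⟩ := (appendLin n p).exists_leftInverse_of_injective
    (LinearMap.ker_eq_bot.2 appendLin_injective)
  set F := stdRep δ (n + 2) (p + 1) (endCup δ (TL.gen δ (n + 2)) (n + 2)) with hF
  have hFi : F ∘ₗ appendLin n p = appendLin n p := stdRep_endCup_appendLin h0
  have hr : (g ∘ₗ F) ∘ₗ appendLin n p = LinearMap.id := by rw [LinearMap.comp_assoc, hFi, hg]
  have hir : appendLin n p ∘ₗ g ∘ₗ F = F := by
    refine LinearMap.ext fun v => ?_
    obtain ⟨u, hu⟩ := range_stdRep_endCup_le (δ := δ) (n := n) (p := p) ⟨v, rfl⟩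
    have := DFunLike.congr_fun hg u
    simp only [LinearMap.comp_apply, LinearMap.id_apply, ← hF] at this hu ⊢
    rw [← hu, this]
  have := trace_mul_of_section hr (stdRep_inclOfLE_appendLin x)
  rw [hir] at this
  simp only [stdTrace, LinearMap.comp_apply, AlgHom.toLinearMap_apply, map_mul]
  exact this

/-- Removing end cups one by one reduces to a module without cups, where every generator acts by
zero. -/
theorem stdRep_endCups_eq_zero (h : p < k) : stdRep δ n p (endCups δ (TL.gen δ n) n k) = 0 := by
  induction k generalizing n p with
  | zero => omega
  | succ k ih =>
    rcases n with _ | _ | n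
    · simp [endCups]
    · simp [endCups]
    rw [endCups, map_mul]
    rcases p with _ | p
    · rw [stdRep_zero_endCup, mul_zero]
    · refine LinearMap.ext fun v => ?_
      obtain ⟨u, hu⟩ := range_stdRep_endCup_le (δ := δ) (n := n) (p := p) ⟨v, rfl⟩
      rw [Module.End.mul_apply, ← hu, ← inclOfLE_endCups, ← LinearMap.comp_apply,
        stdRep_inclOfLE_appendLin, ih (by omega)]
      simp

theorem stdTrace_endCups (hk : k ∈ irrLabels δ n) (hp : k ≤ p) :
    stdTrace δ n p (endCups δ (TL.gen δ n) n k) =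
      Nat.card (LinkState (n - 2 * k) (p - k)) := by
  induction k generalizing n p with
  | zero =>
    have := Fintype.ofFinite (LinkState n p)
    simp [endCups, stdTrace, LinearMap.trace_one, Nat.card_eq_fintype_card]
  | succ k ih =>
    obtain ⟨n, rfl⟩ : ∃ m, n = m + 2 := ⟨n - 2, by have := (mem_irrLabels.1 hk).1; omega⟩
    obtain ⟨p, rfl⟩ : ∃ m, p = m + 1 := ⟨p - 1, by omega⟩
    obtain ⟨h1, h2⟩ := irrLabels_pred hk
    rw [endCups, ← inclOfLE_endCups, stdTrace_mul_endCup h2, ih h1 (by omega)]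
    rw [show n + 2 - 2 * (k + 1) = n - 2 * k by omega, show p + 1 - (k + 1) = p - k by omega]

theorem stdTrace_endCups_of_lt (h : p < k) : stdTrace δ n p (endCups δ (TL.gen δ n) n k) = 0 := by
  simp [stdTrace, stdRep_endCups_eq_zero h]

theorem stdTrace_endCups_self (hp : p ∈ irrLabels δ n) :
    stdTrace δ n p (endCups δ (TL.gen δ n) n p) = 1 := by
  rw [stdTrace_endCups hp le_rfl, Nat.sub_self]
  simp

/-- The image of z_{n,p} is the line spanned by the link state with all its cups at the end, and
this state generates V_{n,p}. The induction peels off one end cup at a time. In consequence the sum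
of all proper invariant subspaces is still killed by z_{n,p}, hence proper. -/
theorem eq_top_of_endCups_ne_zero (hp : p ∈ irrLabels δ n)
    {N : Submodule ℂ (LinkState n p →₀ ℂ)} (hN : ∀ x, N ≤ N.comap (stdRep δ n p x))
    {v : LinkState n p →₀ ℂ} (hv : v ∈ N)
    (h0 : stdRep δ n p (endCups δ (TL.gen δ n) n p) v ≠ 0) : N = ⊤ := by
  induction p generalizing n with
  | zero =>
    have hv0 : v ≠ 0 := by rintro rfl; simp at h0
    obtain ⟨w⟩ : Nonempty (LinkState n 0) := inferInstance
    have hw : v w ≠ 0 := by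
      intro h
      refine hv0 (Finsupp.ext fun w' => ?_)
      rw [Subsingleton.elim w' w, h]
      rfl
    rw [eq_top_iff]
    intro u _
    have : u = (u w / v w) • v := by
      ext w'
      rw [Subsingleton.elim w' w]
      simp [hw]
    rw [this]
    exact N.smul_mem _ hv
  | succ p ih =>
    obtain ⟨n, rfl⟩ : ∃ m, n = m + 2 := ⟨n - 2, by have := (mem_irrLabels.1 hp).1; omega⟩
    obtain ⟨h1, h2⟩ := irrLabels_pred hp
    refine eq_top_of_range_appendLin_le hN ?_
    obtain ⟨u, hu⟩ := range_stdRep_endCup_le (δ := δ) (n := n) (p := p) ⟨v, rfl⟩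
    have huN : appendLin n p u ∈ N := hu ▸ hN _ hv
    rw [endCups, map_mul, Module.End.mul_apply, ← hu, ← inclOfLE_endCups, ← LinearMap.comp_apply,
      stdRep_inclOfLE_appendLin, LinearMap.comp_apply] at h0
    have htop := ih h1 (N := N.comap (appendLin n p)) (fun x u hu => ?_) huN
      (fun h => h0 (by rw [h, map_zero]))
    · rintro _ ⟨u, rfl⟩
      exact (htop ▸ trivial : u ∈ N.comap (appendLin n p))
    · have := DFunLike.congr_fun (stdRep_inclOfLE_appendLin (p := p) x) u
      simp only [LinearMap.comp_apply] at this
      rw [Submodule.mem_comap, Submodule.mem_comap, ← this]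
      exact hN _ hu

theorem stdRad_le_ker (hp : p ∈ irrLabels δ n) :
    stdRad δ n p ≤ LinearMap.ker (stdRep δ n p (endCups δ (TL.gen δ n) n p)) := by
  refine sSup_le fun N hN v hv => ?_
  by_contra h
  exact hN.1 (eq_top_of_endCups_ne_zero hp hN.2 hv h)

theorem irrRep_eq_quotRep :
    irrRep δ n p = quotRep (stdRep δ n p) (stdRad δ n p) (stdRad_le_comap δ n p) := rfl

/-- The radical is in the kernel of z_{n,p}, so passing to the quotient does not change the trace of
z_{n,p}. -/
theorem irrTrace_endCups_self (hp : p ∈ irrLabels δ n) :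
    irrTrace δ n p (endCups δ (TL.gen δ n) n p) = 1 := by
  have h := trace_eq_trace_sub_add_trace_quot (stdRep δ n p) (stdRad δ n p) (stdRad_le_comap δ n p)
    (endCups δ (TL.gen δ n) n p)
  have h0 : subRep (stdRep δ n p) (stdRad δ n p) (stdRad_le_comap δ n p)
      (endCups δ (TL.gen δ n) n p) = 0 :=
    LinearMap.ext fun v => Subtype.ext (stdRad_le_ker hp v.2)
  rw [h0, map_zero, zero_add] at h
  rw [← stdTrace_endCups_self hp]
  exact h.symm

theorem irrRep_endCups_eq_zero (h : p < k) : irrRep δ n p (endCups δ (TL.gen δ n) n k) = 0 := by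
  apply Submodule.linearMap_qext
  refine LinearMap.ext fun v => ?_
  simp [irrRep_eq_quotRep, quotRep_mk, stdRep_endCups_eq_zero h]

theorem irrTrace_endCups_of_lt (h : p < k) : irrTrace δ n p (endCups δ (TL.gen δ n) n k) = 0 := by
  simp [irrTrace, irrRep_endCups_eq_zero h]

theorem irrRep_endCups_ne_zero (hp : p ∈ irrLabels δ n) :
    irrRep δ n p (endCups δ (TL.gen δ n) n p) ≠ 0 := by
  intro h
  have := irrTrace_endCups_self hp
  simp [irrTrace, h] at this

theorem isIrr_irrRep (hp : p ∈ irrLabels δ n) : IsIrr (irrRep δ n p) := by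
  refine ⟨?_, fun N hN => ?_⟩
  · by_contra h
    rw [not_nontrivial_iff_subsingleton] at h
    exact irrRep_endCups_ne_zero hp (Subsingleton.elim _ _)
  · by_cases htop : N.comap (stdRad δ n p).mkQ = ⊤
    · right
      rw [eq_top_iff]
      intro v _
      obtain ⟨v, rfl⟩ := Submodule.mkQ_surjective _ v
      exact (htop ▸ trivial : v ∈ N.comap (stdRad δ n p).mkQ)
    · left
      have hle : N.comap (stdRad δ n p).mkQ ≤ stdRad δ n p :=
        le_sSup ⟨htop, fun x v hv => hN x hv⟩
      rw [eq_bot_iff]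
      intro v hv
      obtain ⟨v, rfl⟩ := Submodule.mkQ_surjective _ v
      simpa using hle hv

theorem hasTop_irrRep (hp : p ∈ irrLabels δ n) : HasTop (irrRep δ n p) p :=
  hasTop_of_isIrr (isIrr_irrRep hp) hp (irrRep_endCups_ne_zero hp)
    fun _ => irrRep_endCups_eq_zero (Nat.lt_succ_self p)

/-- The trace of every finite-dimensional representation of `TL_n(δ)` is a sum of traces of the
irreducible representations `L_{n,i}`. -/
theorem exists_trace_eq_sum_irrTrace {M : Type} [AddCommGroup M] [Module ℂ M]
    [FiniteDimensional ℂ M] (ρ : TL δ n →ₐ[ℂ] Module.End ℂ M) :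
    ∃ b : ℕ → ℕ, ∀ x, LinearMap.trace ℂ M (ρ x) =
      ∑ i ∈ irrLabels δ n, (b i : ℂ) * irrTrace δ n i x := by
  suffices H : ∀ (d : ℕ) (M : Type) [AddCommGroup M] [Module ℂ M] [FiniteDimensional ℂ M]
      (ρ : TL δ n →ₐ[ℂ] Module.End ℂ M), Module.finrank ℂ M = d →
      ∃ b : ℕ → ℕ, ∀ x, LinearMap.trace ℂ M (ρ x) =
        ∑ i ∈ irrLabels δ n, (b i : ℂ) * irrTrace δ n i x from H _ M ρ rfl
  intro d
  induction d using Nat.strong_induction_on with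
  | _ d ih =>
  intro M _ _ _ ρ hd
  by_cases hM : Nontrivial M
  swap
  · rw [not_nontrivial_iff_subsingleton] at hM
    refine ⟨0, fun x => ?_⟩
    rw [Subsingleton.elim (ρ x) 0]
    simp
  by_cases hρ : IsIrr ρ
  -- Base of the induction on dimension: an irreducible module has the same trace as L_{n,k} for its
  -- top label k. Otherwise an invariant subspace and its quotient both have smaller dimension.
  · obtain ⟨k, hk⟩ := exists_hasTop hρ
    refine ⟨Pi.single k 1, fun x => ?_⟩
    rw [trace_eq_of_hasTop hρ (isIrr_irrRep hk.1) hk (hasTop_irrRep hk.1), Finset.sum_eq_single k]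
    · simp [irrTrace]
    · intro i _ hi
      simp [hi]
    · exact fun h => absurd hk.1 h
  · obtain ⟨N, hN, hbot, htop⟩ : ∃ N : Submodule ℂ M, (∀ x, N ≤ N.comap (ρ x)) ∧ N ≠ ⊥ ∧ N ≠ ⊤ := by
      by_contra! h
      exact hρ ⟨hM, fun N hN => or_iff_not_imp_left.2 (h N hN)⟩
    have h1 := Submodule.finrank_lt htop
    have h2 := Submodule.finrank_quotient_add_finrank N
    have h3 : 0 < Module.finrank ℂ N := by
      have := Submodule.nontrivial_iff_ne_bot.2 hbot
      exact Module.finrank_pos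
    obtain ⟨b, hb⟩ := ih _ (by omega) N (subRep ρ N hN) rfl
    obtain ⟨c, hc⟩ := ih _ (by omega) (M ⧸ N) (quotRep ρ N hN) rfl
    refine ⟨b + c, fun x => ?_⟩
    rw [trace_eq_trace_sub_add_trace_quot ρ N hN, hb, hc, ← Finset.sum_add_distrib]
    exact Finset.sum_congr rfl fun i _ => by simp [add_mul]

/-! ### Linear independence of the irreducible traces -/

/-- A unitriangular system of linear equations has only the trivial solution. -/
theorem eq_zero_of_unitriangular {s : Finset ℕ} {C : ℕ → ℕ → ℂ} {μ : ℕ → ℂ}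
    (hC1 : ∀ k ∈ s, C k k = 1) (hC0 : ∀ k ∈ s, ∀ i < k, C i k = 0)
    (h : ∀ k ∈ s, ∑ i ∈ s, μ i * C i k = 0) {k : ℕ} (hk : k ∈ s) : μ k = 0 := by
  -- Induction on the distance to the largest index: the equation at k involves only unknowns with
  -- index at least k.
  suffices H : ∀ d k, k ∈ s → s.sup id - k = d → μ k = 0 from H _ k hk rfl
  clear hk k
  intro d
  induction d using Nat.strong_induction_on with
  | _ d ih =>
  intro k hk hd
  have := h k hk
  rw [Finset.sum_eq_single k] at this
  · rwa [hC1 k hk, mul_one] at this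
  · intro i hi hik
    rcases lt_or_gt_of_ne hik with hlt | hgt
    · rw [hC0 k hk i hlt, mul_zero]
    · have h1 : i ≤ s.sup id := Finset.le_sup (f := id) hi
      rw [ih (s.sup id - i) (by omega) i hi rfl, zero_mul]
  · exact fun h' => absurd hk h'

theorem eq_zero_of_sum_irrTrace {μ : ℕ → ℂ}
    (h : ∀ k ∈ irrLabels δ n,
      ∑ i ∈ irrLabels δ n, μ i * irrTrace δ n i (endCups δ (TL.gen δ n) n k) = 0)
    {k : ℕ} (hk : k ∈ irrLabels δ n) : μ k = 0 :=
  eq_zero_of_unitriangular (C := fun i k => irrTrace δ n i (endCups δ (TL.gen δ n) n k))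
    (fun _ hk => irrTrace_endCups_self hk) (fun _ _ _ hi => irrTrace_endCups_of_lt hi) h hk

/-- The combinations of the traces of the irreducible representations. -/
noncomputable def irrSpan (δ : ℂ) (n : ℕ) : Submodule ℂ (TL δ n →ₗ[ℂ] ℂ) :=
  LinearMap.range (Fintype.linearCombination ℂ fun i : irrLabels δ n => irrTrace δ n i)

theorem mem_irrSpan {f : TL δ n →ₗ[ℂ] ℂ} :
    f ∈ irrSpan δ n ↔ ∃ μ : ℕ → ℂ, f = ∑ i ∈ irrLabels δ n, μ i • irrTrace δ n i := by
  classical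
  constructor
  · rintro ⟨μ, rfl⟩
    refine ⟨fun i => if h : i ∈ irrLabels δ n then μ ⟨i, h⟩ else 0, ?_⟩
    rw [Fintype.linearCombination_apply, ← Finset.sum_coe_sort (irrLabels δ n)]
    simp
  · rintro ⟨μ, rfl⟩
    refine ⟨fun i => μ i, ?_⟩
    rw [Fintype.linearCombination_apply, ← Finset.sum_coe_sort (irrLabels δ n)]

theorem trace_mem_irrSpan {M : Type} [AddCommGroup M] [Module ℂ M]
    [FiniteDimensional ℂ M] (ρ : TL δ n →ₐ[ℂ] Module.End ℂ M) :
    LinearMap.trace ℂ M ∘ₗ ρ.toLinearMap ∈ irrSpan δ n := by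
  obtain ⟨b, hb⟩ := exists_trace_eq_sum_irrTrace ρ
  exact mem_irrSpan.2 ⟨fun i => b i, LinearMap.ext fun x => by simpa using hb x⟩

theorem stdTrace_mem_irrSpan : stdTrace δ n p ∈ irrSpan δ n := trace_mem_irrSpan _

/-- A combination of the traces of the irreducible representations is determined by its values on
the idempotents with `k` cups. -/
theorem irrSpan_ext {f g : TL δ n →ₗ[ℂ] ℂ} (hf : f ∈ irrSpan δ n) (hg : g ∈ irrSpan δ n)
    (h : ∀ k ∈ irrLabels δ n,
      f (endCups δ (TL.gen δ n) n k) = g (endCups δ (TL.gen δ n) n k)) : f = g := by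
  obtain ⟨μ, hμ⟩ := mem_irrSpan.1 (sub_mem hf hg)
  rw [← sub_eq_zero, hμ]
  refine Finset.sum_eq_zero fun i hi => ?_
  rw [eq_zero_of_sum_irrTrace (μ := μ) (fun k hk => ?_) hi, zero_smul]
  have := DFunLike.congr_fun hμ (endCups δ (TL.gen δ n) n k)
  simp only [LinearMap.sub_apply, h k hk, sub_self, LinearMap.coe_sum, Finset.sum_apply,
    LinearMap.smul_apply, smul_eq_mul] at this
  exact this.symm

end

/-! ### The number of link states -/

section
variable {n p : ℕ}

/-- Remove the last point, its partner becoming a through strand. -/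
def openFun (f : Fin (n + 1) → Fin (n + 1)) (a : Fin n) : Fin n :=
  if h : f a.castSucc = Fin.last n then a else (f a.castSucc).castPred h

theorem openFun_of_eq {f : Fin (n + 1) → Fin (n + 1)} {a : Fin n} (h : f a.castSucc = Fin.last n) :
    openFun f a = a := by
  simp [openFun, h]

theorem castSucc_openFun {f : Fin (n + 1) → Fin (n + 1)} {a : Fin n}
    (h : f a.castSucc ≠ Fin.last n) : (openFun f a).castSucc = f a.castSucc := by
  simp [openFun, h]

theorem openFun_invol {f : Fin (n + 1) → Fin (n + 1)} (hf : ∀ a, f (f a) = a) (a : Fin n) :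
    openFun f (openFun f a) = a := by
  by_cases h : f a.castSucc = Fin.last n
  · rw [openFun_of_eq h, openFun_of_eq h]
  · have h1 := castSucc_openFun h
    apply Fin.castSucc_injective
    rw [castSucc_openFun, h1, hf]
    rw [h1, hf]
    exact Fin.castSucc_ne_last a

theorem openFun_nested {f : Fin (n + 1) → Fin (n + 1)}
    (hf : ∀ a b, a < b → b < f a → f b ≠ b ∧ a < f b ∧ f b < f a) (a b : Fin n) (hab : a < b)
    (hb : b < openFun f a) : openFun f b ≠ b ∧ a < openFun f b ∧ openFun f b < openFun f a := by
  have ha : f a.castSucc ≠ Fin.last n := by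
    intro h
    rw [openFun_of_eq h] at hb
    exact lt_asymm hab hb
  rw [← Fin.castSucc_lt_castSucc_iff, castSucc_openFun ha] at hb
  obtain ⟨h1, h2, h3⟩ := hf _ _ (Fin.castSucc_lt_castSucc_iff.2 hab) hb
  have hbl : f b.castSucc ≠ Fin.last n := ne_of_lt (lt_of_lt_of_le h3 (Fin.le_last _))
  rw [← Fin.castSucc_lt_castSucc_iff (a := a), ← Fin.castSucc_lt_castSucc_iff (b := openFun f a),
    castSucc_openFun ha, castSucc_openFun hbl]
  exact ⟨fun h => h1 (by rw [← castSucc_openFun hbl, h]), h2, h3⟩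

/-- Add a through strand at the end. -/
def throughFun (f : Fin n → Fin n) : Fin (n + 1) → Fin (n + 1) :=
  Fin.lastCases (Fin.last n) fun a => (f a).castSucc

/-- Add a point at the end and join it with the end `b` of a through strand. -/
def closeFun (f : Fin n → Fin n) (b : Fin n) : Fin (n + 1) → Fin (n + 1) :=
  Fin.lastCases b.castSucc fun a => if a = b then Fin.last n else (f a).castSucc

theorem throughFun_openFun {f : Fin (n + 1) → Fin (n + 1)} (hf : ∀ a, f (f a) = a)
    (h : f (Fin.last n) = Fin.last n) : throughFun (openFun f) = f := by
  funext a
  induction a using Fin.lastCases with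
  | last => simp [throughFun, h]
  | cast a =>
    have : f a.castSucc ≠ Fin.last n := by
      intro h'
      have := hf a.castSucc
      rw [h', h] at this
      exact (Fin.castSucc_ne_last a) this.symm
    simp [throughFun, castSucc_openFun this]

theorem openFun_throughFun (f : Fin n → Fin n) : openFun (throughFun f) = f := by
  funext a
  apply Fin.castSucc_injective
  rw [castSucc_openFun] <;> simp [throughFun, Fin.castSucc_ne_last]

theorem closeFun_openFun {f : Fin (n + 1) → Fin (n + 1)} (hf : ∀ a, f (f a) = a) {b : Fin n}
    (h : f (Fin.last n) = b.castSucc) : closeFun (openFun f) b = f := by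
  have hb : f b.castSucc = Fin.last n := by rw [← h, hf]
  funext a
  induction a using Fin.lastCases with
  | last => simp [closeFun, h]
  | cast a =>
    by_cases hab : a = b
    · subst hab
      simp [closeFun, hb]
    · have : f a.castSucc ≠ Fin.last n := by
        intro h'
        have := hf a.castSucc
        rw [h', h] at this
        exact hab (Fin.castSucc_injective _ this.symm)
      simp [closeFun, hab, castSucc_openFun this]

theorem openFun_closeFun {f : Fin n → Fin n} {b : Fin n} (hb : f b = b) :
    openFun (closeFun f b) = f := by
  funext a
  by_cases hab : a = b
  · subst hab
    rw [openFun_of_eq, hb]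
    simp [closeFun]
  · apply Fin.castSucc_injective
    rw [castSucc_openFun] <;> simp [closeFun, hab, Fin.castSucc_ne_last]

theorem throughFun_card (f : Fin n → Fin n) :
    (Finset.univ.filter fun a => throughFun f a = a).card =
      (Finset.univ.filter fun a => f a = a).card + 1 := by
  have : (Finset.univ.filter fun a => throughFun f a = a) =
      insert (Fin.last n) ((Finset.univ.filter fun a => f a = a).map Fin.castSuccEmb) := by
    ext a
    rw [Finset.mem_filter]
    induction a using Fin.lastCases with
    | last => simp [throughFun]
    | cast a => simp [throughFun, Fin.castSucc_ne_last]
  rw [this, Finset.card_insert_of_notMem, Finset.card_map]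
  simp [Fin.castSucc_ne_last]

theorem closeFun_card {f : Fin n → Fin n} {b : Fin n} (hb : f b = b) :
    (Finset.univ.filter fun a => closeFun f b a = a).card + 1 =
      (Finset.univ.filter fun a => f a = a).card := by
  have : (Finset.univ.filter fun a => closeFun f b a = a) =
      ((Finset.univ.filter fun a => f a = a).erase b).map Fin.castSuccEmb := by
    ext a
    rw [Finset.mem_filter]
    induction a using Fin.lastCases with
    | last => simp [closeFun, Fin.castSucc_ne_last]
    | cast a =>
      by_cases hab : a = b
      · subst hab
        simp [closeFun, (Fin.castSucc_ne_last _).symm]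
      · simp [closeFun, hab]
  rw [this, Finset.card_map, Finset.card_erase_add_one]
  simp [hb]

namespace LinkState

theorem card_last_eq (n p : ℕ) :
    Nat.card {w : LinkState (n + 1) p // w.1 (Fin.last n) = Fin.last n} =
      Nat.card (LinkState n p) := by
  refine Nat.card_congr (Equiv.ofBijective (fun w => ⟨openFun w.1.1, openFun_invol w.1.2.1,
    openFun_nested w.1.2.2.1, ?_⟩) ⟨?_, ?_⟩)
  · have h1 := w.1.2.2.2
    have h2 := throughFun_card (openFun w.1.1)
    rw [throughFun_openFun w.1.2.1 w.2] at h2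
    omega
  · intro w w' h
    have h : openFun w.1.1 = openFun w'.1.1 := congrArg Subtype.val h
    refine Subtype.ext (Subtype.ext ?_)
    rw [← throughFun_openFun w.1.2.1 w.2, ← throughFun_openFun w'.1.2.1 w'.2, h]
  · intro w
    refine ⟨⟨⟨throughFun w.1, ?_, ?_, ?_⟩, by simp [throughFun]⟩,
      Subtype.ext (openFun_throughFun _)⟩
    · intro a
      induction a using Fin.lastCases with
      | last => simp [throughFun]
      | cast a => simp [throughFun, w.2.1]
    · intro a b hab hb
      induction a using Fin.lastCases with
      | last => exact absurd hab (not_lt.2 (Fin.le_last b))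
      | cast a =>
        induction b using Fin.lastCases with
        | last => exact absurd hb (not_lt.2 (Fin.le_last _))
        | cast b =>
          simp only [throughFun, Fin.lastCases_castSucc, Fin.castSucc_lt_castSucc_iff,
            ne_eq, Fin.castSucc_inj] at hab hb ⊢
          exact w.2.2.1 a b hab hb
    · have h1 := w.2.2.2
      rw [throughFun_card]
      omega

/-- Since b is the rightmost through strand, the new cup encloses no through strand; points to the
right of b have their partners there too, because no cup passes over b. -/
theorem closeFun_mem {w : LinkState n p} {b : Fin n} (hb : w.1 b = b)
    (hmax : ∀ a, b < a → w.1 a ≠ a) :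
    (∀ a, closeFun w.1 b (closeFun w.1 b a) = a) ∧
    (∀ a c, a < c → c < closeFun w.1 b a → closeFun w.1 b c ≠ c ∧ a < closeFun w.1 b c ∧
      closeFun w.1 b c < closeFun w.1 b a) ∧
    (Finset.univ.filter fun a => closeFun w.1 b a = a).card + 2 * (p + 1) = n + 1 := by
  have hne : ∀ a, a ≠ b → w.1 a ≠ b := by
    intro a ha h
    have := w.2.1 a
    rw [h, hb] at this
    exact ha this.symm
  refine ⟨fun a => ?_, fun a c hac hc => ?_, ?_⟩
  · induction a using Fin.lastCases with
    | last => simp [closeFun]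
    | cast a =>
      by_cases hab : a = b
      · simp [closeFun, hab]
      · simp [closeFun, hab, hne a hab, w.2.1]
  · induction a using Fin.lastCases with
    | last => exact absurd hac (not_lt.2 (Fin.le_last c))
    | cast a =>
      induction c using Fin.lastCases with
      | last => exact absurd hc (not_lt.2 (Fin.le_last _))
      | cast c =>
        by_cases hab : a = b
        · subst hab
          have hac : a < c := Fin.castSucc_lt_castSucc_iff.1 hac
          have hca : c ≠ a := hac.ne'
          simp only [closeFun, Fin.lastCases_castSucc, if_neg hca, if_true, ne_eq, Fin.castSucc_inj,
            Fin.castSucc_lt_castSucc_iff, Fin.castSucc_lt_last, and_true]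
          refine ⟨hmax c hac, ?_⟩
          by_contra hlt
          have hlt : w.1 c < a := lt_of_le_of_ne (not_lt.1 hlt) (hne c hca)
          exact (w.2.2.1 (w.1 c) a hlt (by rwa [w.2.1])).1 hb
        · simp only [closeFun, Fin.lastCases_castSucc, if_neg hab, Fin.castSucc_lt_castSucc_iff]
            at hac hc
          have := w.2.2.1 a c hac hc
          have hcb : c ≠ b := by
            rintro rfl
            exact this.1 hb
          simpa only [closeFun, Fin.lastCases_castSucc, if_neg hab, if_neg hcb, ne_eq,
            Fin.castSucc_inj, Fin.castSucc_lt_castSucc_iff] using this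
  · have h1 := w.2.2.2
    have h2 := closeFun_card hb
    omega

theorem openFun_max (w : LinkState (n + 1) p) {b : Fin n} (h : w.1 (Fin.last n) = b.castSucc) :
    openFun w.1 b = b ∧ ∀ a, b < a → openFun w.1 a ≠ a := by
  have hb : w.1 b.castSucc = Fin.last n := by rw [← h, w.2.1]
  refine ⟨openFun_of_eq hb, fun a ha hfix => ?_⟩
  have h1 := w.2.2.1 b.castSucc a.castSucc (Fin.castSucc_lt_castSucc_iff.2 ha)
    (by rw [hb]; exact Fin.castSucc_lt_last a)
  rw [hb] at h1
  rw [← castSucc_openFun h1.2.2.ne, hfix] at h1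
  exact h1.1 rfl

/-- Opening the cup at the last point turns its partner into the rightmost through strand
(`openFun_max`), so the partner can be recovered. Conversely the rightmost strand is closed, and 2p
< n guarantees that there is one. -/
theorem card_last_ne (h : 2 * p < n) :
    Nat.card {w : LinkState (n + 1) (p + 1) // ¬ w.1 (Fin.last n) = Fin.last n} =
      Nat.card (LinkState n p) := by
  have hex : ∀ w : {w : LinkState (n + 1) (p + 1) // ¬ w.1 (Fin.last n) = Fin.last n},
      ∃ b : Fin n, w.1.1 (Fin.last n) = b.castSucc :=
    fun w => ⟨(w.1.1 (Fin.last n)).castPred w.2, by simp⟩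
  refine Nat.card_congr (Equiv.ofBijective (fun w => ⟨openFun w.1.1, openFun_invol w.1.2.1,
    openFun_nested w.1.2.2.1, ?_⟩) ⟨?_, ?_⟩)
  · obtain ⟨b, hb⟩ := hex w
    have h1 := w.1.2.2.2
    have h2 := closeFun_card (w.1.openFun_max hb).1
    rw [closeFun_openFun w.1.2.1 hb] at h2
    omega
  · intro w w' h
    have h : openFun w.1.1 = openFun w'.1.1 := congrArg Subtype.val h
    obtain ⟨b, hb⟩ := hex w
    obtain ⟨b', hb'⟩ := hex w'
    have m := w.1.openFun_max hb
    have m' := w'.1.openFun_max hb'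
    have hbb : b = b' := by
      rcases lt_trichotomy b b' with hlt | heq | hlt
      · exact absurd (h ▸ m'.1) (m.2 b' hlt)
      · exact heq
      · exact absurd (h ▸ m.1) (m'.2 b hlt)
    refine Subtype.ext (Subtype.ext ?_)
    rw [← closeFun_openFun w.1.2.1 hb, ← closeFun_openFun w'.1.2.1 hb', h, hbb]
  · intro w
    have hne : (Finset.univ.filter fun a => w.1 a = a).Nonempty := by
      rw [← Finset.card_pos]
      have := w.2.2.2
      omega
    set b := (Finset.univ.filter fun a => w.1 a = a).max' hne with hbdef
    have hb : w.1 b = b := by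
      have := Finset.max'_mem _ hne
      rw [← hbdef, Finset.mem_filter] at this
      exact this.2
    have hmax : ∀ a, b < a → w.1 a ≠ a := by
      intro a ha h'
      have := Finset.le_max' (Finset.univ.filter fun a => w.1 a = a) a
        (Finset.mem_filter.2 ⟨Finset.mem_univ a, h'⟩)
      exact absurd this (not_le.2 ha)
    exact ⟨⟨⟨closeFun w.1 b, closeFun_mem hb hmax⟩, by simp [closeFun, Fin.castSucc_ne_last]⟩,
      Subtype.ext (openFun_closeFun hb)⟩

theorem card_eq_zero (h : n < 2 * p) : Nat.card (LinkState n p) = 0 := by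
  have : IsEmpty (LinkState n p) := ⟨fun w => by have := w.two_mul_le; omega⟩
  simp

theorem card_succ (h : 2 * p < n) :
    Nat.card (LinkState (n + 1) (p + 1)) =
      Nat.card (LinkState n (p + 1)) + Nat.card (LinkState n p) := by
  classical
  rw [← card_last_eq n (p + 1), ← card_last_ne h, ← Nat.card_sum]
  exact Nat.card_congr (Equiv.sumCompl _).symm

end LinkState

end

/-! ### Numerical identities for the generic coefficients -/

section
variable {n k p : ℕ} {δ : ℂ}

/-- The trace of the idempotent with `k` cups on `V_{n,i}`. -/
noncomputable def cupCount (n k i : ℕ) : ℕ :=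
  if k ≤ i then Nat.card (LinkState (n - 2 * k) (i - k)) else 0

theorem stdTrace_endCups_eq (hk : k ∈ irrLabels δ n) (i : ℕ) :
    stdTrace δ n i (endCups δ (TL.gen δ n) n k) = cupCount n k i := by
  rw [cupCount]
  split_ifs with h
  · exact stdTrace_endCups hk h
  · rw [stdTrace_endCups_of_lt (not_le.1 h), Nat.cast_zero]

/-- The compatibility under restriction by one strand that matches the Pascal-type recursion
`LinkState.card_succ`; it is the recursion of `genTop` multiplied by γ^j. -/
theorem genCoeff_add (γ : ℂ) {m j : ℕ} (h : 2 * j < m) :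
    genCoeff γ (m + 1) j + genCoeff γ (m + 1) (j + 1) = genCoeff γ m j := by
  obtain ⟨d, rfl⟩ : ∃ d, m = 2 * j + d + 1 := ⟨m - 2 * j - 1, by omega⟩
  simp only [genCoeff]
  rw [show 2 * j + d + 1 + 1 - 2 * j = d + 2 by omega,
    show 2 * j + d + 1 + 1 - 2 * (j + 1) = d by omega,
    show 2 * j + d + 1 - 2 * j = d + 1 by omega, genTop]
  ring

theorem sum_genCoeff_mul_card (γ : ℂ) (m : ℕ) :
    ∑ j ∈ Finset.range (m / 2 + 1), genCoeff γ m j * Nat.card (LinkState m j) = 1 := by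
  induction m with
  | zero => simp [genCoeff, genTop]
  | succ m ih =>
    -- Combining the recursions of coefficients and of cardinalities, the partial sums telescope up
    -- to one boundary term.
    have step : ∀ s, 2 * s ≤ m + 1 →
        ∑ j ∈ Finset.range (s + 1), genCoeff γ (m + 1) j * Nat.card (LinkState (m + 1) j) =
          ∑ j ∈ Finset.range s, genCoeff γ m j * Nat.card (LinkState m j) +
            genCoeff γ (m + 1) s * Nat.card (LinkState m s) := by
      intro s
      induction s with
      | zero => simp
      | succ s ihs =>
        intro hs
        rw [Finset.sum_range_succ, ihs (by omega), Finset.sum_range_succ _ s,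
          LinkState.card_succ (by omega), ← genCoeff_add γ (m := m) (by omega)]
        push_cast
        ring
    rw [step _ (by omega), ← ih]
    -- For m = 2s the boundary term is the last summand for m, since c_{2s+1,s} = c_{2s,s} = γ^s.
    -- For m odd it contains the number of link states with too many cups, which is zero.
    rcases Nat.even_or_odd' m with ⟨s, rfl | rfl⟩
    · rw [show (2 * s + 1) / 2 = s by omega, show 2 * s / 2 = s by omega, Finset.sum_range_succ]
      congr 2
      simp only [genCoeff]
      rw [show 2 * s + 1 - 2 * s = 1 by omega, Nat.sub_self]
      simp [genTop]
    · rw [show (2 * s + 1 + 1) / 2 = s + 1 by omega, show (2 * s + 1) / 2 = s by omega,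
        LinkState.card_eq_zero (by omega : 2 * s + 1 < 2 * (s + 1))]
      simp

/-- Only indices i ≥ k contribute; shifting them by k extracts γ^k and leaves the normalization on n
- 2k points. -/
theorem sum_genCoeff_mul_cupCount (γ : ℂ) (h : 2 * k ≤ n) :
    ∑ i ∈ stdLabels n, genCoeff γ n i * cupCount n k i = γ ^ k := by
  obtain ⟨m, rfl⟩ : ∃ m, n = m + 2 * k := ⟨n - 2 * k, by omega⟩
  rw [stdLabels, show (m + 2 * k) / 2 + 1 = k + (m / 2 + 1) by omega, Finset.sum_range_add,
    Finset.sum_eq_zero fun i hi => ?_, zero_add, ← mul_one (γ ^ k), ← sum_genCoeff_mul_card γ m,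
    Finset.mul_sum]
  · refine Finset.sum_congr rfl fun j _ => ?_
    simp only [cupCount, genCoeff, Nat.le_add_right, if_true, Nat.add_sub_cancel,
      Nat.add_sub_cancel_left]
    rw [show m + 2 * k - 2 * (k + j) = m - 2 * j by omega, pow_add]
    ring
  · simp [cupCount, not_le.2 (Finset.mem_range.1 hi)]

theorem cupCount_succ_zero (n k : ℕ) : cupCount n (k + 1) 0 = 0 := by
  simp [cupCount]

theorem cupCount_succ_succ (n k i : ℕ) : cupCount (n + 2) (k + 1) (i + 1) = cupCount n k i := by
  simp only [cupCount, Nat.add_le_add_iff_right]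
  rw [show n + 2 - 2 * (k + 1) = n - 2 * k by omega, show i + 1 - (k + 1) = i - k by omega]

theorem cupCount_of_lt (h : n < 2 * p) (hk : 2 * k ≤ n) : cupCount n k p = 0 := by
  rw [cupCount, if_pos (by omega), LinkState.card_eq_zero (by omega)]

theorem sum_mul_cupCount_succ (a : ℕ → ℂ) (n k : ℕ) :
    ∑ i ∈ stdLabels (n + 2), a i * cupCount (n + 2) (k + 1) i =
      ∑ i ∈ stdLabels n, a (i + 1) * cupCount n k i := by
  rw [stdLabels, stdLabels, show (n + 2) / 2 + 1 = n / 2 + 1 + 1 by omega, Finset.sum_range_succ']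
  simp [cupCount_succ_zero, cupCount_succ_succ]

/-- A sequence moved by one place, with a zero at the front. -/
def shiftSeq (g : ℕ → ℕ) : ℕ → ℕ
  | 0 => 0
  | i + 1 => g i

/-- Two new points can be two through strands, one strand and one closure in either order, or two
closures. The conditional marks the order in which an old strand is closed first, which requires
that one exists. -/
theorem card_add_two {m s : ℕ} (h : 2 * s ≤ m + 2) :
    Nat.card (LinkState (m + 2) s) = Nat.card (LinkState m s) +
      (if 2 * s < m + 2 then shiftSeq (fun j => Nat.card (LinkState m j)) s else 0) +
      shiftSeq (fun j => Nat.card (LinkState m j)) s +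
      shiftSeq (shiftSeq fun j => Nat.card (LinkState m j)) s := by
  rcases s with _ | s
  · simp [shiftSeq]
  have h1 : Nat.card (LinkState (m + 1) (s + 1)) = Nat.card (LinkState m (s + 1)) +
      if 2 * (s + 1) < m + 2 then Nat.card (LinkState m s) else 0 := by
    split_ifs with h2
    · exact LinkState.card_succ (by omega)
    · rw [LinkState.card_eq_zero (by omega), LinkState.card_eq_zero (by omega)]
  rw [LinkState.card_succ (by omega), h1]
  rcases s with _ | s
  · simp [shiftSeq]
  · rw [LinkState.card_succ (n := m) (p := s) (by omega)]
    simp only [shiftSeq]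
    ring

theorem cupCount_add_two {i : ℕ} (hk : 2 * k ≤ n) (hi : 2 * i ≤ n + 2) :
    cupCount (n + 2) k i = cupCount n k i +
      (if 2 * i < n + 2 then shiftSeq (cupCount n k) i else 0) +
      shiftSeq (cupCount n k) i + shiftSeq (shiftSeq (cupCount n k)) i := by
  obtain ⟨m, rfl⟩ : ∃ m, n = m + 2 * k := ⟨n - 2 * k, by omega⟩
  by_cases hki : k ≤ i
  · obtain ⟨s, rfl⟩ : ∃ s, i = s + k := ⟨i - k, by omega⟩
    have hc : ∀ j, cupCount (m + 2 * k) k (j + k) = Nat.card (LinkState m j) := by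
      intro j
      rw [cupCount, if_pos (by omega), Nat.add_sub_cancel, Nat.add_sub_cancel]
    have hc0 : ∀ j, j < k → cupCount (m + 2 * k) k j = 0 := by
      intro j hj
      rw [cupCount, if_neg (by omega)]
    have h1 : shiftSeq (cupCount (m + 2 * k) k) (s + k) =
        shiftSeq (fun j => Nat.card (LinkState m j)) s := by
      rcases s with _ | s
      · rcases k with _ | k
        · rfl
        · rw [Nat.zero_add]
          exact hc0 k (by omega)
      · rw [show s + 1 + k = s + k + 1 by omega]
        exact hc s
    have h2 : shiftSeq (shiftSeq (cupCount (m + 2 * k) k)) (s + k) =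
        shiftSeq (shiftSeq fun j => Nat.card (LinkState m j)) s := by
      rcases s with _ | _ | s
      · rcases k with _ | _ | k
        · rfl
        · rfl
        · rw [Nat.zero_add]
          exact hc0 k (by omega)
      · rcases k with _ | k
        · rfl
        · rw [show 0 + 1 + (k + 1) = k + 2 by omega]
          exact hc0 k (by omega)
      · rw [show s + 1 + 1 + k = s + k + 2 by omega]
        exact hc s
    rw [h1, h2, hc, cupCount, if_pos hki, Nat.add_sub_cancel,
      show m + 2 * k + 2 - 2 * k = m + 2 by omega, card_add_two (by omega)]
    have : 2 * (s + k) < m + 2 * k + 2 ↔ 2 * s < m + 2 := by omega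
    simp only [this]
  · have hc0 : ∀ n j, j < k → cupCount n k j = 0 := by
      intro n j hj
      rw [cupCount, if_neg (by omega)]
    rw [hc0 _ _ (by omega), hc0 _ _ (by omega)]
    rcases i with _ | _ | i
    · simp [shiftSeq]
    · simp [shiftSeq, hc0 (m + 2 * k) 0 (by omega)]
    · simp [shiftSeq, hc0 (m + 2 * k) (i + 1) (by omega), hc0 (m + 2 * k) i (by omega)]

/-- The branching rule over two strands in transposed form. The last sum is separated because it is
the part that belongs to the far trace; what precedes it gives the coefficients of the complement.
-/
theorem sum_mul_cupCount_add_two (a : ℕ → ℂ) (hk : 2 * k ≤ n) :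
    ∑ i ∈ stdLabels (n + 2), a i * cupCount (n + 2) k i =
      ∑ j ∈ stdLabels n, (a j + (if 2 * j < n then a (j + 1) else 0) +
        (if 2 * (j + 2) ≤ n + 2 then a (j + 2) else 0)) * cupCount n k j +
      ∑ j ∈ stdLabels n, a (j + 1) * cupCount n k j := by
  rw [Finset.sum_congr rfl fun i hi => by
    rw [cupCount_add_two hk (mem_stdLabels.1 hi)]]
  rw [stdLabels, stdLabels, show (n + 2) / 2 + 1 = n / 2 + 1 + 1 by omega]
  push_cast
  simp only [mul_add, add_mul, Finset.sum_add_distrib]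
  have h1 : ∑ i ∈ Finset.range (n / 2 + 1 + 1), a i * (cupCount n k i : ℂ) =
      ∑ i ∈ Finset.range (n / 2 + 1), a i * (cupCount n k i : ℂ) := by
    rw [Finset.sum_range_succ, cupCount_of_lt (by omega) hk]
    simp
  have h2 : ∀ b : ℕ → ℂ, ∑ i ∈ Finset.range (n / 2 + 1 + 1), b i * (shiftSeq (cupCount n k) i : ℂ) =
      ∑ i ∈ Finset.range (n / 2 + 1), b (i + 1) * (cupCount n k i : ℂ) := by
    intro b
    rw [Finset.sum_range_succ']
    simp [shiftSeq]
  have h3 : ∑ i ∈ Finset.range (n / 2 + 1 + 1), a i * (shiftSeq (shiftSeq (cupCount n k)) i : ℂ) =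
      ∑ i ∈ Finset.range (n / 2 + 1), (if 2 * (i + 2) ≤ n + 2 then a (i + 2) else 0) *
        (cupCount n k i : ℂ) := by
    rw [Finset.sum_range_succ', Finset.sum_range_succ', Finset.sum_range_succ,
      if_neg (by omega)]
    simp only [shiftSeq, Nat.cast_zero, mul_zero, add_zero, zero_mul]
    refine Finset.sum_congr rfl fun i hi => ?_
    rw [if_pos (by have := Finset.mem_range.1 hi; omega)]
  have h4 : ∑ i ∈ Finset.range (n / 2 + 1 + 1),
      a i * ((if 2 * i < n + 2 then shiftSeq (cupCount n k) i else 0 : ℕ) : ℂ) =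
      ∑ i ∈ Finset.range (n / 2 + 1), (if 2 * i < n then a (i + 1) else 0) *
        (cupCount n k i : ℂ) := by
    rw [← Finset.sum_congr rfl fun i _ => ?_, h2 fun i => if 2 * i < n + 2 then a i else 0]
    · refine Finset.sum_congr rfl fun i _ => ?_
      have : 2 * (i + 1) < n + 2 ↔ 2 * i < n := by omega
      simp only [this]
    · split_ifs <;> simp
  push_cast at h4
  rw [h1, h2, h3, h4]
  ring_nf

/-- For γ = 1/4 + ε with ε > 0 the ratio of consecutive terms is at most 1 - nε, by induction from
x(1 - x) ≤ 1/4 with x = nε. For large n this bound is negative. Positivity of each term comes from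
non-negativity of the term two places further on. -/
theorem le_quarter_of_genTop_nonneg {γ : ℝ} (h : ∀ n, 0 ≤ (genTop (γ : ℂ) n).re) : γ ≤ 1 / 4 := by
  by_contra! hγ
  set g : ℕ → ℝ := fun n => (genTop (γ : ℂ) n).re with hg
  have hrec : ∀ n, g (n + 2) = g (n + 1) - γ * g n := by
    intro n
    simp [hg, genTop]
  have h0 : ∀ n, 0 ≤ g n := h
  set ε := γ - 1 / 4 with hε
  have hε0 : 0 < ε := by linarith
  have key : ∀ n : ℕ, 0 < g n ∧ g (n + 1) ≤ (1 - n * ε) * g n := by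
    intro n
    induction n with
    | zero => simp [hg, genTop]
    | succ n ih =>
      obtain ⟨hp, hle⟩ := ih
      have hr := hrec n
      have h2 := h0 (n + 2)
      have hp1 : 0 < g (n + 1) := by nlinarith
      refine ⟨hp1, ?_⟩
      have hn : (0 : ℝ) ≤ n * ε := by positivity
      have hle1 : g (n + 1) ≤ g n := by nlinarith
      have e1 : n * ε * g (n + 1) ≤ n * ε * ((1 - n * ε) * g n) :=
        mul_le_mul_of_nonneg_left hle hn
      have e2 : ε * g (n + 1) ≤ ε * g n := mul_le_mul_of_nonneg_left hle1 hε0.le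
      have e3 : n * ε * ((1 - n * ε) * g n) ≤ 1 / 4 * g n := by
        nlinarith [mul_nonneg (sq_nonneg (n * ε - 1 / 2)) hp.le]
      have hγ' : γ = ε + 1 / 4 := by rw [hε]; ring
      rw [show n + 1 + 1 = n + 2 from rfl, hr, hγ']
      push_cast
      nlinarith
  obtain ⟨n, hn⟩ := exists_nat_gt (1 / ε)
  have h1 := (key n).2
  have h2 := (key (n + 1)).1
  have h3 : 1 < n * ε := by rwa [div_lt_iff₀ hε0] at hn
  nlinarith [(key n).1]

end

/-! ### Traces on the infinite algebra -/

section
variable {δ : ℂ} {n k : ℕ}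

/-- The pair e_{m+2} e_{m+1} becomes e_{m+1} e_m under the trace: insert e_{m+1} = e_{m+1} e_m
e_{m+1}, move its last factor past x, with which it commutes, and around the trace, and contract
e_{m+1} e_{m+2} e_{m+1}. -/
theorem trace_mul_gen_mul_gen {χ : TLInf δ →ₗ[ℂ] ℂ} (htr : ∀ x y, χ (x * y) = χ (y * x))
    {x : TLInf δ} (hx : x ∈ genAlg (TLInf.gen δ) (n + 1)) {m : ℕ} (hm : n ≤ m) :
    χ (x * (TLInf.gen δ (m + 1) * TLInf.gen δ m)) =
      χ (x * (TLInf.gen δ (n + 1) * TLInf.gen δ n)) := by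
  induction m, hm using Nat.le_induction with
  | base => rfl
  | succ m hm ih =>
    rw [← ih]
    have hx' := genAlg_mono (by omega : n + 1 ≤ m + 1) hx
    have hfam := TLInf.isTLFamily δ (m + 4)
    have c1 := (hfam.commute_genAlg le_rfl (by omega) hx').eq
    have u := hfam.up (m + 1) (by omega)
    have d := hfam.down m (by omega)
    set a := TLInf.gen δ m
    set b := TLInf.gen δ (m + 1)
    set c := TLInf.gen δ (m + 1 + 1)
    calc χ (x * (c * b)) = χ ((c * b) * x) := htr _ _
      _ = χ (c * (b * a * b) * x) := by rw [d]
      _ = χ (c * b * a * (x * b)) := by rw [c1]; simp only [mul_assoc]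
      _ = χ (c * b * a * x * b) := by simp only [mul_assoc]
      _ = χ (b * (c * b * a * x)) := htr _ _
      _ = χ ((b * c * b) * (a * x)) := by simp only [mul_assoc]
      _ = χ (b * a * x) := by rw [u, mul_assoc]
      _ = χ (x * (b * a)) := htr _ _

/-- The trace obtained by inserting an idempotent with one cup far away. -/
theorem exists_farTrace {χ : TLInf δ →ₗ[ℂ] ℂ} (htr : ∀ x y, χ (x * y) = χ (y * x)) :
    ∃ ψ : TLInf δ →ₗ[ℂ] ℂ, (∀ x y, ψ (x * y) = ψ (y * x)) ∧
      ∀ n, ∀ x ∈ genAlg (TLInf.gen δ) (n + 1),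
        ψ x = χ (x * (TLInf.gen δ (n + 1) * TLInf.gen δ n)) := by
  choose N hN using TLInf.exists_mem_genAlg (δ := δ)
  -- `N x` is only some level containing x; independence of the level makes the choice harmless and
  -- yields linearity.
  have hval : ∀ n, ∀ x ∈ genAlg (TLInf.gen δ) (n + 1),
      χ (x * (TLInf.gen δ (N x + 1) * TLInf.gen δ (N x))) =
        χ (x * (TLInf.gen δ (n + 1) * TLInf.gen δ n)) := by
    intro n x hx
    rw [← trace_mul_gen_mul_gen htr hx (le_max_left n (N x)),
      ← trace_mul_gen_mul_gen htr (genAlg_mono (Nat.le_succ _) (hN x)) (le_max_right n (N x))]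
  refine ⟨{ toFun := fun x => χ (x * (TLInf.gen δ (N x + 1) * TLInf.gen δ (N x)))
            map_add' := fun x y => ?_
            map_smul' := fun c x => ?_ }, fun x y => ?_, hval⟩
  · have hx := genAlg_mono (by omega : N x ≤ max (N x) (N y) + 1) (hN x)
    have hy := genAlg_mono (by omega : N y ≤ max (N x) (N y) + 1) (hN y)
    rw [hval _ _ hx, hval _ _ hy, hval _ _ (add_mem hx hy), add_mul, map_add]
  · have hx := genAlg_mono (Nat.le_succ _) (hN x)
    rw [hval _ _ hx, hval _ _ (Subalgebra.smul_mem _ hx c), smul_mul_assoc, map_smul,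
      RingHom.id_apply]
  · set n := max (N x) (N y)
    have hx := genAlg_mono (le_max_left (N x) (N y)) (hN x)
    have hy := genAlg_mono (le_max_right (N x) (N y)) (hN y)
    have hx' := genAlg_mono (Nat.le_succ n) hx
    have hy' := genAlg_mono (Nat.le_succ n) hy
    have hfam := TLInf.isTLFamily δ (n + 3)
    have c : y * (TLInf.gen δ (n + 1) * TLInf.gen δ n) =
        TLInf.gen δ (n + 1) * TLInf.gen δ n * y :=
      (Commute.mul_right (hfam.commute_genAlg le_rfl (by omega) hy')
        (hfam.commute_genAlg le_rfl (by omega) hy)).eq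
    simp only [LinearMap.coe_mk, AddHom.coe_mk]
    rw [hval _ _ (mul_mem hx' hy'), hval _ _ (mul_mem hy' hx'), mul_assoc, c, ← mul_assoc, htr,
      ← mul_assoc]

theorem farTrace_endCups {χ ψ : TLInf δ →ₗ[ℂ] ℂ} (htr : ∀ x y, χ (x * y) = χ (y * x))
    (hψ : ∀ n, ∀ x ∈ genAlg (TLInf.gen δ) (n + 1),
      ψ x = χ (x * (TLInf.gen δ (n + 1) * TLInf.gen δ n))) (h0 : 0 < n ∨ δ ≠ 0) :
    χ (endCups δ (TLInf.gen δ) (n + 2) (k + 1)) = ψ (endCups δ (TLInf.gen δ) n k) := by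
  rw [endCups]
  rcases n with _ | n
  · have h0 : δ ≠ 0 := by simpa using h0
    rcases k with _ | k
    · rw [hψ 0 _ (genAlg_mono (Nat.zero_le 1) (endCups_mem 0 0))]
      have hfam := TLInf.isTLFamily δ 3
      have u := hfam.up 0 (by omega)
      have s := hfam.sq 0 (by omega)
      simp only [endCups, endCup, one_mul, map_smul]
      -- On two points the idempotent is δ⁻¹ e_0 instead of a pair of generators; under a trace it
      -- has the same value as e_1 e_0.
      have : χ (TLInf.gen δ 0) = δ • χ (TLInf.gen δ 1 * TLInf.gen δ 0) := by
        calc χ (TLInf.gen δ 0) = χ (TLInf.gen δ 0 * (TLInf.gen δ 1 * TLInf.gen δ 0)) := by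
              rw [← mul_assoc, u]
          _ = χ (TLInf.gen δ 1 * (TLInf.gen δ 0 * TLInf.gen δ 0)) := by rw [htr, mul_assoc]
          _ = δ • χ (TLInf.gen δ 1 * TLInf.gen δ 0) := by rw [s, mul_smul_comm, map_smul]
      rw [this, smul_smul, inv_mul_cancel₀ h0, one_smul]
    · simp [endCups]
  · exact (hψ n _ (endCups_mem _ _)).symm

theorem trace_endCups_eq {χ : TLInf δ →ₗ[ℂ] ℂ} (htr : ∀ x y, χ (x * y) = χ (y * x)) {m : ℕ}
    (hn : k ∈ irrLabels δ n) (hm : k ∈ irrLabels δ m) :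
    χ (endCups δ (TLInf.gen δ) n k) = χ (endCups δ (TLInf.gen δ) m k) := by
  induction k generalizing χ n m with
  | zero => simp [endCups]
  | succ k ih =>
    obtain ⟨n, rfl⟩ : ∃ d, n = d + 2 := ⟨n - 2, by have := (mem_irrLabels.1 hn).1; omega⟩
    obtain ⟨m, rfl⟩ : ∃ d, m = d + 2 := ⟨m - 2, by have := (mem_irrLabels.1 hm).1; omega⟩
    obtain ⟨h1, h2⟩ := irrLabels_pred hn
    obtain ⟨h3, h4⟩ := irrLabels_pred hm
    obtain ⟨ψ, hψtr, hψ⟩ := exists_farTrace htr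
    rw [farTrace_endCups htr hψ h2, farTrace_endCups htr hψ h4]
    exact ih hψtr h1 h3

theorem TLInf.linearMap_ext {f g : TLInf δ →ₗ[ℂ] ℂ}
    (h : ∀ n, f ∘ₗ (TL.incl δ n).toLinearMap = g ∘ₗ (TL.incl δ n).toLinearMap) : f = g := by
  ext x
  obtain ⟨n, hn⟩ := TLInf.exists_mem_genAlg x
  rw [← TL.range_incl] at hn
  obtain ⟨y, rfl⟩ := hn
  exact DFunLike.congr_fun (h n) y

/-- The functional has non-negative coefficients with respect to the traces `τ n i`. -/
def HasPosExpansion (I : ℕ → Finset ℕ) (τ : ∀ n, ℕ → TL δ n →ₗ[ℂ] ℂ) (ψ : TLInf δ →ₗ[ℂ] ℂ) : Prop :=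
  ∃ a : ℕ → ℕ → ℝ, (∀ n i, 0 ≤ a n i) ∧ IsExpansion I τ ψ fun n i => (a n i : ℂ)

variable {I : ℕ → Finset ℕ} {τ : ∀ n, ℕ → TL δ n →ₗ[ℂ] ℂ}

/-- For each n the value at 1 is a sum of coefficients times dimensions. If it vanishes, every
coefficient is zero or belongs to a zero trace. The condition `hτ` is what matrix traces provide in
both the standard and the irreducible setting. -/
theorem HasPosExpansion.apply_one {ψ : TLInf δ →ₗ[ℂ] ℂ} (h : HasPosExpansion I τ ψ)
    (hτ : ∀ n i, ∃ d : ℕ, τ n i 1 = d ∧ (d = 0 → τ n i = 0)) :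
    ∃ r : ℝ, 0 ≤ r ∧ ψ 1 = r ∧ (r = 0 → ψ = 0) := by
  obtain ⟨a, ha, hexp⟩ := h
  choose d hd hd0 using hτ
  have key : ∀ n, ψ 1 = ((∑ i ∈ I n, a n i * d n i : ℝ) : ℂ) := by
    intro n
    have := DFunLike.congr_fun (hexp n) 1
    simp only [LinearMap.comp_apply, AlgHom.toLinearMap_apply, map_one, LinearMap.coe_sum,
      Finset.sum_apply, LinearMap.smul_apply, hd, smul_eq_mul] at this
    rw [this]
    push_cast
    rfl
  refine ⟨_, Finset.sum_nonneg fun i _ => mul_nonneg (ha 0 i) (Nat.cast_nonneg _), key 0,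
    fun h0 => TLInf.linearMap_ext fun n => ?_⟩
  have hn : ∑ i ∈ I n, a n i * d n i = 0 := by
    have := (key n).symm.trans (key 0)
    rw [h0] at this
    exact_mod_cast this
  rw [Finset.sum_eq_zero_iff_of_nonneg
    fun i _ => mul_nonneg (ha n i) (Nat.cast_nonneg _)] at hn
  rw [hexp n, LinearMap.zero_comp]
  refine Finset.sum_eq_zero fun i hi => ?_
  rcases mul_eq_zero.1 (hn i hi) with h | h
  · simp [h]
  · rw [hd0 n i (by exact_mod_cast h), smul_zero]

theorem HasPosExpansion.smul {ψ : TLInf δ →ₗ[ℂ] ℂ} (h : HasPosExpansion I τ ψ) {r : ℝ}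
    (hr : 0 ≤ r) : HasPosExpansion I τ (r • ψ) := by
  obtain ⟨a, ha, hexp⟩ := h
  refine ⟨fun n i => r * a n i, fun n i => mul_nonneg hr (ha n i), fun n => ?_⟩
  rw [LinearMap.smul_comp, hexp n, Finset.smul_sum]
  refine Finset.sum_congr rfl fun i _ => ?_
  ext x
  simp [mul_assoc]

/-- An extreme point is proportional to every summand of a decomposition into traces with
non-negative coefficients. -/
theorem exists_eq_smul_of_extreme {χ ψ ψ' : TLInf δ →ₗ[ℂ] ℂ}
    (hτ : ∀ n i, ∃ d : ℕ, τ n i 1 = d ∧ (d = 0 → τ n i = 0))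
    (hχ : χ ∈ (positiveTraces I τ).extremePoints ℝ) (hsum : ψ + ψ' = χ)
    (htr : ∀ x y, ψ (x * y) = ψ (y * x)) (htr' : ∀ x y, ψ' (x * y) = ψ' (y * x))
    (h : HasPosExpansion I τ ψ) (h' : HasPosExpansion I τ ψ') :
    ∃ γ : ℝ, 0 ≤ γ ∧ ψ = γ • χ := by
  obtain ⟨hmem, hext⟩ := mem_extremePoints.1 hχ
  obtain ⟨r, hr, hr1, hr0⟩ := h.apply_one hτ
  obtain ⟨r', hr', hr1', hr0'⟩ := h'.apply_one hτ
  have hrr : r + r' = 1 := by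
    have := hmem.2.1
    rw [← hsum, LinearMap.add_apply, hr1, hr1'] at this
    exact_mod_cast this
  refine ⟨r, hr, ?_⟩
  by_cases h0 : r = 0
  · rw [hr0 h0, h0, zero_smul]
  by_cases h0' : r' = 0
  · rw [← hsum, hr0' h0', add_zero, show r = 1 by linarith, one_smul]
  have hscale : ∀ (φ : TLInf δ →ₗ[ℂ] ℂ) (s : ℝ), 0 ≤ s → s ≠ 0 → φ 1 = s →
      (∀ x y, φ (x * y) = φ (y * x)) → HasPosExpansion I τ φ → s⁻¹ • φ ∈ positiveTraces I τ := by
    intro φ s hs hs0 hs1 htr hpos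
    refine ⟨fun x y => ?_, ?_, hpos.smul (inv_nonneg.2 hs)⟩
    · rw [LinearMap.smul_apply, LinearMap.smul_apply, htr]
    · rw [LinearMap.smul_apply, hs1]
      simp [hs0]
  have := (hext _ (hscale ψ r hr h0 hr1 htr h) _ (hscale ψ' r' hr' h0' hr1' htr' h')
    ⟨r, r', lt_of_le_of_ne hr (Ne.symm h0), lt_of_le_of_ne hr' (Ne.symm h0'), hrr, by
      rw [smul_smul, smul_smul, mul_inv_cancel₀ h0, mul_inv_cancel₀ h0', one_smul, one_smul,
        hsum]⟩).1
  rw [← this, smul_smul, mul_inv_cancel₀ h0, one_smul]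

theorem exists_trace_one {A M : Type*} [Ring A] [Algebra ℂ A] [AddCommGroup M] [Module ℂ M]
    [FiniteDimensional ℂ M] (ρ : A →ₐ[ℂ] Module.End ℂ M) :
    ∃ d : ℕ, (LinearMap.trace ℂ M ∘ₗ ρ.toLinearMap) 1 = d ∧
      (d = 0 → LinearMap.trace ℂ M ∘ₗ ρ.toLinearMap = 0) := by
  refine ⟨Module.finrank ℂ M, by simp [LinearMap.trace_one], fun h => ?_⟩
  have := Module.finrank_zero_iff.1 h
  ext x
  simp [Subsingleton.elim (ρ x) 0]

/-! ### Cutting by idempotents that commute with a smaller algebra -/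

/-- As f commutes with TL_n, the image fM is a TL_n-module, and the trace of x f on M is the trace
of x on fM. -/
theorem exists_trace_corner_eq_sum {m : ℕ} (hnm : n ≤ m) {M : Type} [AddCommGroup M] [Module ℂ M]
    [FiniteDimensional ℂ M] (ρ : TL δ m →ₐ[ℂ] Module.End ℂ M) {f : TL δ m} (hf : f * f = f)
    (hc : ∀ x, Commute (TL.inclOfLE δ hnm x) f) :
    ∃ b : ℕ → ℕ, ∀ x : TL δ n, LinearMap.trace ℂ M (ρ (TL.inclOfLE δ hnm x * f)) =
      ∑ i ∈ irrLabels δ n, (b i : ℂ) * irrTrace δ n i x := by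
  have hinv : ∀ x, LinearMap.range (ρ f) ≤
      (LinearMap.range (ρ f)).comap (ρ.comp (TL.inclOfLE δ hnm) x) := by
    rintro x _ ⟨v, rfl⟩
    refine ⟨ρ (TL.inclOfLE δ hnm x) v, ?_⟩
    change (ρ f * ρ (TL.inclOfLE δ hnm x)) v = (ρ (TL.inclOfLE δ hnm x) * ρ f) v
    rw [← map_mul, ← map_mul, (hc x).eq]
  obtain ⟨b, hb⟩ := exists_trace_eq_sum_irrTrace
    (subRep (ρ.comp (TL.inclOfLE δ hnm)) (LinearMap.range (ρ f)) hinv)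
  refine ⟨b, fun x => ?_⟩
  rw [← hb]
  have hr : (ρ f).rangeRestrict ∘ₗ (LinearMap.range (ρ f)).subtype = LinearMap.id := by
    ext ⟨_, v, rfl⟩
    change (ρ f * ρ f) v = ρ f v
    rw [← map_mul, hf]
  have := trace_mul_of_section hr
    (g := ρ (TL.inclOfLE δ hnm x))
    (g' := subRep (ρ.comp (TL.inclOfLE δ hnm)) (LinearMap.range (ρ f)) hinv x) rfl
  rw [← this, map_mul]
  rfl

theorem endCup_mul_self (n : ℕ) :
    endCup δ (TL.gen δ (n + 3)) (n + 3) * endCup δ (TL.gen δ (n + 3)) (n + 3) =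
      endCup δ (TL.gen δ (n + 3)) (n + 3) := by
  simpa using (TL.isTLFamily δ (n + 3)).endCup_mul_endCup (m := n + 1) le_rfl
    (Or.inl (by omega)) (one_mem _)

/-- Three extra strands are used because the idempotent e_{n+1} e_n of TL_{n+3} commutes with TL_n,
whereas e_n e_{n-1} on two extra strands meets the generator e_{n-2}. -/
theorem commute_inclOfLE_endCup (x : TL δ n) :
    Commute (TL.inclOfLE δ (Nat.le_add_right n 3) x) (endCup δ (TL.gen δ (n + 3)) (n + 3)) := by
  have hx := TL.inclOfLE_mem (Nat.le_add_right n 3) x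
  have hfam := TL.isTLFamily δ (n + 3)
  exact Commute.mul_right
    (hfam.commute_genAlg le_rfl (by omega) (genAlg_mono (Nat.le_succ n) hx))
    (hfam.commute_genAlg le_rfl (by omega) hx)

theorem farTrace_incl {χ ψ : TLInf δ →ₗ[ℂ] ℂ}
    (hψ : ∀ n, ∀ x ∈ genAlg (TLInf.gen δ) (n + 1),
      ψ x = χ (x * (TLInf.gen δ (n + 1) * TLInf.gen δ n))) (x : TL δ n) :
    ψ (TL.incl δ n x) = χ (TL.incl δ (n + 3) (TL.inclOfLE δ (Nat.le_add_right n 3) x *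
      endCup δ (TL.gen δ (n + 3)) (n + 3))) := by
  have hx : TL.incl δ n x ∈ genAlg (TLInf.gen δ) n := by
    rw [← TL.range_incl]
    exact ⟨x, rfl⟩
  rw [hψ n _ (genAlg_mono (Nat.le_succ n) hx), map_mul (TL.incl δ (n + 3)), TL.incl_inclOfLE,
    map_endCup]
  simp only [endCup]
  rw [TL.incl_gen (by omega), TL.incl_gen (by omega)]

theorem HasPosExpansion.corner {χ ψ : TLInf δ →ₗ[ℂ] ℂ}
    (h : HasPosExpansion (irrLabels δ) (irrTrace δ) χ) (f : ∀ n, TL δ (n + 3))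
    (hf : ∀ n, f n * f n = f n)
    (hc : ∀ n x, Commute (TL.inclOfLE δ (Nat.le_add_right n 3) x) (f n))
    (hψ : ∀ n x, ψ (TL.incl δ n x) =
      χ (TL.incl δ (n + 3) (TL.inclOfLE δ (Nat.le_add_right n 3) x * f n))) :
    HasPosExpansion (irrLabels δ) (irrTrace δ) ψ := by
  obtain ⟨a, ha, hexp⟩ := h
  choose b hb using fun n j =>
    exists_trace_corner_eq_sum (Nat.le_add_right n 3) (irrRep δ (n + 3) j) (hf n) (hc n)
  refine ⟨fun n i => ∑ j ∈ irrLabels δ (n + 3), a (n + 3) j * b n j i,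
    fun n i => Finset.sum_nonneg fun j _ => mul_nonneg (ha _ _) (Nat.cast_nonneg _), fun n => ?_⟩
  ext x
  have := DFunLike.congr_fun (hexp (n + 3)) (TL.inclOfLE δ (Nat.le_add_right n 3) x * f n)
  simp only [LinearMap.comp_apply, AlgHom.toLinearMap_apply, LinearMap.coe_sum, Finset.sum_apply,
    LinearMap.smul_apply, smul_eq_mul] at this ⊢
  rw [hψ, this]
  have hj : ∀ j, irrTrace δ (n + 3) j (TL.inclOfLE δ (Nat.le_add_right n 3) x * f n) =
      ∑ i ∈ irrLabels δ n, (b n j i : ℂ) * irrTrace δ n i x := fun j => hb n j x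
  simp only [hj, Finset.mul_sum]
  rw [Finset.sum_comm]
  refine Finset.sum_congr rfl fun i _ => ?_
  push_cast
  rw [Finset.sum_mul]
  exact Finset.sum_congr rfl fun j _ => by ring

theorem corner_mem_irrSpan {m : ℕ} (hnm : n ≤ m) {g : TL δ m →ₗ[ℂ] ℂ} (hg : g ∈ irrSpan δ m)
    {f : TL δ m} (hf : f * f = f) (hc : ∀ x, Commute (TL.inclOfLE δ hnm x) f)
    {g' : TL δ n →ₗ[ℂ] ℂ} (h : ∀ x, g' x = g (TL.inclOfLE δ hnm x * f)) : g' ∈ irrSpan δ n := by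
  obtain ⟨μ, rfl⟩ := mem_irrSpan.1 hg
  choose b hb using fun j => exists_trace_corner_eq_sum hnm (irrRep δ m j) hf hc
  refine mem_irrSpan.2 ⟨fun i => ∑ j ∈ irrLabels δ m, μ j * b j i, ?_⟩
  ext x
  have hj : ∀ j, irrTrace δ m j (TL.inclOfLE δ hnm x * f) =
      ∑ i ∈ irrLabels δ n, (b j i : ℂ) * irrTrace δ n i x := fun j => hb j x
  simp only [h, LinearMap.coe_sum, Finset.sum_apply, LinearMap.smul_apply, smul_eq_mul, hj,
    Finset.mul_sum, Finset.sum_mul]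
  rw [Finset.sum_comm]
  exact Finset.sum_congr rfl fun i _ => Finset.sum_congr rfl fun j _ => by ring

end

/-! ### Positivity of the far trace and moments of extremal traces -/

section
variable {δ : ℂ} {n k : ℕ}

theorem IsExpansion.mem_irrSpan_of_std {χ : TLInf δ →ₗ[ℂ] ℂ} {a : ℕ → ℕ → ℂ}
    (h : IsExpansion stdLabels (stdTrace δ) χ a) (n : ℕ) :
    χ ∘ₗ (TL.incl δ n).toLinearMap ∈ irrSpan δ n := by
  rw [h n]
  exact sum_mem fun i _ => Submodule.smul_mem _ _ stdTrace_mem_irrSpan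

theorem IsExpansion.mem_irrSpan_of_irr {χ : TLInf δ →ₗ[ℂ] ℂ} {a : ℕ → ℕ → ℂ}
    (h : IsExpansion (irrLabels δ) (irrTrace δ) χ a) (n : ℕ) :
    χ ∘ₗ (TL.incl δ n).toLinearMap ∈ irrSpan δ n := by
  rw [h n]
  exact mem_irrSpan.2 ⟨_, rfl⟩

theorem IsExpansion.apply_endCups {χ : TLInf δ →ₗ[ℂ] ℂ} {a : ℕ → ℕ → ℂ}
    (h : IsExpansion stdLabels (stdTrace δ) χ a) (hk : k ∈ irrLabels δ n) :
    χ (endCups δ (TLInf.gen δ) n k) = ∑ i ∈ stdLabels n, a n i * cupCount n k i := by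
  have := DFunLike.congr_fun (h n) (endCups δ (TL.gen δ n) n k)
  simp only [LinearMap.comp_apply, AlgHom.toLinearMap_apply, LinearMap.coe_sum, Finset.sum_apply,
    LinearMap.smul_apply, smul_eq_mul, stdTrace_endCups_eq hk, TL.incl_endCups] at this
  exact this

/-- A functional whose restrictions are combinations of irreducible traces has the expansion in
standard traces that gives the right values on the idempotents with `k` cups. -/
theorem comp_incl_eq_sum_stdTrace {χ : TLInf δ →ₗ[ℂ] ℂ} {a : ℕ → ℂ}
    (h : χ ∘ₗ (TL.incl δ n).toLinearMap ∈ irrSpan δ n)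
    (hval : ∀ k ∈ irrLabels δ n,
      χ (endCups δ (TLInf.gen δ) n k) = ∑ i ∈ stdLabels n, a i * cupCount n k i) :
    χ ∘ₗ (TL.incl δ n).toLinearMap = ∑ i ∈ stdLabels n, a i • stdTrace δ n i := by
  refine irrSpan_ext h (sum_mem fun i _ => Submodule.smul_mem _ _ stdTrace_mem_irrSpan)
    fun k hk => ?_
  simp only [LinearMap.comp_apply, AlgHom.toLinearMap_apply, LinearMap.coe_sum, Finset.sum_apply,
    LinearMap.smul_apply, smul_eq_mul, stdTrace_endCups_eq hk, TL.incl_endCups]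
  exact hval k hk

theorem hasPosExpansion_of_pos {ψ : TLInf δ →ₗ[ℂ] ℂ} (hψ : ∃ r : ℝ, 0 ≤ r ∧ ψ 1 = r)
    (h : ∀ n, 0 < n → ∃ b : ℕ → ℝ, (∀ i, 0 ≤ b i) ∧
      ψ ∘ₗ (TL.incl δ n).toLinearMap = ∑ i ∈ stdLabels n, (b i : ℂ) • stdTrace δ n i) :
    HasPosExpansion stdLabels (stdTrace δ) ψ := by
  obtain ⟨r, hr, hr1⟩ := hψ
  have h' : ∀ n, ∃ b : ℕ → ℝ, (∀ i, 0 ≤ b i) ∧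
      ψ ∘ₗ (TL.incl δ n).toLinearMap = ∑ i ∈ stdLabels n, (b i : ℂ) • stdTrace δ n i := by
    intro n
    -- The case n = 0 is separate since passing from 0 to 2 points requires δ ≠ 0; here TL_0
    -- consists of scalars.
    rcases Nat.eq_zero_or_pos n with rfl | hn
    · refine ⟨fun _ => r, fun _ => hr, ?_⟩
      ext x
      have hx : x ∈ genAlg (TL.gen δ 0) 0 := by rw [TL.genAlg_eq_top]; trivial
      have hbot : genAlg (TL.gen δ 0) 0 = ⊥ := by simp [genAlg]
      rw [hbot, Algebra.mem_bot] at hx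
      obtain ⟨c, rfl⟩ := hx
      have hcard := stdTrace_endCups_self (δ := δ) (n := 0) (p := 0)
        (mem_irrLabels.2 ⟨le_rfl, fun _ h => absurd h (lt_irrefl 0)⟩)
      simp only [endCups] at hcard
      simp [stdLabels, Algebra.algebraMap_eq_smul_one, hr1, hcard]
    · exact h n hn
  choose b hb hexp using h'
  exact ⟨b, hb, hexp⟩

/-- Coefficients are found by matching values on the idempotents: ψ has coefficients a_{n+2,i+1} on
TL_n. In the restriction of V_{n+2,i}, the branching rule leaves for χ - ψ only non-negative
combinations of the a_{n+2,j}. -/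
theorem HasPosExpansion.farTrace_std {χ ψ : TLInf δ →ₗ[ℂ] ℂ}
    (htr : ∀ x y, χ (x * y) = χ (y * x)) (h : HasPosExpansion stdLabels (stdTrace δ) χ)
    (hψ : ∀ n, ∀ x ∈ genAlg (TLInf.gen δ) (n + 1),
      ψ x = χ (x * (TLInf.gen δ (n + 1) * TLInf.gen δ n))) :
    HasPosExpansion stdLabels (stdTrace δ) ψ ∧ HasPosExpansion stdLabels (stdTrace δ) (χ - ψ) := by
  obtain ⟨a, ha, hexp⟩ := h
  have hspan : ∀ n, ψ ∘ₗ (TL.incl δ n).toLinearMap ∈ irrSpan δ n := fun n =>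
    corner_mem_irrSpan (Nat.le_add_right n 3) (hexp.mem_irrSpan_of_std (n + 3)) (endCup_mul_self n)
      commute_inclOfLE_endCup fun x => farTrace_incl hψ x
  have hval : ∀ n k, k ∈ irrLabels δ n → 0 < n → ψ (endCups δ (TLInf.gen δ) n k) =
      ∑ i ∈ stdLabels n, (a (n + 2) (i + 1) : ℂ) * cupCount n k i := by
    intro n k hk hn
    rw [← farTrace_endCups htr hψ (Or.inl hn),
      hexp.apply_endCups (irrLabels_succ hk (Or.inl hn)), sum_mul_cupCount_succ]
  have hval' : ∀ n k, k ∈ irrLabels δ n → 0 < n → (χ - ψ) (endCups δ (TLInf.gen δ) n k) =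
      ∑ j ∈ stdLabels n, ((a (n + 2) j + (if 2 * j < n then a (n + 2) (j + 1) else 0) +
        (if 2 * (j + 2) ≤ n + 2 then a (n + 2) (j + 2) else 0) : ℝ) : ℂ) * cupCount n k j := by
    intro n k hk hn
    have hk2 := (mem_irrLabels.1 hk).1
    have hk' : k ∈ irrLabels δ (n + 2) := mem_irrLabels.2 ⟨by omega, fun h => by omega⟩
    rw [LinearMap.sub_apply, hval n k hk hn, trace_endCups_eq htr hk hk', hexp.apply_endCups hk',
      sum_mul_cupCount_add_two _ hk2, add_sub_cancel_right]
    simp only [Complex.ofReal_add, apply_ite Complex.ofReal, Complex.ofReal_zero]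
  have h1 : (1 : TLInf δ) = endCups δ (TLInf.gen δ) 1 0 := by simp [endCups]
  have hmem : 0 ∈ irrLabels δ 1 := mem_irrLabels.2 ⟨by omega, fun h => by omega⟩
  have hb : ∀ n j, 0 ≤ a (n + 2) j + (if 2 * j < n then a (n + 2) (j + 1) else 0) +
        (if 2 * (j + 2) ≤ n + 2 then a (n + 2) (j + 2) else 0) := by
    intro n j
    refine add_nonneg (add_nonneg (ha _ _) ?_) ?_ <;> split_ifs <;>
      first | exact ha _ _ | exact le_rfl
  have hreal : ∀ (b : ℕ → ℝ) (n : ℕ), (∀ i, 0 ≤ b i) → ∃ r : ℝ, 0 ≤ r ∧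
      ∑ i ∈ stdLabels n, (b i : ℂ) * cupCount n 0 i = r := fun b n hb =>
    ⟨∑ i ∈ stdLabels n, b i * cupCount n 0 i,
      Finset.sum_nonneg fun i _ => mul_nonneg (hb i) (Nat.cast_nonneg _), by push_cast; rfl⟩
  refine ⟨hasPosExpansion_of_pos ?_ fun n hn => ⟨fun i => a (n + 2) (i + 1), fun i => ha _ _,
    comp_incl_eq_sum_stdTrace (hspan n) fun k hk => hval n k hk hn⟩,
    hasPosExpansion_of_pos ?_ fun n hn => ⟨_, hb n, comp_incl_eq_sum_stdTrace ?_
      fun k hk => hval' n k hk hn⟩⟩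
  · rw [h1, hval 1 0 hmem one_pos]
    exact hreal _ _ fun i => ha _ _
  · rw [h1, hval' 1 0 hmem one_pos]
    exact hreal _ _ (hb 1)
  · rw [LinearMap.sub_comp]
    exact sub_mem (hexp.mem_irrSpan_of_std n) (hspan n)

/-- The functionals ψ and χ - ψ are the corners of χ by the complementary idempotents f and 1 - f.
-/
theorem HasPosExpansion.farTrace_irr {χ ψ : TLInf δ →ₗ[ℂ] ℂ}
    (h : HasPosExpansion (irrLabels δ) (irrTrace δ) χ)
    (hψ : ∀ n, ∀ x ∈ genAlg (TLInf.gen δ) (n + 1),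
      ψ x = χ (x * (TLInf.gen δ (n + 1) * TLInf.gen δ n))) :
    HasPosExpansion (irrLabels δ) (irrTrace δ) ψ ∧
      HasPosExpansion (irrLabels δ) (irrTrace δ) (χ - ψ) := by
  refine ⟨h.corner (fun n => endCup δ (TL.gen δ (n + 3)) (n + 3)) endCup_mul_self
    (fun n x => commute_inclOfLE_endCup x) fun n x => farTrace_incl hψ x,
    h.corner (fun n => 1 - endCup δ (TL.gen δ (n + 3)) (n + 3))
      (fun n => (IsIdempotentElem.one_sub (endCup_mul_self n)))
      (fun n x => (Commute.one_right _).sub_right (commute_inclOfLE_endCup x)) fun n x => ?_⟩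
  rw [LinearMap.sub_apply, farTrace_incl hψ, mul_sub, mul_one, map_sub, map_sub, TL.incl_inclOfLE]

/-- The moments of an extremal trace are the powers of a number. -/
theorem exists_moment {χ : TLInf δ →ₗ[ℂ] ℂ} (hχ : IsExtremalStd χ ∨ IsExtremalIrr χ) :
    (∀ n, χ ∘ₗ (TL.incl δ n).toLinearMap ∈ irrSpan δ n) ∧
    ∃ γ : ℝ, 0 ≤ γ ∧ ∀ n, ∀ k ∈ irrLabels δ n, χ (endCups δ (TLInf.gen δ) n k) = (γ : ℂ) ^ k := by
  have main : ∀ (I : ℕ → Finset ℕ) (τ : ∀ n, ℕ → TL δ n →ₗ[ℂ] ℂ),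
      (∀ n i, ∃ d : ℕ, τ n i 1 = d ∧ (d = 0 → τ n i = 0)) →
      χ ∈ (positiveTraces I τ).extremePoints ℝ →
      (∀ ψ : TLInf δ →ₗ[ℂ] ℂ, (∀ x y, χ (x * y) = χ (y * x)) → HasPosExpansion I τ χ →
        (∀ n, ∀ x ∈ genAlg (TLInf.gen δ) (n + 1),
          ψ x = χ (x * (TLInf.gen δ (n + 1) * TLInf.gen δ n))) →
        HasPosExpansion I τ ψ ∧ HasPosExpansion I τ (χ - ψ)) →
      ∃ γ : ℝ, 0 ≤ γ ∧
        ∀ n, ∀ k ∈ irrLabels δ n, χ (endCups δ (TLInf.gen δ) n k) = (γ : ℂ) ^ k := by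
    intro I τ hτ hext hfar
    obtain ⟨htr, hone, hpos⟩ := hext.1
    obtain ⟨ψ, hψtr, hψ⟩ := exists_farTrace htr
    obtain ⟨h1, h2⟩ := hfar ψ htr hpos hψ
    obtain ⟨γ, hγ, hγψ⟩ := exists_eq_smul_of_extreme hτ hext (add_sub_cancel ψ χ) hψtr
      (fun x y => by rw [LinearMap.sub_apply, LinearMap.sub_apply, htr, hψtr]) h1 h2
    refine ⟨γ, hγ, fun n k => ?_⟩
    induction k generalizing n with
    | zero => simp [endCups, hone]
    | succ k ih =>
      intro hk
      obtain ⟨n, rfl⟩ : ∃ m, n = m + 2 := ⟨n - 2, by have := (mem_irrLabels.1 hk).1; omega⟩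
      obtain ⟨h1, h2⟩ := irrLabels_pred hk
      rw [farTrace_endCups htr hψ h2, hγψ, LinearMap.smul_apply, ih n h1, pow_succ']
      simp
  rcases hχ with hχ | hχ
  · have h2 := main _ _ (fun n i => exists_trace_one (stdRep δ n i)) hχ
      fun ψ htr hpos hψ => hpos.farTrace_std htr hψ
    obtain ⟨a, -, hexp⟩ := hχ.1.2.2
    exact ⟨hexp.mem_irrSpan_of_std, h2⟩
  · have h2 := main _ _ (fun n i => exists_trace_one (irrRep δ n i)) hχ
      fun ψ htr hpos hψ => hpos.farTrace_irr hψ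
    obtain ⟨a, -, hexp⟩ := hχ.1.2.2
    exact ⟨hexp.mem_irrSpan_of_irr, h2⟩

theorem le_quarter_of_hasPosExpansion {χ : TLInf δ →ₗ[ℂ] ℂ} {γ : ℝ} (hγ : 0 ≤ γ)
    (h : HasPosExpansion stdLabels (stdTrace δ) χ)
    (hval : ∀ n, ∀ k ∈ irrLabels δ n, χ (endCups δ (TLInf.gen δ) n k) = (γ : ℂ) ^ k) :
    γ ≤ 1 / 4 := by
  obtain ⟨a, ha, hexp⟩ := h
  -- For odd n no label is omitted whatever δ is, so the standard coefficients are unique and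
  -- a_{n,0} = c_{n,0}(γ). Even n follow from c_{n,0} = c_{n+1,0} + γ c_{n-1,0}.
  have hodd : ∀ m, 0 ≤ (genTop (γ : ℂ) (2 * m + 1)).re := by
    intro m
    have hlab : ∀ k ∈ stdLabels (2 * m + 1), k ∈ irrLabels δ (2 * m + 1) := fun k hk =>
      mem_irrLabels.2 ⟨mem_stdLabels.1 hk, fun h => by omega⟩
    have h0 := eq_zero_of_unitriangular (s := stdLabels (2 * m + 1))
      (C := fun i k => (cupCount (2 * m + 1) k i : ℂ))
      (μ := fun i => (a (2 * m + 1) i : ℂ) - genCoeff γ (2 * m + 1) i)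
      (fun k _ => by simp [cupCount]) (fun k _ i hi => by simp [cupCount, not_le.2 hi])
      (fun k hk => by
        simp only [sub_mul, Finset.sum_sub_distrib]
        rw [← hexp.apply_endCups (hlab k hk), hval _ k (hlab k hk),
          sum_genCoeff_mul_cupCount _ (mem_stdLabels.1 hk), sub_self])
      (mem_stdLabels.2 (Nat.zero_le _) : 0 ∈ stdLabels (2 * m + 1))
    have h1 : genTop (γ : ℂ) (2 * m + 1) = a (2 * m + 1) 0 := by
      simpa [genCoeff] using (sub_eq_zero.1 h0).symm
    rw [h1, Complex.ofReal_re]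
    exact ha _ _
  refine le_quarter_of_genTop_nonneg fun n => ?_
  rcases Nat.even_or_odd' n with ⟨m, rfl | rfl⟩
  · rcases m with _ | m
    · simp [genTop]
    · have h1 := hodd (m + 1)
      have h2 := mul_nonneg hγ (hodd m)
      rw [show 2 * (m + 1) + 1 = 2 * m + 1 + 2 by ring, genTop] at h1
      simp only [Complex.sub_re, Complex.re_ofReal_mul] at h1
      rw [show 2 * (m + 1) = 2 * m + 1 + 1 by ring]
      linarith
  · exact hodd m

/-- All other labels are smaller than k, so their irreducible traces vanish on the idempotent with k
cups. -/
theorem top_coeff {χ : TLInf δ →ₗ[ℂ] ℂ} {lam : ℕ → ℕ → ℂ}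
    (h : IsExpansion (irrLabels δ) (irrTrace δ) χ lam) (hk : k ∈ irrLabels δ n)
    (hmax : n < 2 * (k + 1)) : lam n k = χ (endCups δ (TLInf.gen δ) n k) := by
  have := DFunLike.congr_fun (h n) (endCups δ (TL.gen δ n) n k)
  simp only [LinearMap.comp_apply, AlgHom.toLinearMap_apply, LinearMap.coe_sum, Finset.sum_apply,
    LinearMap.smul_apply, smul_eq_mul, TL.incl_endCups] at this
  rw [this, Finset.sum_eq_single k, irrTrace_endCups_self hk, mul_one]
  · intro i hi hik
    have := (mem_irrLabels.1 hi).1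
    rw [irrTrace_endCups_of_lt (by omega), mul_zero]
  · exact fun h => absurd hk h

/-- If δ = 0 then q² = -1 and q⁴ = 1, so that l ≤ 2. -/
theorem add_inv_ne_zero {q : ℂ} {l : ℕ} (hl : 3 ≤ l)
    (hq : IsLeast {k : ℕ | 0 < k ∧ q ^ (2 * k) = 1} l) : q + q⁻¹ ≠ 0 := by
  intro h
  have hq0 : q ≠ 0 := by
    rintro rfl
    have := hq.1.2
    rw [zero_pow (by omega)] at this
    exact zero_ne_one this
  have h2 : q ^ 2 = -1 := by
    have : q * (q + q⁻¹) = 0 := by rw [h, mul_zero]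
    rw [mul_add, mul_inv_cancel₀ hq0] at this
    linear_combination this
  have := hq.2 (show 2 ∈ {k : ℕ | 0 < k ∧ q ^ (2 * k) = 1} from
    ⟨two_pos, by rw [pow_mul, h2]; norm_num⟩)
  omega

end

/-! ### The main theorem -/

theorem mainTheorem11 (q : ℂ) (l : ℕ) (hl : 2 ≤ l)
    (hq : IsLeast {k : ℕ | 0 < k ∧ q ^ (2 * k) = 1} l)
    (χ : TLInf (q + q⁻¹) →ₗ[ℂ] ℂ) (hχ : IsExtremalStd χ ∨ IsExtremalIrr χ) :
    (∃ lam : ℕ → ℕ → ℂ, IsExpansion (irrLabels (q + q⁻¹)) (irrTrace (q + q⁻¹)) χ lam) ∧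
    ∃ γ : ℝ, 0 ≤ γ ∧ (IsExtremalStd χ → γ ≤ 1 / 4) ∧
      IsExpansion stdLabels (stdTrace (q + q⁻¹)) χ (genCoeff (γ : ℂ)) ∧
      ∀ lam : ℕ → ℕ → ℂ, IsExpansion (irrLabels (q + q⁻¹)) (irrTrace (q + q⁻¹)) χ lam →
        (l = 2 → ∀ n : ℕ, lam (2 * n + 1) n = genCoeff (γ : ℂ) (2 * n + 1) n) ∧
        (3 ≤ l → ∀ n : ℕ, lam (2 * n) n = genCoeff (γ : ℂ) (2 * n) n) := by
  obtain ⟨hspan, γ, hγ, hval⟩ := exists_moment hχ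
  refine ⟨?_, γ, hγ, fun h => le_quarter_of_hasPosExpansion hγ h.1.2.2 hval, fun n => ?_,
    fun lam hlam => ⟨fun _ n => ?_, fun hl3 n => ?_⟩⟩
  · choose μ hμ using fun n => mem_irrSpan.1 (hspan n)
    exact ⟨μ, hμ⟩
  · refine comp_incl_eq_sum_stdTrace (hspan n) fun k hk => ?_
    rw [hval n k hk, sum_genCoeff_mul_cupCount _ (mem_irrLabels.1 hk).1]
  · have hk : n ∈ irrLabels (q + q⁻¹) (2 * n + 1) :=
      mem_irrLabels.2 ⟨by omega, fun h => by omega⟩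
    rw [top_coeff hlam hk (by omega), hval _ _ hk, genCoeff, Nat.add_sub_cancel_left, genTop,
      mul_one]
  -- The label n of TL_{2n} is available for positive n because δ ≠ 0 when l ≥ 3.
  · have hk : n ∈ irrLabels (q + q⁻¹) (2 * n) :=
      mem_irrLabels.2 ⟨le_rfl, fun _ _ => add_inv_ne_zero hl3 hq⟩
    rw [top_coeff hlam hk (by omega), hval _ _ hk, genCoeff, Nat.sub_self, genTop, mul_one]
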